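/- Let $d\ge 2$ and let $\mathbb{H}^d$ be the $d$-dimensional hyperbolic space of constant sectional curvature $-1$, realised as the upper half-space $\{x\in\mathbb{R}^d : x_d>0\}$ with distance $d_1(x,y)=\operatorname{arcosh}\bigl(1+\tfrac{|x-y|^2}{2x_dy_d}\bigr)$, where $|\cdot|$ is the Euclidean norm, and with the hyperbolic volume $\mathcal{H}^d_1(\mathrm{d}x)=x_d^{-d}\,\mathrm{d}x$ (which is the $d$-dimensional Hausdorff measure of $d_1$). Fix a point $o\in\mathbb{H}^d$, let $B^d(o,R)$ be the open ball of radius $R$ around $o$, and put $V_1(R)=\mathcal{H}^d_1(B^d(o,R))$. For $\gamma>0$ let $\eta$ be a stationary Poisson process on $\mathbb{H}^d$ with intensity $\gamma$, i.e. a random locally finite subset of $\mathbb{H}^d$ such that for every Borel set $B$ the number of points of $\eta$ in $B$ is Poisson distributed with mean $\gamma\mathcal{H}^d_1(B)$ (almost surely infinite if $\mathcal{H}^d_1(B)=\infty$), and such that the numbers of points in finitely many pairwise disjoint Borel sets are independent. For $x\in\eta\setminus\{o\}$ let $n(x,\eta)$ be the radial nearest neighbour of $x$, i.e. a point of $\eta\cup\{o\}$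 that minimises the distance to $x$ among all $y\in\eta\cup\{o\}$ with $d_1(o,y)<d_1(o,x)$. For $\alpha>0$ and $R>0$ consider the edge-length functional $$\mathcal{L}^{(\alpha)}_{R,\gamma,1}=\sum_{x\in\eta\cap B^d(o,R)} d_1(x,n(x,\eta))^{\alpha}$$ (a point of $\eta$ at $o$, which almost surely does not exist, contributes $0$). Let $\alpha>0$ and $c_0>0$. Then there are constants $c_\ell,c_u>0$ and $r_0>0$, depending only on $d$, $\alpha$ and $c_0$, such that for all $\gamma\ge c_0$ and all $R\ge r_0$ the random variable $\mathcal{L}^{(\alpha)}_{R,\gamma,1}$ is square integrable and $$c_\ell\,\gamma^{1-2\alpha/d}\,V_1(R)\;\le\;\operatorname{Var}\bigl[\mathcal{L}^{(\alpha)}_{R,\gamma,1}\bigr]\;\le\;c_u\,\gamma^{1-2\alpha/d}\,V_1(R).$$ -/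

import Mathlib

open MeasureTheory ProbabilityTheory Topology

noncomputable section

/-- The upper half-space model of the `d`-dimensional hyperbolic space of curvature `-1`: the points
of `ℝ^d` whose last coordinate is positive. -/
@[ext]
structure HypSpace (d : ℕ) [NeZero d] where
  /-- the underlying point of `ℝ^d` -/
  coord : EuclideanSpace ℝ (Fin d)
  pos : 0 < coord ⊤

namespace HypSpace

variable {d : ℕ} [NeZero d]

/-- The last coordinate. -/
def height (x : HypSpace d) : ℝ := x.coord ⊤

theorem height_pos (x : HypSpace d) : 0 < x.height := x.pos

/-- The hyperbolic distance `arcosh (1 + |x - y|² / (2 x_d y_d))`, with `|·|` the Euclidean norm. -/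
instance : Dist (HypSpace d) :=
  ⟨fun x y => Real.arcosh (1 + ‖x.coord - y.coord‖ ^ 2 / (2 * x.height * y.height))⟩

theorem dist_def (x y : HypSpace d) :
    dist x y = Real.arcosh (1 + ‖x.coord - y.coord‖ ^ 2 / (2 * x.height * y.height)) := rfl

theorem one_le_arg (x y : HypSpace d) :
    1 ≤ 1 + ‖x.coord - y.coord‖ ^ 2 / (2 * x.height * y.height) := by
  have := x.height_pos
  have := y.height_pos
  have : 0 ≤ ‖x.coord - y.coord‖ ^ 2 / (2 * x.height * y.height) := by positivity
  linarith

theorem dist_nonneg_aux (x y : HypSpace d) : 0 ≤ dist x y :=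
  Real.arcosh_nonneg (one_le_arg x y)

theorem cosh_dist (x y : HypSpace d) :
    Real.cosh (dist x y) = 1 + ‖x.coord - y.coord‖ ^ 2 / (2 * x.height * y.height) :=
  Real.cosh_arcosh (one_le_arg x y)

theorem sinh_half_dist (x y : HypSpace d) :
    Real.sinh (dist x y / 2) =
      ‖x.coord - y.coord‖ / (2 * (√x.height * √y.height)) := by
  have hx := x.height_pos
  have hy := y.height_pos
  have h0 : 0 ≤ Real.sinh (dist x y / 2) :=
    Real.sinh_nonneg_iff.2 (by have := dist_nonneg_aux x y; linarith)
  rw [← sq_eq_sq₀ h0 (by positivity), div_pow, mul_pow, mul_pow, Real.sq_sqrt hx.le,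
    Real.sq_sqrt hy.le]
  have h1 := cosh_dist x y
  have h2 : Real.cosh (dist x y) = 1 + 2 * Real.sinh (dist x y / 2) ^ 2 := by
    have h3 := Real.cosh_two_mul (dist x y / 2)
    rw [mul_div_cancel₀ _ (two_ne_zero' ℝ), Real.cosh_sq] at h3
    linarith
  have h4 : ‖x.coord - y.coord‖ ^ 2 / (2 ^ 2 * (x.height * y.height)) =
      (‖x.coord - y.coord‖ ^ 2 / (2 * x.height * y.height)) / 2 := by
    field_simp
    try norm_num
  rw [h4]
  linarith

/-- The mirror image of a point in the boundary hyperplane. -/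
def mirror (x : HypSpace d) : EuclideanSpace ℝ (Fin d) :=
  x.coord - EuclideanSpace.single ⊤ (2 * x.height)

theorem norm_sub_mirror_sq (x y : HypSpace d) :
    ‖x.coord - y.mirror‖ ^ 2 = ‖x.coord - y.coord‖ ^ 2 + 4 * (x.height * y.height) := by
  have h : x.coord - y.mirror =
      (x.coord - y.coord) + EuclideanSpace.single ⊤ (2 * y.height) := by
    simp only [mirror]; abel
  rw [h, norm_add_sq_real, EuclideanSpace.inner_single_right, EuclideanSpace.single,
    PiLp.norm_single]
  simp only [height, Real.norm_eq_abs, sq_abs, PiLp.sub_apply, conj_trivial]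
  ring

theorem cosh_half_dist (x y : HypSpace d) :
    Real.cosh (dist x y / 2) =
      ‖x.coord - y.mirror‖ / (2 * (√x.height * √y.height)) := by
  have hx := x.height_pos
  have hy := y.height_pos
  rw [← sq_eq_sq₀ (Real.cosh_pos _).le (by positivity), Real.cosh_sq, sinh_half_dist, div_pow,
    div_pow, norm_sub_mirror_sq, mul_pow, mul_pow, Real.sq_sqrt hx.le, Real.sq_sqrt hy.le]
  field_simp
  ring

theorem norm_sub_mirror_comm (x y : HypSpace d) :
    ‖x.coord - y.mirror‖ = ‖y.coord - x.mirror‖ := by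
  rw [← sq_eq_sq₀ (norm_nonneg _) (norm_nonneg _), norm_sub_mirror_sq, norm_sub_mirror_sq,
    norm_sub_rev, mul_comm x.height]

theorem norm_self_sub_mirror (x : HypSpace d) : ‖x.coord - x.mirror‖ = 2 * x.height := by
  have hx := x.height_pos
  rw [← sq_eq_sq₀ (norm_nonneg _) (by positivity), norm_sub_mirror_sq]
  simp
  ring

theorem dist_triangle_aux (x y z : HypSpace d) : dist x z ≤ dist x y + dist y z := by
  have hx := Real.sqrt_pos.2 x.height_pos
  have hy := Real.sqrt_pos.2 y.height_pos
  have hz := Real.sqrt_pos.2 z.height_pos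
  have hP := EuclideanGeometry.mul_dist_le_mul_dist_add_mul_dist x.coord y.coord z.coord y.mirror
  simp only [dist_eq_norm] at hP
  rw [norm_self_sub_mirror, norm_sub_mirror_comm z y] at hP
  have hle : Real.sinh (dist x z / 2) ≤ Real.sinh (dist x y / 2 + dist y z / 2) := by
    rw [Real.sinh_add, sinh_half_dist, sinh_half_dist, sinh_half_dist, cosh_half_dist,
      cosh_half_dist, div_mul_div_comm, div_mul_div_comm,
      show 2 * (√x.height * √y.height) * (2 * (√y.height * √z.height)) =
        2 * (√x.height * √z.height) * (2 * (√y.height * √y.height)) by ring,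
      Real.mul_self_sqrt y.height_pos.le, ← add_div]
    have := y.height_pos
    rw [div_le_div_iff₀ (by positivity) (by positivity)]
    have h2 : 0 ≤ 2 * (√x.height * √z.height) := by positivity
    nlinarith [mul_le_mul_of_nonneg_left hP h2]
  have := Real.sinh_le_sinh.1 hle
  linarith

/-- The metric space structure, with a topology still to be compared with the Euclidean one. -/
@[reducible]
def metricSpaceAux : MetricSpace (HypSpace d) where
  dist := dist
  dist_self x := by simp [dist_def]
  dist_comm x y := by
    rw [dist_def, dist_def, norm_sub_rev, mul_assoc, mul_assoc, mul_comm x.height]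
  dist_triangle := dist_triangle_aux
  eq_of_dist_eq_zero {x y} h := by
    have h1 := sinh_half_dist x y
    have hx := Real.sqrt_pos.2 x.height_pos
    have hy := Real.sqrt_pos.2 y.height_pos
    rw [h, zero_div, Real.sinh_zero, eq_comm, div_eq_zero_iff] at h1
    rcases h1 with h1 | h1
    · exact HypSpace.ext (sub_eq_zero.1 (norm_eq_zero.1 h1))
    · exact absurd h1 (by positivity)

theorem norm_sub_le (x y : HypSpace d) :
    ‖x.coord - y.coord‖ ≤ 4 * Real.sinh (dist x y / 2) ^ 2 * y.height +
      2 * Real.sinh (dist x y / 2) * y.height := by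
  have hx := x.height_pos
  have hy := y.height_pos
  have hs := sinh_half_dist x y
  have h0 : 0 ≤ Real.sinh (dist x y / 2) :=
    Real.sinh_nonneg_iff.2 (by have := dist_nonneg_aux x y; linarith)
  have he := norm_nonneg (x.coord - y.coord)
  have hxy : x.height ≤ y.height + ‖x.coord - y.coord‖ := by
    have := PiLp.norm_apply_le (x.coord - y.coord) ⊤
    have := (le_abs_self _).trans this
    simp only [PiLp.sub_apply] at this
    simp only [height]
    linarith
  have hsq : ‖x.coord - y.coord‖ ^ 2 =
      4 * Real.sinh (dist x y / 2) ^ 2 * (x.height * y.height) := by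
    rw [hs, div_pow, mul_pow, mul_pow, Real.sq_sqrt hx.le, Real.sq_sqrt hy.le]
    field_simp
    norm_num
  set s := Real.sinh (dist x y / 2)
  set e := ‖x.coord - y.coord‖
  by_contra! hlt
  have h1 : e ^ 2 ≤ 4 * s ^ 2 * ((y.height + e) * y.height) := by
    rw [hsq]; gcongr
  have hA : 0 ≤ 4 * s ^ 2 * y.height := by positivity
  have hB : 0 ≤ 2 * s * y.height := by positivity
  nlinarith [mul_nonneg hA hB, mul_nonneg he hB]

theorem continuous_coord_aux :
    @Continuous (HypSpace d) _ metricSpaceAux.toUniformSpace.toTopologicalSpace _ coord := by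
  let := metricSpaceAux (d := d)
  rw [continuous_iff_continuousAt]
  intro y
  rw [ContinuousAt, tendsto_iff_norm_sub_tendsto_zero]
  have hc : Continuous fun x : HypSpace d =>
      4 * Real.sinh (dist x y / 2) ^ 2 * y.height + 2 * Real.sinh (dist x y / 2) * y.height := by
    have : Continuous fun x : HypSpace d => Real.sinh (dist x y / 2) :=
      Real.continuous_sinh.comp ((continuous_id.dist continuous_const).div_const 2)
    fun_prop
  refine squeeze_zero (fun _ => norm_nonneg _) (fun x => norm_sub_le x y) ?_
  have := hc.tendsto y
  simpa using this

/-- The topology of the half-space as a subset of `ℝ^d`. -/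
instance : TopologicalSpace (HypSpace d) := TopologicalSpace.induced coord inferInstance

theorem continuous_coord : Continuous (coord : HypSpace d → _) := continuous_induced_dom

theorem continuous_height : Continuous (height : HypSpace d → ℝ) :=
  (EuclideanSpace.proj (𝕜 := ℝ) (⊤ : Fin d)).continuous.comp continuous_coord

/-- The hyperbolic metric; its topology is definitionally the Euclidean one. -/
instance : MetricSpace (HypSpace d) :=
  metricSpaceAux.replaceTopology <| by
    refine le_antisymm (continuous_id_iff_le.1 ?_) ?_
    · refine (@continuous_iff_continuous_dist (HypSpace d) (HypSpace d)
        metricSpaceAux.toPseudoMetricSpace _ _).2 ?_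
      change Continuous fun p : HypSpace d × HypSpace d =>
        Real.arcosh (1 + ‖p.1.coord - p.2.coord‖ ^ 2 / (2 * p.1.height * p.2.height))
      refine Real.continuousOn_arcosh.comp_continuous ?_ fun p => one_le_arg p.1 p.2
      refine continuous_const.add (Continuous.div ?_ ?_ ?_)
      · exact ((continuous_coord.comp continuous_fst).sub
          (continuous_coord.comp continuous_snd)).norm.pow 2
      · exact (continuous_const.mul (continuous_height.comp continuous_fst)).mul
          (continuous_height.comp continuous_snd)
      · intro p
        have := p.1.height_pos
        have := p.2.height_pos
        positivity
    · exact continuous_iff_le_induced.1 continuous_coord_aux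

instance : MeasurableSpace (HypSpace d) := borel _

instance : BorelSpace (HypSpace d) := ⟨rfl⟩

/-- The hyperbolic volume, i.e. the Riemannian volume of the metric
`(dx_1² + ⋯ + dx_d²) / x_d²`: it has the density `x_d^{-d}` with respect to Lebesgue measure on the
half-space. It coincides with the (normalised) `d`-dimensional Hausdorff measure. -/
def hypVolume (d : ℕ) [NeZero d] : Measure (HypSpace d) :=
  ((volume : Measure (EuclideanSpace ℝ (Fin d))).comap coord).withDensity
    fun x => ENNReal.ofReal ((x.height ^ d)⁻¹)

/-- The hyperbolic volume of the open ball of radius `R` around `o`. -/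
def ballVolume (o : HypSpace d) (R : ℝ) : ℝ := (hypVolume d).real (Metric.ball o R)

end HypSpace

/-- A Poisson process on `X` with intensity measure `μ`: a random locally finite subset `η` of `X`
(a bounded set contains finitely many of its points) such that the number of points in a Borel set
`B` has the Poisson distribution with mean `μ B` (and is almost surely infinite if `μ B = ∞`), and
such that the numbers of points in disjoint Borel sets are independent. -/
structure IsPoissonProcess {Ω X : Type*} [MeasurableSpace Ω] [MetricSpace X] [MeasurableSpace X]
    (P : Measure Ω) (η : Ω → Set X) (μ : Measure X) : Prop where
  locallyFinite : ∀ ω, ∀ s : Set X, Bornology.IsBounded s → (η ω ∩ s).Finite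
  measurable_count : ∀ B : Set X, MeasurableSet B → Measurable fun ω => (η ω ∩ B).encard
  count_law : ∀ B : Set X, MeasurableSet B → μ B ≠ ⊤ →
    P.map (fun ω => (η ω ∩ B).encard) =
      (poissonMeasure (μ B).toNNReal).map (fun k : ℕ => (k : ℕ∞))
  count_top : ∀ B : Set X, MeasurableSet B → μ B = ⊤ → ∀ᵐ ω ∂P, (η ω ∩ B).encard = ⊤
  indep : ∀ (k : ℕ) (B : Fin k → Set X), (∀ i, MeasurableSet (B i)) →
    Pairwise (fun i j => Disjoint (B i) (B j)) →
    iIndepFun (fun i ω => (η ω ∩ B i).encard) P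

section RadialSpanningTree

variable {X : Type*} [MetricSpace X]

/-- `y` is a radial nearest neighbour of `x`: a point of `ξ ∪ {o}` strictly closer to `o` than `x`
and, among all such points, one with minimal distance to `x`. -/
def IsRadialNearest (o : X) (ξ : Set X) (x y : X) : Prop :=
  (y ∈ ξ ∪ {o} ∧ dist o y < dist o x) ∧
    ∀ z ∈ ξ ∪ {o}, dist o z < dist o x → dist x y ≤ dist x z

open Classical in
/-- The radial nearest neighbour `n(x, ξ)`. The default value `o` is only taken at `x = o` if `ξ` is
locally finite. -/
def radialNearest (o : X) (ξ : Set X) (x : X) : X :=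
  if h : ∃ y, IsRadialNearest o ξ x y then h.choose else o

/-- `ℓ(x, ξ)`, the distance of `x` to its radial nearest neighbour, which is the length of the edge
of the radial spanning tree that leads from `x` towards the root `o`. -/
def radialEdgeLength (o : X) (ξ : Set X) (x : X) : ℝ := dist x (radialNearest o ξ x)

/-- The edge-length functional: the sum of `ℓ(x, ξ) ^ α` over the points `x` of `ξ` in the open ball
of radius `R` around `o` (a finite sum if `ξ` is locally finite). -/
def edgeLengthFunctional (o : X) (α R : ℝ) (ξ : Set X) : ℝ :=
  ∑ᶠ x ∈ ξ ∩ Metric.ball o R, radialEdgeLength o ξ x ^ α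

end RadialSpanningTree

end

noncomputable section

/-! Fix the length scale `ρ` by `γ * ρ ^ d = β`, with `β` depending only on `c₀` and `d` and chosen
so that `γ ≥ c₀` forces `ρ ≤ 1/2`. A ball of radius `ρ` then has volume of order `ρ ^ d` and
contains a bounded expected number of points, and typical edges have length of order `ρ`. About
`V(R) / ρ ^ d` cells of size `ρ` fill the ball, and each contributes variance of order `ρ ^ (2α)`.
The product is `γ ^ (1 - 2α/d) V(R)` up to constants.

Upper bound (`exists_variance_le`). The functional is a sum over cells. Long edges at a cell require
an empty ball of radius `(k - 1)ρ` on the way to the root. By the volume bound `c s ^ d` with `d ≥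
2`, this has probability at most `exp (-cβ(k - 1)²)`. Unless such a void occurs, the contribution of
a cell depends only on the points within `(2k + 1)ρ`, so the covariance of two cells at distance
about `6kρ` has Gaussian decay in `k` (`covariance_cells_le`). The number of cells at that distance
grows only exponentially in `k`, even in hyperbolic space, so the covariances with one fixed cell
sum to `O(ρ ^ (2α))` (`sum_separated_le`).

Lower bound (`exists_le_variance`). Near each centre `z` of a `4ρ`-separated family a bounded
centred variable `H` is built from the points in the ball of radius `2ρ` around `z`. These variables
are independent, and if each has correlation at least `e` with the functional, then the variance is
at least `e²` times their number (`card_mul_sq_le_variance`). `H` is the indicator of a local event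
times two centred void indicators, of small balls `U` and `W`. Integrating against it replaces the
functional by its second difference under removal of the points in `U` and `W`. In the fork
configuration this is strictly positive: a point near `z` can connect to `U` or to `W` equally well
and gets a markedly longer edge only when both are emptied (`IsFork.exists_correlated`). -/

theorem EuclideanSpace.exists_unit_orthogonal {d : ℕ} (hd : 2 ≤ d) (n : EuclideanSpace ℝ (Fin d)) :
    ∃ e : EuclideanSpace ℝ (Fin d), ‖e‖ = 1 ∧ inner ℝ n e = 0 := by
  have h1 : Module.finrank ℝ (Submodule.span ℝ {n}) ≤ 1 := (finrank_span_le_card _).trans (by simp)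
  have h2 := Submodule.finrank_add_finrank_orthogonal (Submodule.span ℝ {n})
  rw [finrank_euclideanSpace_fin] at h2
  have h3 : (Submodule.span ℝ {n})ᗮ ≠ ⊥ := by
    intro h
    rw [h, finrank_bot] at h2
    omega
  obtain ⟨e, he, he0⟩ := Submodule.exists_mem_ne_zero_of_ne_bot h3
  refine ⟨‖e‖⁻¹ • e, ?_, ?_⟩
  · rw [norm_smul, norm_inv, norm_norm, inv_mul_cancel₀ (norm_ne_zero_iff.2 he0)]
  · rw [inner_smul_right, Submodule.mem_orthogonal_singleton_iff_inner_right.1 he, mul_zero]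

/-! ### Hyperboloid coordinates, points on geodesics, and the geometry of the fork. -/

namespace HypSpace

variable {d : ℕ} [NeZero d]

/-- The spatial part of the hyperboloid coordinates centred at `z`. -/
def chart (z x : HypSpace d) : EuclideanSpace ℝ (Fin d) :=
  x.height⁻¹ • (x.coord - z.coord) + EuclideanSpace.single ⊤ (Real.cosh (dist x z) - 1)

/-- With `cosh (dist x z)` as time coordinate and `chart z x` as space coordinate, `cosh (dist x y)`
is the Lorentz product. This is the law of cosines at `z`, and it reduces the constructions below to
Euclidean inner products. -/
theorem inner_chart (z x y : HypSpace d) :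
    inner ℝ (chart z x) (chart z y) =
      Real.cosh (dist x z) * Real.cosh (dist y z) - Real.cosh (dist x y) := by
  have hx := x.height_pos
  have hy := y.height_pos
  have hz := z.height_pos
  have e : x.coord - y.coord = (x.coord - z.coord) - (y.coord - z.coord) := by abel
  have tx : (x.coord - z.coord).ofLp ⊤ = x.height - z.height := rfl
  have ty : (y.coord - z.coord).ofLp ⊤ = y.height - z.height := rfl
  simp only [chart, inner_add_left, inner_add_right, inner_smul_left, inner_smul_right,
    EuclideanSpace.inner_single_left, EuclideanSpace.inner_single_right, conj_trivial,
    tx, ty, PiLp.single_apply, if_true]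
  rw [cosh_dist x z, cosh_dist y z, cosh_dist x y, e, norm_sub_sq_real (x.coord - z.coord)]
  field_simp
  ring

theorem norm_chart (z x : HypSpace d) : ‖chart z x‖ = Real.sinh (dist x z) := by
  rw [← sq_eq_sq₀ (norm_nonneg _) (Real.sinh_nonneg_iff.2 dist_nonneg), ← real_inner_self_eq_norm_sq,
    inner_chart, dist_self, Real.cosh_zero, Real.sinh_sq]
  ring

theorem chart_surjective (z : HypSpace d) : Function.Surjective (chart z) := by
  intro v
  have hz := z.height_pos
  obtain ⟨c, hc⟩ : ∃ c, c = √(1 + ‖v‖ ^ 2) := ⟨_, rfl⟩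
  have hc2 : c ^ 2 = 1 + ‖v‖ ^ 2 := by rw [hc, Real.sq_sqrt (by positivity)]
  have hc0 : 0 ≤ c := hc ▸ Real.sqrt_nonneg _
  have hvt : v ⊤ ≤ ‖v‖ := (le_abs_self _).trans (PiLp.norm_apply_le v ⊤)
  have hcv : 0 < c - v ⊤ := by
    have : ‖v‖ < c := by
      by_contra! h
      nlinarith [norm_nonneg v]
    linarith
  -- The last component of `chart z x = v` reads `v ⊤ = c - z.height / x.height`, which forces this
  -- height.
  obtain ⟨h, hh⟩ : ∃ h, h = z.height / (c - v ⊤) := ⟨_, rfl⟩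
  have hhpos : 0 < h := hh ▸ div_pos hz hcv
  have hh' : h * (c - v ⊤) = z.height := by rw [hh]; field_simp
  have htop : (z.coord + h • (v - EuclideanSpace.single ⊤ (c - 1)) : EuclideanSpace ℝ (Fin d)) ⊤ = h := by
    have : z.coord ⊤ = z.height := rfl
    simp only [PiLp.add_apply, PiLp.smul_apply, PiLp.sub_apply, PiLp.single_apply,
      if_true, smul_eq_mul, this]
    linarith
  refine ⟨⟨z.coord + h • (v - EuclideanSpace.single ⊤ (c - 1)), by rw [htop]; exact hhpos⟩, ?_⟩
  simp only [chart, cosh_dist]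
  have e1 : height (⟨z.coord + h • (v - EuclideanSpace.single ⊤ (c - 1)),
    by rw [htop]; exact hhpos⟩ : HypSpace d) = h := htop
  rw [e1, add_sub_cancel_left, smul_smul, inv_mul_cancel₀ hhpos.ne', one_smul, norm_smul, mul_pow,
    norm_sub_sq_real, EuclideanSpace.inner_single_right, EuclideanSpace.single, PiLp.norm_single]
  have : 1 + ‖h‖ ^ 2 * (‖v‖ ^ 2 - 2 * ((c - 1) * (starRingEnd ℝ) (v ⊤)) + ‖c - 1‖ ^ 2)
      / (2 * h * z.height) - 1 = c - 1 := by
    simp only [conj_trivial, Real.norm_eq_abs, sq_abs]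
    rw [← hh', show ‖v‖ ^ 2 = c ^ 2 - 1 by linarith]
    field_simp
    ring
  rw [this]
  simp

theorem cosh_dist_chart (z x y : HypSpace d) :
    Real.cosh (dist x y) =
      Real.cosh (dist x z) * Real.cosh (dist y z) - inner ℝ (chart z x) (chart z y) := by
  rw [inner_chart]; ring

theorem exists_chart_eq_sinh_smul (z : HypSpace d) {v : EuclideanSpace ℝ (Fin d)} (hv : ‖v‖ = 1)
    {s : ℝ} (hs : 0 ≤ s) : ∃ x, dist x z = s ∧ chart z x = Real.sinh s • v := by
  obtain ⟨x, hx⟩ := chart_surjective z (Real.sinh s • v)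
  refine ⟨x, ?_, hx⟩
  have := norm_chart z x
  rw [hx, norm_smul, hv, mul_one, Real.norm_of_nonneg (Real.sinh_nonneg_iff.2 hs)] at this
  exact (Real.sinh_injective this).symm

theorem exists_dist_eq (o : HypSpace d) {s : ℝ} (hs : 0 ≤ s) : ∃ x, dist x o = s := by
  obtain ⟨x, hx, -⟩ := exists_chart_eq_sinh_smul o
    (v := EuclideanSpace.single ⊤ 1) (by simp) hs
  exact ⟨x, hx⟩

theorem cosh_inj {a b : ℝ} (ha : 0 ≤ a) (hb : 0 ≤ b) (h : Real.cosh a = Real.cosh b) : a = b := by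
  have := Real.cosh_abs a ▸ Real.cosh_abs b ▸ h
  have h1 := Real.cosh_le_cosh.1 h.le
  have h2 := Real.cosh_le_cosh.1 h.ge
  rw [abs_of_nonneg ha, abs_of_nonneg hb] at h1 h2
  linarith

theorem exists_unit_chart (z o : HypSpace d) :
    ∃ v : EuclideanSpace ℝ (Fin d), ‖v‖ = 1 ∧ chart z o = Real.sinh (dist o z) • v := by
  by_cases h : chart z o = 0
  · refine ⟨EuclideanSpace.single ⊤ 1, by simp, ?_⟩
    have := norm_chart z o
    rw [h, norm_zero] at this
    rw [h, ← this, zero_smul]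
  · have h0 := norm_chart z o
    refine ⟨(‖chart z o‖)⁻¹ • chart z o, ?_, ?_⟩
    · rw [norm_smul, norm_inv, norm_norm, inv_mul_cancel₀ (norm_ne_zero_iff.2 h)]
    · rw [smul_smul, ← h0, mul_inv_cancel₀ (norm_ne_zero_iff.2 h), one_smul]

/-- Points on one ray of the chart at `z` satisfy `cosh a * cosh b - sinh a * sinh b = cosh (a -
b)`, so their distances to `z` subtract. -/
theorem exists_between (o z : HypSpace d) {s : ℝ} (hs : 0 ≤ s) (hsr : s ≤ dist o z) :
    ∃ m, dist m z = s ∧ dist o m = dist o z - s := by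
  obtain ⟨n, hn, hno⟩ := exists_unit_chart z o
  obtain ⟨m, hm, hmc⟩ := exists_chart_eq_sinh_smul z hn hs
  refine ⟨m, hm, cosh_inj dist_nonneg (by linarith) ?_⟩
  rw [cosh_dist_chart z, hm, hno, hmc, Real.cosh_sub, inner_smul_left, inner_smul_right,
    real_inner_self_eq_norm_sq, hn]
  simp

theorem cosh_le_of_sq_le {s : ℝ} (hs : s ^ 2 ≤ 2) :
    Real.cosh s ≤ 1 + s ^ 2 / 2 * (1 + s ^ 2 / 2) := by
  refine (Real.cosh_le_exp_half_sq s).trans ?_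
  have := Real.abs_exp_sub_one_sub_id_le (x := s ^ 2 / 2)
    (by rw [abs_of_nonneg (by positivity)]; linarith)
  have := (abs_le.1 this).2
  nlinarith [sq_nonneg s]

theorem one_add_sq_div_two_le_cosh (s : ℝ) : 1 + s ^ 2 / 2 ≤ Real.cosh s := by
  have h := Real.cosh_two_mul (s / 2)
  rw [mul_div_cancel₀ _ (two_ne_zero' ℝ), Real.cosh_sq] at h
  have h2 : |s / 2| ≤ |Real.sinh (s / 2)| := by
    rw [Real.abs_sinh]
    exact Real.self_le_sinh_iff.2 (abs_nonneg _)
  have := sq_le_sq.2 h2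
  nlinarith

/-- The constant satisfies `(49/40) / 5 = (7/10)² / 2`, which is what the distance bound `7/10 * s`
in the fork requires. -/
theorem sinh_sq_le {s : ℝ} (hs : 0 ≤ s) (hs' : s ≤ 1 / 2) :
    Real.sinh s ^ 2 ≤ 49 / 40 * s ^ 2 := by
  have h2 : s ^ 2 ≤ 1 / 4 := by nlinarith
  have h1 := cosh_le_of_sq_le (s := s) (by linarith)
  have h3 : Real.cosh s ≤ 1 + 9 / 16 * s ^ 2 := by nlinarith [sq_nonneg s]
  rw [Real.sinh_sq]
  nlinarith [sq_nonneg s, Real.one_le_cosh s]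

theorem cosh_mul_le {s : ℝ} (hs : 0 ≤ s) (hs' : s ≤ 1 / 2) :
    Real.cosh (11 / 10 * s) ≤ 1 + 18 / 25 * Real.sinh s ^ 2 := by
  have h2 : s ^ 2 ≤ 1 / 4 := by nlinarith
  have h1 := cosh_le_of_sq_le (s := 11 / 10 * s) (by nlinarith)
  have h3 : s ^ 2 ≤ Real.sinh s ^ 2 := by
    have := Real.self_le_sinh_iff.2 hs
    gcongr
  refine h1.trans ?_
  have h4 : (11 / 10 * s) ^ 2 / 2 * (1 + (11 / 10 * s) ^ 2 / 2) ≤ 18 / 25 * s ^ 2 := by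
    nlinarith [sq_nonneg s]
  linarith

/-- Two points at distance `s` from `z` that both see `z` and `o` on the same side, and are far from
each other. -/
theorem exists_fork (hd : 2 ≤ d) (o z : HypSpace d) {s : ℝ} (hs : 0 < s) (hs' : s ≤ 1 / 2)
    (hsr : 6 / 5 * s ≤ dist o z) :
    ∃ t u w : HypSpace d, dist t z = 6 / 5 * s ∧ dist o t = dist o z - 6 / 5 * s ∧
      dist u z = s ∧ dist w z = s ∧ dist o u ≤ dist o z - 3 / 10 * s ∧
      dist o w ≤ dist o z - 3 / 10 * s ∧ dist u t ≤ 9 / 10 * s ∧ dist w t ≤ 9 / 10 * s ∧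
      11 / 10 * s ≤ dist u w := by
  obtain ⟨n, hn, hno⟩ := exists_unit_chart z o
  obtain ⟨e, he, hne⟩ := EuclideanSpace.exists_unit_orthogonal hd n
  have hnn : inner ℝ n n = (1 : ℝ) := by rw [real_inner_self_eq_norm_sq, hn, one_pow]
  have hee : inner ℝ e e = (1 : ℝ) := by rw [real_inner_self_eq_norm_sq, he, one_pow]
  have hen : inner ℝ e n = (0 : ℝ) := by rw [real_inner_comm, hne]
  -- The directions of `u` and `w` as seen from `z` are mirror images in the axis `n` that points to
  -- `o`, with cosine `4/5` to it.
  have hunit : ∀ b : ℝ, b ^ 2 = 9 / 25 → ‖(4 / 5 : ℝ) • n + b • e‖ = 1 := by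
    intro b hb
    rw [← sq_eq_sq₀ (norm_nonneg _) zero_le_one, ← real_inner_self_eq_norm_sq]
    simp only [inner_add_left, inner_add_right, inner_smul_left, inner_smul_right, hnn, hee, hen,
      hne, conj_trivial]
    nlinarith
  obtain ⟨t, ht, htc⟩ := exists_chart_eq_sinh_smul z hn (s := 6 / 5 * s) (by positivity)
  -- The auxiliary point `p` lies on the axis between `z` and `t`. All bounds for `u` and `w` with
  -- respect to `o` and `t` follow from `dist u p ≤ 7/10 * s` and the triangle inequality: `1 - 7/10
  -- = 3/10` and `7/10 + 1/5 = 9/10`.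
  obtain ⟨p, hp, hpc⟩ := exists_chart_eq_sinh_smul z hn hs.le
  obtain ⟨u, hu, huc⟩ := exists_chart_eq_sinh_smul z (hunit (3 / 5) (by norm_num)) hs.le
  obtain ⟨w, hw, hwc⟩ := exists_chart_eq_sinh_smul z (hunit (-(3 / 5)) (by norm_num)) hs.le
  have hot : dist o t = dist o z - 6 / 5 * s := by
    refine cosh_inj dist_nonneg (by linarith) ?_
    rw [cosh_dist_chart z, ht, hno, htc, Real.cosh_sub, inner_smul_left, inner_smul_right, hnn]
    simp
  have hop : dist o p = dist o z - s := by
    refine cosh_inj dist_nonneg (by linarith) ?_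
    rw [cosh_dist_chart z, hp, hno, hpc, Real.cosh_sub, inner_smul_left, inner_smul_right, hnn]
    simp
  have hpt : dist p t = 1 / 5 * s := by
    refine cosh_inj dist_nonneg (by linarith) ?_
    rw [cosh_dist_chart z, hp, ht, hpc, htc, show 1 / 5 * s = 6 / 5 * s - s by ring, Real.cosh_sub,
      inner_smul_left, inner_smul_right, hnn]
    simp only [conj_trivial]
    ring
  have hss := sinh_sq_le hs.le hs'
  have hnear : ∀ q, dist q z = s → inner ℝ (chart z q) (chart z p) = 4 / 5 * Real.sinh s ^ 2 →
      dist q p ≤ 7 / 10 * s := by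
    intro q hq hqp
    have h1 : Real.cosh (dist q p) ≤ Real.cosh (7 / 10 * s) := by
      rw [cosh_dist_chart z, hq, hp, hqp]
      have := one_add_sq_div_two_le_cosh (7 / 10 * s)
      nlinarith [Real.cosh_sq s]
    have := Real.cosh_le_cosh.1 h1
    rwa [abs_of_nonneg dist_nonneg, abs_of_nonneg (by positivity)] at this
  have hup : dist u p ≤ 7 / 10 * s := by
    refine hnear u hu ?_
    rw [huc, hpc]
    simp only [inner_add_left, inner_smul_left, inner_smul_right, hnn, hen, conj_trivial]
    ring
  have hwp : dist w p ≤ 7 / 10 * s := by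
    refine hnear w hw ?_
    rw [hwc, hpc]
    simp only [inner_add_left, inner_smul_left, inner_smul_right, hnn, hen, conj_trivial]
    ring
  refine ⟨t, u, w, ht, hot, hu, hw, ?_, ?_, ?_, ?_, ?_⟩
  · linarith [dist_triangle o p u, dist_comm p u]
  · linarith [dist_triangle o p w, dist_comm p w]
  · linarith [dist_triangle u p t]
  · linarith [dist_triangle w p t]
  -- The cosine of the angle at `z` between `u` and `w` is `16/25 - 9/25 = 7/25`, and `1 - 7/25 =
  -- 18/25`.
  · have h0 : Real.cosh (dist u w) = 1 + 18 / 25 * Real.sinh s ^ 2 := by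
      rw [cosh_dist_chart z, hu, hw, huc, hwc]
      simp only [inner_add_left, inner_add_right, inner_smul_left, inner_smul_right, hnn, hee, hen,
        hne, conj_trivial]
      linear_combination Real.cosh_sq s
    have h1 : Real.cosh (11 / 10 * s) ≤ Real.cosh (dist u w) := by
      rw [h0]
      exact cosh_mul_le hs.le hs'
    have := Real.cosh_le_cosh.1 h1
    rwa [abs_of_nonneg dist_nonneg, abs_of_nonneg (by positivity)] at this

end HypSpace

/-! ### Two-sided bounds for the volume of hyperbolic balls. -/

namespace HypSpace

variable {d : ℕ} [NeZero d]

theorem coord_injective : Function.Injective (coord : HypSpace d → _) := fun _ _ h => HypSpace.ext h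

theorem isOpenEmbedding_coord : IsOpenEmbedding (coord : HypSpace d → _) := by
  refine ⟨⟨⟨rfl⟩, coord_injective⟩, ?_⟩
  have : Set.range (coord : HypSpace d → _) = {x | 0 < x ⊤} := by
    ext x
    exact ⟨by rintro ⟨y, rfl⟩; exact y.pos, fun h => ⟨⟨x, h⟩, rfl⟩⟩
  rw [this]
  exact isOpen_lt continuous_const (EuclideanSpace.proj (𝕜 := ℝ) (⊤ : Fin d)).continuous

theorem measurableEmbedding_coord : MeasurableEmbedding (coord : HypSpace d → _) :=
  isOpenEmbedding_coord.measurableEmbedding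

/-- The Euclidean centre of a hyperbolic ball. -/
def euclideanCenter (z : HypSpace d) (s : ℝ) : EuclideanSpace ℝ (Fin d) :=
  z.coord + EuclideanSpace.single ⊤ (z.height * (Real.cosh s - 1))

/-- Clearing the denominator in `cosh (dist x z) < cosh s` and completing the square in the last
coordinate shows that a hyperbolic ball is a Euclidean ball with a raised centre. -/
theorem dist_lt_iff (z x : HypSpace d) {s : ℝ} (hs : 0 ≤ s) :
    dist x z < s ↔ ‖x.coord - euclideanCenter z s‖ < z.height * Real.sinh s := by
  have hx := x.height_pos
  have hz := z.height_pos
  have h1 : dist x z < s ↔ Real.cosh (dist x z) < Real.cosh s := by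
    rw [Real.cosh_lt_cosh, abs_of_nonneg dist_nonneg, abs_of_nonneg hs]
  have h2 : 0 ≤ z.height * Real.sinh s := mul_nonneg hz.le (Real.sinh_nonneg_iff.2 hs)
  have e : x.coord - euclideanCenter z s =
      (x.coord - z.coord) - EuclideanSpace.single ⊤ (z.height * (Real.cosh s - 1)) := by
    rw [euclideanCenter]; abel
  have tx : (x.coord - z.coord).ofLp ⊤ = x.height - z.height := rfl
  rw [h1, ← sq_lt_sq₀ (norm_nonneg _) h2, cosh_dist, e, norm_sub_sq_real (x.coord - z.coord),
    EuclideanSpace.inner_single_right, EuclideanSpace.single, PiLp.norm_single, mul_pow,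
    Real.sinh_sq, conj_trivial, tx, Real.norm_eq_abs, sq_abs, ← lt_sub_iff_add_lt',
    div_lt_iff₀ (by positivity)]
  constructor <;> intro h <;> nlinarith

theorem height_bounds {z x : HypSpace d} {s : ℝ} (hs : 0 ≤ s) (h : dist x z < s) :
    z.height * Real.exp (-s) ≤ x.height ∧ x.height ≤ z.height * Real.exp s := by
  have h1 := (dist_lt_iff z x hs).1 h
  have h2 := (PiLp.norm_apply_le (x.coord - euclideanCenter z s) ⊤).trans h1.le
  have e : (x.coord - euclideanCenter z s) ⊤ = x.height - z.height * Real.cosh s := by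
    simp only [euclideanCenter, PiLp.sub_apply, PiLp.add_apply, PiLp.single_apply, if_true, height]
    ring
  rw [e, Real.norm_eq_abs, abs_le] at h2
  rw [← Real.cosh_sub_sinh, ← Real.cosh_add_sinh]
  constructor <;> nlinarith

theorem coord_image_ball (z : HypSpace d) {s : ℝ} (hs : 0 ≤ s) :
    coord '' Metric.ball z s = Metric.ball (euclideanCenter z s) (z.height * Real.sinh s) := by
  ext v
  constructor
  · rintro ⟨x, hx, rfl⟩
    rw [mem_ball_iff_norm]
    exact (dist_lt_iff z x hs).1 hx
  · intro hv
    rw [mem_ball_iff_norm] at hv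
    have h2 := (PiLp.norm_apply_le (v - euclideanCenter z s) ⊤).trans hv.le
    have e : (v - euclideanCenter z s) ⊤ = v ⊤ - z.height * Real.cosh s := by
      simp only [euclideanCenter, PiLp.sub_apply, PiLp.add_apply, PiLp.single_apply, if_true,
        height]
      ring
    rw [e, Real.norm_eq_abs, abs_le] at h2
    have hpos : 0 < v ⊤ := by
      have h3 := mul_pos z.height_pos (Real.exp_pos (-s))
      rw [← Real.cosh_sub_sinh, mul_sub] at h3
      linarith [h2.1]
    exact ⟨⟨v, hpos⟩, (dist_lt_iff z ⟨v, hpos⟩ hs).2 hv, rfl⟩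

theorem comap_volume_ball (z : HypSpace d) {s : ℝ} (hs : 0 ≤ s) :
    (volume : Measure (EuclideanSpace ℝ (Fin d))).comap coord (Metric.ball z s) =
      ENNReal.ofReal ((z.height * Real.sinh s) ^ d) *
        volume (Metric.ball (0 : EuclideanSpace ℝ (Fin d)) 1) := by
  rw [measurableEmbedding_coord.comap_apply, coord_image_ball z hs, Measure.addHaar_ball _ _
    (mul_nonneg z.height_pos.le (Real.sinh_nonneg_iff.2 hs)), finrank_euclideanSpace_fin]

theorem sinh_le_mul_exp (s : ℝ) : Real.sinh s ≤ s * Real.exp s := by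
  have h1 := Real.add_one_le_exp (-2 * s)
  have h2 : Real.exp (-s) = Real.exp s * Real.exp (-2 * s) := by rw [← Real.exp_add]; ring_nf
  rw [Real.sinh_eq, h2]
  nlinarith [Real.exp_pos s]

/-- The density is bounded by its value at the lowest height of the ball, and the Euclidean volume
is explicit. The exponential factor is crude, but it is later beaten by Gaussian decay. -/
theorem hypVolume_ball_le (z : HypSpace d) {s : ℝ} (hs : 0 ≤ s) :
    hypVolume d (Metric.ball z s) ≤ ENNReal.ofReal ((s * Real.exp (2 * s)) ^ d) *
      volume (Metric.ball (0 : EuclideanSpace ℝ (Fin d)) 1) := by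
  have hz := z.height_pos
  rw [hypVolume, withDensity_apply _ measurableSet_ball]
  calc ∫⁻ x in Metric.ball z s, ENNReal.ofReal ((x.height ^ d)⁻¹)
        ∂(volume : Measure (EuclideanSpace ℝ (Fin d))).comap coord
      ≤ ∫⁻ x in Metric.ball z s, ENNReal.ofReal (((z.height * Real.exp (-s)) ^ d)⁻¹)
        ∂(volume : Measure (EuclideanSpace ℝ (Fin d))).comap coord := by
        refine setLIntegral_mono measurable_const fun x hx => ?_
        have := (height_bounds hs hx).1
        gcongr
    _ = _ := by rw [setLIntegral_const, comap_volume_ball z hs]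
    _ ≤ _ := by
        rw [← mul_assoc, ← ENNReal.ofReal_mul (by positivity)]
        gcongr
        rw [← inv_pow, ← mul_pow, mul_inv, ← Real.exp_neg, neg_neg]
        have hsn := Real.sinh_nonneg_iff.2 hs
        refine pow_le_pow_left₀ (by positivity) ?_ _
        rw [show z.height⁻¹ * Real.exp s * (z.height * Real.sinh s) = Real.exp s * Real.sinh s by
          field_simp, two_mul, Real.exp_add]
        nlinarith [sinh_le_mul_exp s, Real.exp_pos s]

/-- The density is at least its value at the greatest height. The resulting bound stays bounded as
`s` grows, so it is useful for small radii only. -/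
theorem le_hypVolume_ball (z : HypSpace d) {s : ℝ} (hs : 0 ≤ s) :
    ENNReal.ofReal (((1 - Real.exp (-2 * s)) / 2) ^ d) *
      volume (Metric.ball (0 : EuclideanSpace ℝ (Fin d)) 1) ≤ hypVolume d (Metric.ball z s) := by
  have hz := z.height_pos
  rw [hypVolume, withDensity_apply _ measurableSet_ball]
  calc _ = ∫⁻ x in Metric.ball z s, ENNReal.ofReal (((z.height * Real.exp s) ^ d)⁻¹)
        ∂(volume : Measure (EuclideanSpace ℝ (Fin d))).comap coord := by
        rw [setLIntegral_const, comap_volume_ball z hs, ← mul_assoc,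
          ← ENNReal.ofReal_mul (by positivity)]
        congr 2
        rw [← inv_pow, ← mul_pow, mul_inv, ← Real.exp_neg, Real.sinh_eq]
        congr 1
        have h1 : Real.exp (-s) * Real.exp s = 1 := by rw [← Real.exp_add]; simp
        have h2 : Real.exp (-2 * s) = Real.exp (-s) * Real.exp (-s) := by
          rw [← Real.exp_add]; ring_nf
        rw [h2]
        field_simp
        linear_combination -h1
    _ ≤ _ := by
        refine setLIntegral_mono_ae ?_ ?_
        · exact (ENNReal.measurable_ofReal.comp
            ((continuous_height.measurable.pow_const d).inv)).aemeasurable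
        · refine Filter.Eventually.of_forall fun x hx => ?_
          have := (height_bounds hs hx).2
          have := x.height_pos
          gcongr

theorem hypVolume_ball_lt_top (z : HypSpace d) (s : ℝ) : hypVolume d (Metric.ball z s) < ⊤ := by
  rcases le_or_gt s 0 with hs | hs
  · rw [Metric.ball_eq_empty.2 hs, measure_empty]; exact ENNReal.zero_lt_top
  · exact (hypVolume_ball_le z hs.le).trans_lt
      (ENNReal.mul_lt_top ENNReal.ofReal_lt_top measure_ball_lt_top)

/-- Equally spaced points on a horizontal line have distances that grow only logarithmically in the
index, so exponentially many separated points fit into a large ball. -/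
theorem exists_horocycle (hd : 2 ≤ d) (z : HypSpace d) :
    ∃ q : ℕ → HypSpace d, q 0 = z ∧
      ∀ k l, Real.sinh (dist (q k) (q l) / 2) = |(k : ℝ) - l| := by
  have hz := z.height_pos
  obtain ⟨i, hi⟩ : ∃ i : Fin d, i ≠ ⊤ := by
    have : Nontrivial (Fin d) := Fin.nontrivial_iff_two_le.2 hd
    exact exists_ne ⊤
  have htop : ∀ k : ℕ, (z.coord + EuclideanSpace.single i (2 * z.height * k) :
      EuclideanSpace ℝ (Fin d)) ⊤ = z.height := by
    intro k
    simp [hi.symm, height]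
  refine ⟨fun k => ⟨z.coord + EuclideanSpace.single i (2 * z.height * k), by rw [htop]; exact hz⟩,
    ?_, ?_⟩
  · ext1; simp
  · intro k l
    rw [sinh_half_dist]
    change _ / (2 * (√((z.coord + EuclideanSpace.single i (2 * z.height * k) :
      EuclideanSpace ℝ (Fin d)) ⊤) * √((z.coord + EuclideanSpace.single i (2 * z.height * l) :
      EuclideanSpace ℝ (Fin d)) ⊤))) = _
    rw [htop, htop, add_sub_add_left_eq_sub, EuclideanSpace.single, EuclideanSpace.single, ← PiLp.single_sub,
      PiLp.norm_single, ← mul_sub, norm_mul, Real.norm_of_nonneg (by positivity),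
      Real.mul_self_sqrt hz.le, Real.norm_eq_abs]
    field_simp

/-- For `s ≤ 1` the density bound suffices. For `s ≥ 1` the ball contains more than `sinh (s / 4)`
disjoint balls of radius `1/2` centred on a horocycle, and `sinh` dominates the required power. One
power law at all radii is what makes void probabilities decay uniformly. -/
theorem exists_le_hypVolume_ball (hd : 2 ≤ d) : ∃ c : ℝ, 0 < c ∧ ∀ (z : HypSpace d) (s : ℝ), 0 < s →
    ENNReal.ofReal (c * s ^ d) ≤ hypVolume d (Metric.ball z s) := by
  obtain ⟨κ, hκ⟩ : ∃ κ : ℝ, κ = (volume (Metric.ball (0 : EuclideanSpace ℝ (Fin d)) 1)).toReal :=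
    ⟨_, rfl⟩
  have hκpos : 0 < κ := hκ ▸ ENNReal.toReal_pos
    (Metric.measure_ball_pos volume _ one_pos).ne' measure_ball_lt_top.ne
  have hκ' : volume (Metric.ball (0 : EuclideanSpace ℝ (Fin d)) 1) = ENNReal.ofReal κ := by
    rw [hκ, ENNReal.ofReal_toReal measure_ball_lt_top.ne]
  have hsmall : ∀ (z : HypSpace d) (s : ℝ), 0 < s → s ≤ 1 →
      ENNReal.ofReal (κ * (s / 8) ^ d) ≤ hypVolume d (Metric.ball z s) := by
    intro z s hs hs1
    refine le_trans ?_ (le_hypVolume_ball z hs.le)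
    rw [hκ', ← ENNReal.ofReal_mul]
    · refine ENNReal.ofReal_le_ofReal ?_
      rw [mul_comm]
      refine mul_le_mul_of_nonneg_right (pow_le_pow_left₀ (by positivity) ?_ _) hκpos.le
      have h1 : Real.exp (-2 * s) ≤ Real.exp (-(s / 2)) := Real.exp_le_exp.2 (by linarith)
      have h2 := Real.abs_exp_sub_one_sub_id_le (x := -(s / 2))
        (by rw [abs_neg, abs_of_pos (by positivity)]; linarith)
      have := (abs_le.1 h2).2
      nlinarith
    · have : Real.exp (-2 * s) ≤ 1 := Real.exp_le_one_iff.2 (by linarith)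
      exact pow_nonneg (by linarith) _
  obtain ⟨a, ha⟩ : ∃ a : ℝ, a = κ * ((1 / 2) / 8) ^ d := ⟨_, rfl⟩
  have hapos : 0 < a := by rw [ha]; positivity
  have hlarge : ∀ (z : HypSpace d) (s : ℝ), 1 ≤ s →
      ENNReal.ofReal (a * ((s / 4) ^ d / d.factorial / 2)) ≤ hypVolume d (Metric.ball z s) := by
    intro z s hs
    obtain ⟨q, hq0, hq⟩ := exists_horocycle hd z
    let K := ⌊Real.sinh (s / 4)⌋₊
    have hsin : 0 ≤ Real.sinh (s / 4) := Real.sinh_nonneg_iff.2 (by linarith)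
    have hdisj : Set.PairwiseDisjoint (↑(Finset.range (K + 1)))
        fun k => Metric.ball (q k) (1 / 2) := by
      intro k _ l _ hkl
      refine Metric.ball_disjoint_ball ?_
      by_contra! h
      have h1 : Real.sinh (dist (q k) (q l) / 2) < 1 := by
        refine (Real.sinh_lt_sinh.2 (show _ < (1 / 2 : ℝ) by linarith)).trans ?_
        have := sinh_sq_le (s := 1 / 2) (by norm_num) le_rfl
        nlinarith
      rw [hq] at h1
      have h2 : |(k : ℤ) - l| < 1 := by exact_mod_cast h1
      rw [Int.abs_lt_one_iff] at h2
      exact hkl (by omega)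
    have hsub : (⋃ k ∈ Finset.range (K + 1), Metric.ball (q k) (1 / 2)) ⊆ Metric.ball z s := by
      refine Set.iUnion₂_subset fun k hk => Metric.ball_subset_ball' ?_
      have h1 : Real.sinh (dist (q k) z / 2) ≤ Real.sinh (s / 4) := by
        rw [← hq0, hq, Nat.cast_zero, sub_zero, Nat.abs_cast]
        refine le_trans ?_ (Nat.floor_le hsin)
        exact_mod_cast Nat.lt_succ_iff.1 (Finset.mem_range.1 hk)
      have := Real.sinh_le_sinh.1 h1
      linarith
    calc ENNReal.ofReal (a * ((s / 4) ^ d / d.factorial / 2))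
        ≤ ENNReal.ofReal (((K + 1 : ℕ) : ℝ) * a) := by
          refine ENNReal.ofReal_le_ofReal ?_
          rw [mul_comm]
          gcongr
          have h1 : Real.sinh (s / 4) ≤ ((K + 1 : ℕ) : ℝ) := by
            push_cast; exact (Nat.lt_floor_add_one _).le
          refine le_trans ?_ h1
          -- The term of degree `d` of the exponential series gives the power; the earlier terms sum
          -- to at least `1` and absorb `exp (-(s / 4))`.
          have h2 := Real.sum_le_exp_of_nonneg (x := s / 4) (by linarith) (d + 1)
          rw [Finset.sum_range_succ] at h2
          have h3 : (1 : ℝ) ≤ ∑ i ∈ Finset.range d, (s / 4) ^ i / (i.factorial : ℝ) := by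
            have := Finset.single_le_sum (f := fun i : ℕ => (s / 4) ^ i / (i.factorial : ℝ))
              (s := Finset.range d) (fun i _ => by positivity)
              (Finset.mem_range.2 (show 0 < d by omega))
            simpa using this
          have h4 : Real.exp (-(s / 4)) ≤ 1 := Real.exp_le_one_iff.2 (by linarith)
          rw [Real.sinh_eq]
          linarith
      _ = ∑ _k ∈ Finset.range (K + 1), ENNReal.ofReal a := by
          rw [Finset.sum_const, Finset.card_range, ENNReal.ofReal_mul (by positivity),
            ENNReal.ofReal_natCast, nsmul_eq_mul]
      _ ≤ ∑ k ∈ Finset.range (K + 1), hypVolume d (Metric.ball (q k) (1 / 2)) := by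
          refine Finset.sum_le_sum fun k _ => ?_
          rw [ha]
          exact hsmall _ _ (by norm_num) (by norm_num)
      _ = hypVolume d (⋃ k ∈ Finset.range (K + 1), Metric.ball (q k) (1 / 2)) :=
          (measure_biUnion_finset hdisj fun k _ => measurableSet_ball).symm
      _ ≤ _ := measure_mono hsub
  refine ⟨min (κ * (1 / 8) ^ d) (a * ((1 / 4) ^ d / d.factorial / 2)), ?_, ?_⟩
  · have : 0 < (d.factorial : ℝ) := by exact_mod_cast d.factorial_pos
    positivity
  · intro z s hs
    rcases le_or_gt s 1 with h | h
    · refine le_trans (ENNReal.ofReal_le_ofReal ?_) (hsmall z s hs h)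
      rw [show s / 8 = 1 / 8 * s by ring, mul_pow, ← mul_assoc]
      gcongr
      exact min_le_left _ _
    · refine le_trans (ENNReal.ofReal_le_ofReal ?_) (hlarge z s h.le)
      calc _ ≤ a * ((1 / 4) ^ d / d.factorial / 2) * s ^ d := by
            gcongr; exact min_le_right _ _
        _ = _ := by rw [show s / 4 = 1 / 4 * s by ring, mul_pow]; ring

theorem exists_hypVolume_ball_le : ∃ C : ℝ, 0 < C ∧ ∀ (z : HypSpace d) (s : ℝ), 0 < s →
    hypVolume d (Metric.ball z s) ≤ ENNReal.ofReal (C * (s * Real.exp (2 * s)) ^ d) := by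
  refine ⟨(volume (Metric.ball (0 : EuclideanSpace ℝ (Fin d)) 1)).toReal, ENNReal.toReal_pos
    (Metric.measure_ball_pos volume _ one_pos).ne' measure_ball_lt_top.ne, fun z s hs => ?_⟩
  refine (hypVolume_ball_le z hs.le).trans_eq ?_
  rw [mul_comm, ENNReal.ofReal_mul ENNReal.toReal_nonneg,
    ENNReal.ofReal_toReal measure_ball_lt_top.ne]

end HypSpace

/-! ### Independence of the Poisson process over disjoint regions. -/

theorem Set.encard_biUnion_finset {ι α : Type*} (T : Finset ι) (f : ι → Set α)
    (hf : (T : Set ι).PairwiseDisjoint f) : (⋃ t ∈ T, f t).encard = ∑ t ∈ T, (f t).encard := by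
  classical
  induction T using Finset.induction_on with
  | empty => simp
  | insert a T ha ih =>
    rw [Finset.set_biUnion_insert, Finset.sum_insert ha, Set.encard_union_eq,
      ih (hf.subset (by simp))]
    rw [Set.disjoint_iUnion₂_right]
    intro t ht
    exact hf (by simp) (by simp [ht]) (by rintro rfl; exact ha ht)

section Atoms

variable {X : Type*}

/-- The part of `B` on which exactly the sets in `s` occur among those in `S`. -/
def setAtom (B : Set X) (S s : Finset (Set X)) : Set X := {x ∈ B | ∀ A ∈ S, x ∈ A ↔ A ∈ s}

theorem measurableSet_setAtom [MeasurableSpace X] {B : Set X} {S : Finset (Set X)}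
    (hB : MeasurableSet B) (hS : ∀ A ∈ S, MeasurableSet A) (s : Finset (Set X)) :
    MeasurableSet (setAtom B S s) := by
  have : setAtom B S s = B ∩ ⋂ A ∈ S, {x | x ∈ A ↔ A ∈ s} := by
    ext x; simp [setAtom]
  rw [this]
  refine hB.inter (Finset.measurableSet_biInter _ fun A hA => ?_)
  by_cases h : A ∈ s
  · simpa [h] using hS A hA
  · have : {x | x ∈ A ↔ A ∈ s} = Aᶜ := by ext; simp [h]
    rw [this]
    exact (hS A hA).compl

theorem disjoint_setAtom {B : Set X} {S s s' : Finset (Set X)} (hs : s ⊆ S) (hs' : s' ⊆ S)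
    (h : s ≠ s') : Disjoint (setAtom B S s) (setAtom B S s') := by
  rw [Set.disjoint_left]
  rintro x ⟨-, hx⟩ ⟨-, hx'⟩
  refine h (Finset.ext fun A => ⟨fun hA => ?_, fun hA => ?_⟩)
  · exact (hx' A (hs hA)).1 ((hx A (hs hA)).2 hA)
  · exact (hx A (hs' hA)).1 ((hx' A (hs' hA)).2 hA)

open Classical in
-- Independence of counts is given for disjoint sets only. Counts in overlapping sets become
-- functions of independent ones through this decomposition.
theorem encard_inter_eq_sum_setAtom {B : Set X} {S : Finset (Set X)} {A : Set X} (hA : A ∈ S)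
    (hAB : A ⊆ B) (ξ : Set X) :
    (ξ ∩ A).encard = ∑ s ∈ S.powerset, if A ∈ s then (ξ ∩ setAtom B S s).encard else 0 := by
  rw [← Finset.sum_filter, ← Set.encard_biUnion_finset]
  · congr 1
    ext x
    simp only [Set.mem_inter_iff, Set.mem_iUnion, Finset.mem_filter, Finset.mem_powerset,
      exists_prop]
    constructor
    · rintro ⟨h1, h2⟩
      refine ⟨S.filter (x ∈ ·), ⟨Finset.filter_subset _ _, by simp [hA, h2]⟩, h1, hAB h2, ?_⟩
      intro A' hA'
      simp [hA']
    · rintro ⟨s, ⟨-, hs⟩, h1, -, h2⟩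
      exact ⟨h1, (h2 A hA).2 hs⟩
  · intro s hs s' hs' h
    simp only [Finset.coe_filter, Finset.mem_powerset, Set.mem_ofPred_eq] at hs hs'
    exact (disjoint_setAtom hs.1 hs'.1 h).mono Set.inter_subset_right Set.inter_subset_right

end Atoms

/-- The σ-algebra of the counts of points in the measurable subsets of a region. -/
@[reducible]
def regionSigma {Ω X : Type*} [MeasurableSpace X] (η : Ω → Set X) (B : Set X) :
    MeasurableSpace Ω :=
  ⨆ A : {A : Set X // MeasurableSet A ∧ A ⊆ B},
    MeasurableSpace.comap (fun ω => (η ω ∩ A.1).encard) inferInstance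

theorem regionSigma_mono {Ω X : Type*} [MeasurableSpace X] (η : Ω → Set X) {B B' : Set X}
    (h : B ⊆ B') : regionSigma η B ≤ regionSigma η B' :=
  iSup_le fun A => le_iSup (fun A : {A : Set X // MeasurableSet A ∧ A ⊆ B'} =>
    MeasurableSpace.comap (fun ω => (η ω ∩ A.1).encard) inferInstance) ⟨A.1, A.2.1, A.2.2.trans h⟩

theorem measurable_count_regionSigma {Ω X : Type*} [MeasurableSpace X] (η : Ω → Set X)
    {A B : Set X} (hA : MeasurableSet A) (hAB : A ⊆ B) :
    Measurable[regionSigma η B] fun ω => (η ω ∩ A).encard :=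
  measurable_iff_comap_le.2 <| le_iSup (fun A : {A : Set X // MeasurableSet A ∧ A ⊆ B} =>
    MeasurableSpace.comap (fun ω => (η ω ∩ A.1).encard) inferInstance) ⟨A, hA, hAB⟩

namespace IsPoissonProcess

variable {Ω X : Type*} [mΩ : MeasurableSpace Ω] [MetricSpace X] [MeasurableSpace X]
  {P : Measure Ω} {η : Ω → Set X} {μ : Measure X}

theorem regionSigma_le (h : IsPoissonProcess P η μ) (B : Set X) : regionSigma η B ≤ mΩ :=
  iSup_le fun A => measurable_iff_comap_le.1 (h.measurable_count A.1 A.2.1)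

theorem iIndepFun_count (h : IsPoissonProcess P η μ) {ι : Type*} {B : ι → Set X}
    (hB : ∀ i, MeasurableSet (B i)) (hd : Pairwise fun i j => Disjoint (B i) (B j)) :
    iIndepFun (fun i ω => (η ω ∩ B i).encard) P := by
  rw [iIndepFun_iff_finset]
  intro s
  have e := (Fintype.equivFin s).symm
  refine iIndepFun.of_precomp (g := e) e.surjective ?_
  exact h.indep _ (fun i => B (e i)) (fun i => hB _) fun i j hij =>
    hd fun h => hij (e.injective (Subtype.ext h))

/-- Each σ-algebra is generated by the π-system of events on finitely many counts. Such events in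
`B` and in `B'` are determined by the counts in two finite families of atoms, which together are
pairwise disjoint. -/
theorem indep_regionSigma [IsProbabilityMeasure P] (h : IsPoissonProcess P η μ) {B B' : Set X}
    (hB : MeasurableSet B) (hB' : MeasurableSet B') (hd : Disjoint B B') :
    Indep (regionSigma η B) (regionSigma η B') P := by
  classical
  refine IndepSets.indep (h.regionSigma_le B) (h.regionSigma_le B')
    (isPiSystem_piiUnionInter (fun A : {A : Set X // MeasurableSet A ∧ A ⊆ B} =>
      {s | MeasurableSet[MeasurableSpace.comap (fun ω => (η ω ∩ A.1).encard) inferInstance] s})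
      (fun A => @MeasurableSpace.isPiSystem_measurableSet _ (_)) Set.univ)
    (isPiSystem_piiUnionInter (fun A : {A : Set X // MeasurableSet A ∧ A ⊆ B'} =>
      {s | MeasurableSet[MeasurableSpace.comap (fun ω => (η ω ∩ A.1).encard) inferInstance] s})
      (fun A => @MeasurableSpace.isPiSystem_measurableSet _ (_)) Set.univ) ?_ ?_ ?_
  · refine Eq.trans ?_ (generateFrom_piiUnionInter_measurableSet
      (fun A : {A : Set X // MeasurableSet A ∧ A ⊆ B} =>
        MeasurableSpace.comap (fun ω => (η ω ∩ A.1).encard) inferInstance) Set.univ).symm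
    simp [regionSigma]
  · refine Eq.trans ?_ (generateFrom_piiUnionInter_measurableSet
      (fun A : {A : Set X // MeasurableSet A ∧ A ⊆ B'} =>
        MeasurableSpace.comap (fun ω => (η ω ∩ A.1).encard) inferInstance) Set.univ).symm
    simp [regionSigma]
  rw [IndepSets_iff]
  rintro E E' ⟨t, -, f, hf, rfl⟩ ⟨t', -, f', hf', rfl⟩
  let S : Finset (Set X) := t.image Subtype.val
  let S' : Finset (Set X) := t'.image Subtype.val
  have hS : ∀ A ∈ S, MeasurableSet A ∧ A ⊆ B := by
    intro A hA
    obtain ⟨a, -, rfl⟩ := Finset.mem_image.1 hA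
    exact a.2
  have hS' : ∀ A ∈ S', MeasurableSet A ∧ A ⊆ B' := by
    intro A hA
    obtain ⟨a, -, rfl⟩ := Finset.mem_image.1 hA
    exact a.2
  let T : {s // s ∈ S.powerset} ⊕ {s // s ∈ S'.powerset} → Set X :=
    Sum.elim (fun s => setAtom B S s.1) (fun s => setAtom B' S' s.1)
  have hT : iIndepFun (fun i ω => (η ω ∩ T i).encard) P := by
    refine h.iIndepFun_count ?_ ?_
    · rintro (s | s)
      · exact measurableSet_setAtom hB (fun A hA => (hS A hA).1) _
      · exact measurableSet_setAtom hB' (fun A hA => (hS' A hA).1) _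
    · rintro (s | s) (s' | s') hss
      · exact disjoint_setAtom (Finset.mem_powerset.1 s.2) (Finset.mem_powerset.1 s'.2)
          fun h => hss (by rw [Subtype.ext h])
      · exact hd.mono (fun x hx => hx.1) fun x hx => hx.1
      · exact (hd.mono (fun x hx => hx.1) fun x hx => hx.1).symm
      · exact disjoint_setAtom (Finset.mem_powerset.1 s.2) (Finset.mem_powerset.1 s'.2)
          fun h => hss (by rw [Subtype.ext h])
  have hTm : ∀ i, Measurable fun ω => (η ω ∩ T i).encard := by
    rintro (s | s)
    · exact h.measurable_count _ (measurableSet_setAtom hB (fun A hA => (hS A hA).1) _)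
    · exact h.measurable_count _ (measurableSet_setAtom hB' (fun A hA => (hS' A hA).1) _)
  have hind := hT.indepFun_finset (Finset.univ.map Function.Embedding.inl)
    (Finset.univ.map Function.Embedding.inr)
    (by rw [Finset.disjoint_left]; simp) hTm
  rw [IndepFun_iff] at hind
  refine hind _ _ ?_ ?_
  · refine Finset.measurableSet_biInter _ fun a ha => ?_
    obtain ⟨K, -, hK⟩ := hf a ha
    rw [← hK]
    have hmem : a.1 ∈ S := Finset.mem_image_of_mem _ ha
    refine ⟨{g | (∑ s : {s // s ∈ S.powerset}, if a.1 ∈ s.1 then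
      g ⟨Sum.inl s, by simp⟩ else 0) ∈ K}, MeasurableSet.of_discrete, ?_⟩
    ext ω
    simp only [Set.mem_preimage, Set.mem_ofPred_eq]
    rw [encard_inter_eq_sum_setAtom hmem a.2.2, ← Finset.sum_coe_sort S.powerset]
    rfl
  · refine Finset.measurableSet_biInter _ fun a ha => ?_
    obtain ⟨K, -, hK⟩ := hf' a ha
    rw [← hK]
    have hmem : a.1 ∈ S' := Finset.mem_image_of_mem _ ha
    refine ⟨{g | (∑ s : {s // s ∈ S'.powerset}, if a.1 ∈ s.1 then
      g ⟨Sum.inr s, by simp⟩ else 0) ∈ K}, MeasurableSet.of_discrete, ?_⟩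
    ext ω
    simp only [Set.mem_preimage, Set.mem_ofPred_eq]
    rw [encard_inter_eq_sum_setAtom hmem a.2.2, ← Finset.sum_coe_sort S'.powerset]
    rfl

end IsPoissonProcess

/-! ### Void probabilities and second moments of counts. -/

theorem sq_le_two_pow_succ (k : ℕ) : k ^ 2 ≤ 2 ^ (k + 1) := by
  induction k with
  | zero => simp
  | succ n ih =>
    rcases lt_or_ge n 3 with h | h
    · interval_cases n <;> norm_num
    · calc (n + 1) ^ 2 ≤ 2 * n ^ 2 := by nlinarith
        _ ≤ 2 * 2 ^ (n + 1) := by omega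
        _ = 2 ^ (n + 1 + 1) := by ring

/-- After `k² ≤ 2 ^ (k + 1)` the series is `2 * exp r` times the total mass of the Poisson law with
parameter `2 * r`. The bound is applied to bounded means, so its size is harmless. -/
theorem lintegral_sq_poissonMeasure_le (r : NNReal) :
    ∫⁻ k, (k : ENNReal) ^ 2 ∂poissonMeasure r ≤ ENNReal.ofReal (2 * Real.exp r) := by
  have h1 := (hasSum_one_poissonMeasure (2 * r)).mul_left (2 * Real.exp r)
  rw [mul_one] at h1
  rw [lintegral_countable', ← h1.tsum_eq, ENNReal.ofReal_tsum_of_nonneg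
    (fun n => by positivity) h1.summable]
  refine ENNReal.tsum_le_tsum fun k => ?_
  rw [poissonMeasure_singleton, ← ENNReal.ofReal_natCast, ← ENNReal.ofReal_pow (by positivity),
    ← ENNReal.ofReal_mul (by positivity)]
  refine ENNReal.ofReal_le_ofReal ?_
  have h2 : ((k : ℝ)) ^ 2 ≤ 2 ^ (k + 1) := by exact_mod_cast sq_le_two_pow_succ k
  have h3 : Real.exp (-(r : ℝ)) = Real.exp r * Real.exp (-((2 * r : NNReal) : ℝ)) := by
    rw [← Real.exp_add]; push_cast; ring_nf
  rw [h3]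
  push_cast
  calc _ ≤ (2 : ℝ) ^ (k + 1) * (Real.exp r * Real.exp (-(2 * r)) * r ^ k / k.factorial) := by
        gcongr
    _ = _ := by rw [mul_pow]; ring

namespace IsPoissonProcess

variable {Ω X : Type*} [mΩ : MeasurableSpace Ω] [MetricSpace X] [MeasurableSpace X]
  {P : Measure Ω} {η : Ω → Set X} {μ : Measure X}

theorem measurableSet_void (h : IsPoissonProcess P η μ) {B : Set X} (hB : MeasurableSet B) :
    MeasurableSet {ω | η ω ∩ B = ∅} := by
  have := h.measurable_count B hB (MeasurableSet.singleton 0)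
  simpa [Set.preimage, Set.encard_eq_zero] using this

theorem measure_void (h : IsPoissonProcess P η μ) {B : Set X} (hB : MeasurableSet B)
    (hμ : μ B ≠ ⊤) : P {ω | η ω ∩ B = ∅} = ENNReal.ofReal (Real.exp (-(μ B).toReal)) := by
  have h1 : P.map (fun ω => (η ω ∩ B).encard) {0} =
      (poissonMeasure (μ B).toNNReal).map (fun k : ℕ => (k : ℕ∞)) {0} := by
    rw [h.count_law B hB hμ]
  rw [Measure.map_apply (h.measurable_count B hB) (MeasurableSet.singleton 0),
    Measure.map_apply (measurable_of_countable _) (MeasurableSet.singleton 0)] at h1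
  have e1 : (fun ω => (η ω ∩ B).encard) ⁻¹' {0} = {ω | η ω ∩ B = ∅} := by
    ext ω; simp [Set.encard_eq_zero]
  have e2 : (fun k : ℕ => (k : ℕ∞)) ⁻¹' {0} = {0} := by
    ext k; simp
  rw [e1, e2, poissonMeasure_singleton] at h1
  rw [h1, pow_zero, Nat.factorial_zero, Nat.cast_one, div_one, mul_one]
  rfl

theorem lintegral_count_sq_le (h : IsPoissonProcess P η μ) {B : Set X} (hB : MeasurableSet B)
    (hμ : μ B ≠ ⊤) :
    ∫⁻ ω, ((η ω ∩ B).encard : ENNReal) ^ 2 ∂P ≤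
      ENNReal.ofReal (2 * Real.exp (μ B).toReal) := by
  have h1 : ∫⁻ ω, ((η ω ∩ B).encard : ENNReal) ^ 2 ∂P =
      ∫⁻ n, (n : ENNReal) ^ 2 ∂(P.map fun ω => (η ω ∩ B).encard) :=
    (lintegral_map (f := fun n : ℕ∞ => (n : ENNReal) ^ 2) (measurable_of_countable _)
      (h.measurable_count B hB)).symm
  rw [h1, h.count_law B hB hμ, lintegral_map (measurable_of_countable _)
    (measurable_of_countable _)]
  exact lintegral_sq_poissonMeasure_le _

end IsPoissonProcess

/-! ### Locality of radial edge lengths. -/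

section RadialEdge

variable {X : Type*} [MetricSpace X] {o x : X} {ξ ξ' : Set X}

theorem isRadialNearest_radialNearest (hξ : ∀ r, (ξ ∩ Metric.ball o r).Finite) (hx : x ≠ o) :
    IsRadialNearest o ξ x (radialNearest o ξ x) := by
  have hex : ∃ y, IsRadialNearest o ξ x y := by
    have hf : {z ∈ ξ ∪ {o} | dist o z < dist o x}.Finite := by
      refine ((hξ (dist o x)).union (Set.finite_singleton o)).subset ?_
      rintro z ⟨hz | hz, h⟩
      · exact Or.inl ⟨hz, by rwa [Metric.mem_ball, dist_comm]⟩
      · exact Or.inr hz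
    obtain ⟨y, hy, hmin⟩ := hf.exists_minimalFor (fun z => dist x z) _
      ⟨o, Or.inr rfl, by rw [dist_self]; exact dist_pos.2 hx.symm⟩
    refine ⟨y, hy, fun z hz hzo => ?_⟩
    by_contra! hlt
    exact absurd (hmin ⟨hz, hzo⟩ hlt.le) (not_le.2 hlt)
  rw [radialNearest, dif_pos hex]
  exact hex.choose_spec

/-- No point is strictly closer to the root than the root itself, so the default value applies. -/
theorem radialEdgeLength_self (o : X) (ξ : Set X) : radialEdgeLength o ξ o = 0 := by
  have : ¬ ∃ y, IsRadialNearest o ξ o y := by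
    rintro ⟨y, ⟨-, hy⟩, -⟩
    rw [dist_self] at hy
    exact absurd hy (not_lt.2 dist_nonneg)
  rw [radialEdgeLength, radialNearest, dif_neg this, dist_self]

theorem radialEdgeLength_nonneg (o : X) (ξ : Set X) (x : X) : 0 ≤ radialEdgeLength o ξ x :=
  dist_nonneg

theorem radialEdgeLength_lt_iff (hξ : ∀ r, (ξ ∩ Metric.ball o r).Finite) (hx : x ≠ o) {s : ℝ} :
    radialEdgeLength o ξ x < s ↔
      ∃ z ∈ ξ ∪ {o}, dist o z < dist o x ∧ dist x z < s := by
  have h := isRadialNearest_radialNearest hξ hx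
  exact ⟨fun hs => ⟨_, h.1.1, h.1.2, hs⟩, fun ⟨z, hz, hzo, hzs⟩ => (h.2 z hz hzo).trans_lt hzs⟩

theorem le_radialEdgeLength_iff (hξ : ∀ r, (ξ ∩ Metric.ball o r).Finite) (hx : x ≠ o) {s : ℝ} :
    s ≤ radialEdgeLength o ξ x ↔
      ∀ z ∈ ξ ∪ {o}, dist o z < dist o x → s ≤ dist x z := by
  rw [← not_lt, radialEdgeLength_lt_iff hξ hx]
  push Not
  rfl

theorem radialEdgeLength_le_dist (hξ : ∀ r, (ξ ∩ Metric.ball o r).Finite) {z : X} (hz : z ∈ ξ)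
    (hzx : dist o z < dist o x) : radialEdgeLength o ξ x ≤ dist x z := by
  have hx : x ≠ o := by
    rintro rfl
    rw [dist_self] at hzx
    exact absurd hzx (not_lt.2 dist_nonneg)
  exact (isRadialNearest_radialNearest hξ hx).2 z (Or.inl hz) hzx

theorem radialEdgeLength_le_dist_root (hξ : ∀ r, (ξ ∩ Metric.ball o r).Finite) :
    radialEdgeLength o ξ x ≤ dist o x := by
  rcases eq_or_ne x o with rfl | hx
  · rw [radialEdgeLength_self, dist_self]
  · rw [dist_comm]
    refine (isRadialNearest_radialNearest hξ hx).2 o (Or.inr rfl) ?_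
    rw [dist_self]
    exact dist_pos.2 hx.symm

/-- The edge length is a minimum over the admissible points. This min structure gives the second
difference of the functional its sign. -/
theorem radialEdgeLength_union (hξ : ∀ r, (ξ ∩ Metric.ball o r).Finite)
    (hξ' : ∀ r, (ξ' ∩ Metric.ball o r).Finite) :
    radialEdgeLength o (ξ ∪ ξ') x = min (radialEdgeLength o ξ x) (radialEdgeLength o ξ' x) := by
  rcases eq_or_ne x o with rfl | hx
  · simp [radialEdgeLength_self]
  have hu : ∀ r, ((ξ ∪ ξ') ∩ Metric.ball o r).Finite := fun r => by
    rw [Set.union_inter_distrib_right]; exact (hξ r).union (hξ' r)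
  refine eq_of_forall_le_iff fun s => ?_
  rw [le_min_iff, le_radialEdgeLength_iff hu hx, le_radialEdgeLength_iff hξ hx,
    le_radialEdgeLength_iff hξ' hx]
  refine ⟨fun h => ⟨fun z hz => h z ?_, fun z hz => h z ?_⟩, fun h z hz => ?_⟩
  · exact hz.imp_left Or.inl
  · exact hz.imp_left Or.inr
  · rcases hz with (hz | hz) | hz
    · exact h.1 z (Or.inl hz)
    · exact h.2 z (Or.inl hz)
    · exact h.1 z (Or.inr hz)

/-- The edge length is determined by the points that are nearer than the edge length. -/
theorem radialEdgeLength_eq_of_inter_subset (hξ : ∀ r, (ξ ∩ Metric.ball o r).Finite)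
    (hsub : ξ' ⊆ ξ) {s : ℝ} (hs : radialEdgeLength o ξ x < s)
    (hloc : ∀ z ∈ ξ, dist o z < dist o x → dist x z < s → z ∈ ξ') :
    radialEdgeLength o ξ' x = radialEdgeLength o ξ x := by
  rcases eq_or_ne x o with rfl | hx
  · simp [radialEdgeLength_self]
  have hξ' : ∀ r, (ξ' ∩ Metric.ball o r).Finite := fun r =>
    (hξ r).subset (Set.inter_subset_inter_left _ hsub)
  have h := isRadialNearest_radialNearest hξ hx
  have h' := isRadialNearest_radialNearest hξ' hx
  refine le_antisymm (h'.2 _ ?_ h.1.2) (h.2 _ (h'.1.1.imp_left fun h => hsub h) h'.1.2)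
  rcases h.1.1 with h1 | h1
  · exact Or.inl (hloc _ h1 h.1.2 hs)
  · exact Or.inr h1

end RadialEdge

/-! ### Measurability of the functional through counting kernels. -/

section CountingKernel

variable {Ω X : Type*} [MeasurableSpace Ω] [MeasurableSpace X] [MeasurableSingletonClass X]

theorem count_restrict_apply {ξ A : Set X} (hξ : ξ.Finite) (hA : MeasurableSet A) :
    (Measure.count.restrict ξ) A = ((ξ ∩ A).encard : ENNReal) := by
  rw [Measure.restrict_apply hA, Set.inter_comm,
    Measure.count_apply (hξ.measurableSet.inter hA)]

/-- The counting measures of a family of finite sets with measurable counts. -/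
def countingKernel (ξ : Ω → Set X) (hfin : ∀ ω, (ξ ω).Finite)
    (hcount : ∀ A, MeasurableSet A → Measurable fun ω => (ξ ω ∩ A).encard) : Kernel Ω X where
  toFun ω := Measure.count.restrict (ξ ω)
  measurable' := by
    refine Measure.measurable_of_measurable_coe _ fun A hA => ?_
    simp_rw [count_restrict_apply (hfin _) hA]
    exact (measurable_of_countable (fun n : ℕ∞ => (n : ENNReal))).comp (hcount A hA)

variable {ξ : Ω → Set X} {hfin : ∀ ω, (ξ ω).Finite}
    {hcount : ∀ A, MeasurableSet A → Measurable fun ω => (ξ ω ∩ A).encard}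

theorem countingKernel_apply (ω : Ω) {A : Set X} (hA : MeasurableSet A) :
    countingKernel ξ hfin hcount ω A = ((ξ ω ∩ A).encard : ENNReal) :=
  count_restrict_apply (hfin ω) hA

theorem lintegral_countingKernel (ω : Ω) (f : X → ENNReal) :
    ∫⁻ x, f x ∂countingKernel ξ hfin hcount ω = ∑ x ∈ (hfin ω).toFinset, f x := by
  have : countingKernel ξ hfin hcount ω = Measure.count.restrict (hfin ω).toFinset := by
    simp [countingKernel]
  rw [this, lintegral_finset]
  simp

/-- The total mass need not be bounded in `ω`, so the kernel is split according to the number of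
points. -/
instance : IsSFiniteKernel (countingKernel ξ hfin hcount) := by
  classical
  have hms : ∀ n : ℕ, MeasurableSet {ω | (ξ ω).encard = n} := fun n => by
    have := hcount Set.univ MeasurableSet.univ (MeasurableSet.singleton (n : ℕ∞))
    simpa [Set.preimage] using this
  refine ⟨fun n => Kernel.piecewise (hms n) (countingKernel ξ hfin hcount) 0, fun n => ?_, ?_⟩
  · refine ⟨n, ENNReal.natCast_lt_top n, fun ω => ?_⟩
    rw [Kernel.piecewise_apply]
    split_ifs with h
    · rw [countingKernel_apply _ MeasurableSet.univ, Set.inter_univ, h]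
      simp
    · simp
  · ext ω A hA
    rw [Kernel.sum_apply' _ _ hA]
    have hn : (ξ ω).encard = ((ξ ω).ncard : ℕ∞) := (Set.Finite.cast_ncard_eq (hfin ω)).symm
    rw [tsum_eq_single (ξ ω).ncard]
    · rw [Kernel.piecewise_apply', if_pos (show ω ∈ {ω' | (ξ ω').encard = ((ξ ω).ncard : ℕ∞)} from hn)]
    · intro m hm
      rw [Kernel.piecewise_apply', if_neg]
      · simp
      · intro h
        refine hm ?_
        have h' : (ξ ω).encard = (m : ℕ∞) := h
        rw [hn] at h'
        exact_mod_cast h'.symm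

end CountingKernel

/-- The contribution of the points in `S` to the edge-length functional. -/
def regionFunctional {X : Type*} [MetricSpace X] (o : X) (α : ℝ) (S ξ : Set X) : ℝ :=
  ∑ᶠ x ∈ ξ ∩ S, radialEdgeLength o ξ x ^ α

theorem edgeLengthFunctional_eq {X : Type*} [MetricSpace X] (o : X) (α R : ℝ) (ξ : Set X) :
    edgeLengthFunctional o α R ξ = regionFunctional o α (Metric.ball o R) ξ := rfl

theorem regionFunctional_nonneg {X : Type*} [MetricSpace X] (o : X) (α : ℝ) (S ξ : Set X) :
    0 ≤ regionFunctional o α S ξ :=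
  finsum_nonneg fun x => finsum_nonneg fun _ =>
    Real.rpow_nonneg (radialEdgeLength_nonneg o ξ x) _

/-- Edges lead towards the root, so points outside the ball have no influence. This reduces
measurability to finite point sets. -/
theorem regionFunctional_inter_ball {X : Type*} [MetricSpace X] {o : X} {α R : ℝ} {S ξ : Set X}
    (hξ : ∀ r, (ξ ∩ Metric.ball o r).Finite) (hS : S ⊆ Metric.ball o R) :
    regionFunctional o α S (ξ ∩ Metric.ball o R) = regionFunctional o α S ξ := by
  rw [regionFunctional, regionFunctional, Set.inter_assoc, Set.inter_eq_self_of_subset_right hS]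
  refine finsum_mem_congr rfl fun x hx => ?_
  congr 1
  refine radialEdgeLength_eq_of_inter_subset hξ Set.inter_subset_left (lt_add_one _) ?_
  intro z hz hzx _
  refine ⟨hz, ?_⟩
  have := hS hx.2
  rw [Metric.mem_ball, dist_comm] at this ⊢
  exact hzx.trans this

section Measurability

variable {Ω X : Type*} [MeasurableSpace Ω] [MetricSpace X] [MeasurableSpace X]
  [SecondCountableTopology X] [BorelSpace X]

/-- Away from the root, the edge is shorter than `t` iff the root is that near or the counting
kernel charges a section of a jointly measurable set. No measurable choice of the neighbour is
needed. -/
theorem measurable_radialEdgeLength (o : X) {ξ : Ω → Set X} (hfin : ∀ ω, (ξ ω).Finite)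
    (hcount : ∀ A, MeasurableSet A → Measurable fun ω => (ξ ω ∩ A).encard) :
    Measurable fun p : Ω × X => radialEdgeLength o (ξ p.1) p.2 := by
  refine measurable_of_Iio fun t => ?_
  let κ : Kernel (Ω × X) X :=
    (countingKernel ξ hfin hcount).comap (Prod.fst : Ω × X → Ω) measurable_fst
  let s : Set ((Ω × X) × X) := {q | dist o q.2 < dist o q.1.2 ∧ dist q.1.2 q.2 < t}
  have hs : MeasurableSet s := by
    refine MeasurableSet.inter ?_ ?_
    · exact measurableSet_lt (measurable_const.dist measurable_snd)
        (measurable_const.dist (measurable_snd.comp measurable_fst))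
    · exact measurableSet_lt ((measurable_snd.comp measurable_fst).dist measurable_snd)
        measurable_const
  have hκ : Measurable fun p => κ p (Prod.mk p ⁻¹' s) := Kernel.measurable_kernel_prodMk_left hs
  have ho : MeasurableSet {p : Ω × X | p.2 = o} := measurable_snd (MeasurableSet.singleton o)
  have heq : (fun p : Ω × X => radialEdgeLength o (ξ p.1) p.2) ⁻¹' Set.Iio t =
      ({p | p.2 = o} ∩ {_p | 0 < t}) ∪ ({p | p.2 = o}ᶜ ∩
        ({p | dist o p.2 < t} ∪ {p | κ p (Prod.mk p ⁻¹' s) ≠ 0})) := by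
    ext p
    rcases eq_or_ne p.2 o with h | h
    · simp [h, radialEdgeLength_self]
    · have hm : MeasurableSet (Prod.mk p ⁻¹' s) := measurable_prodMk_left hs
      have hκp : κ p (Prod.mk p ⁻¹' s) ≠ 0 ↔ (ξ p.1 ∩ Prod.mk p ⁻¹' s).Nonempty := by
        rw [Kernel.comap_apply, countingKernel_apply _ hm, Ne, ENat.toENNReal_eq_zero,
          Set.encard_eq_zero, Set.nonempty_iff_ne_empty]
      have h' : dist o p.2 > 0 := dist_pos.2 h.symm
      simp only [Set.mem_preimage, Set.mem_Iio, Set.mem_union, Set.mem_inter_iff,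
        Set.mem_ofPred_eq, h, false_and, Set.mem_compl_iff, not_false_eq_true, true_and, false_or,
        hκp]
      rw [radialEdgeLength_lt_iff (fun r => (hfin _).inter_of_left _) h]
      constructor
      · rintro ⟨z, hz | hz, h1, h2⟩
        · exact Or.inr ⟨z, hz, h1, h2⟩
        · rw [hz, dist_comm] at h2
          exact Or.inl h2
      · rintro (h1 | ⟨z, hz, h1, h2⟩)
        · exact ⟨o, Or.inr rfl, by rwa [dist_self], by rwa [dist_comm]⟩
        · exact ⟨z, Or.inl hz, h1, h2⟩
  rw [heq]
  refine (ho.inter (MeasurableSet.const _)).union (ho.compl.inter (MeasurableSet.union ?_ ?_))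
  · exact measurableSet_lt (measurable_const.dist measurable_snd) measurable_const
  · exact (measurableSet_eq_fun hκ measurable_const).compl

theorem measurable_regionFunctional_of_finite (o : X) (α : ℝ) {S : Set X} (hS : MeasurableSet S)
    {ξ : Ω → Set X} (hfin : ∀ ω, (ξ ω).Finite)
    (hcount : ∀ A, MeasurableSet A → Measurable fun ω => (ξ ω ∩ A).encard) :
    Measurable fun ω => regionFunctional o α S (ξ ω) := by
  classical
  have h1 : Measurable fun p : Ω × X =>
      S.indicator (fun x => ENNReal.ofReal (radialEdgeLength o (ξ p.1) x ^ α)) p.2 := by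
    have : (fun p : Ω × X =>
      S.indicator (fun x => ENNReal.ofReal (radialEdgeLength o (ξ p.1) x ^ α)) p.2) =
      (Prod.snd ⁻¹' S).indicator
        fun p : Ω × X => ENNReal.ofReal (radialEdgeLength o (ξ p.1) p.2 ^ α) := by
      ext p; simp [Set.indicator]
    rw [this]
    exact (((measurable_radialEdgeLength o hfin hcount).pow_const α).ennreal_ofReal).indicator
      (measurable_snd hS)
  have h2 := (h1.lintegral_kernel_prod_right' (κ := countingKernel ξ hfin hcount)).ennreal_toReal
  convert h2 using 2 with ω
  rw [lintegral_countingKernel, ENNReal.toReal_sum]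
  · rw [regionFunctional, finsum_mem_eq_finite_toFinset_sum _ ((hfin ω).inter_of_left S)]
    have e : ((hfin ω).inter_of_left S).toFinset = (hfin ω).toFinset.filter (· ∈ S) := by
      ext x; simp
    rw [e, Finset.sum_filter]
    refine Finset.sum_congr rfl fun x _ => ?_
    split_ifs with hx
    · rw [Set.indicator_of_mem hx, ENNReal.toReal_ofReal
        (Real.rpow_nonneg (radialEdgeLength_nonneg _ _ _) _)]
    · rw [Set.indicator_of_notMem hx, ENNReal.toReal_zero]
  · intro x _
    by_cases hx : x ∈ S <;> simp [hx]

theorem measurable_regionFunctional {o : X} (α : ℝ) {R : ℝ} {S : Set X} (hS : MeasurableSet S)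
    (hSR : S ⊆ Metric.ball o R) {ξ : Ω → Set X} (hfin : ∀ ω r, (ξ ω ∩ Metric.ball o r).Finite)
    (hcount : ∀ A, MeasurableSet A → Measurable fun ω => (ξ ω ∩ A).encard) :
    Measurable fun ω => regionFunctional o α S (ξ ω) := by
  simp_rw [← fun ω => regionFunctional_inter_ball (α := α) (hfin ω) hSR]
  refine measurable_regionFunctional_of_finite o α hS (fun ω => hfin ω R) fun A hA => ?_
  simp_rw [Set.inter_assoc]
  exact hcount _ (measurableSet_ball.inter hA)

end Measurability

/-! ### Separated sets and volume packing. -/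

theorem exists_maximal_separated {X : Type*} [MetricSpace X] (A : Set X) {s : ℝ} (hs : 0 < s)
    (N : ℕ) (hN : ∀ T : Finset X, ↑T ⊆ A → (∀ x ∈ T, ∀ y ∈ T, x ≠ y → s ≤ dist x y) → T.card ≤ N) :
    ∃ T : Finset X, ↑T ⊆ A ∧ (∀ x ∈ T, ∀ y ∈ T, x ≠ y → s ≤ dist x y) ∧
      ∀ x ∈ A, ∃ y ∈ T, dist x y < s := by
  classical
  let p : ℕ → Prop := fun n => ∃ T : Finset X, ↑T ⊆ A ∧
    (∀ x ∈ T, ∀ y ∈ T, x ≠ y → s ≤ dist x y) ∧ T.card = n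
  have h0 : p 0 := ⟨∅, by simp, by simp, rfl⟩
  obtain ⟨T, hTA, hT, hcard⟩ := Nat.findGreatest_spec (P := p) (Nat.zero_le N) h0
  refine ⟨T, hTA, hT, fun x hx => ?_⟩
  by_contra! hfar
  have hxT : x ∉ T := fun h => absurd (hfar x h) (by rw [dist_self]; exact not_le.2 hs)
  have hp : p (T.card + 1) := by
    refine ⟨insert x T, ?_, ?_, Finset.card_insert_of_notMem hxT⟩
    · rw [Finset.coe_insert]; exact Set.insert_subset hx hTA
    · intro y hy z hz hyz
      rcases Finset.mem_insert.1 hy with rfl | hy' <;>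
        rcases Finset.mem_insert.1 hz with rfl | hz'
      · exact absurd rfl hyz
      · exact hfar z hz'
      · rw [dist_comm]; exact hfar y hy'
      · exact hT y hy' z hz' hyz
  have hle : T.card + 1 ≤ N := by
    obtain ⟨T', h1, h2, h3⟩ := hp
    rw [← h3]; exact hN T' h1 h2
  have := Nat.le_findGreatest hle hp
  omega

namespace HypSpace

variable {d : ℕ} [NeZero d]

instance : SecondCountableTopology (HypSpace d) :=
  isOpenEmbedding_coord.isEmbedding.secondCountableTopology

/-- The point at distance `s` from `x` on the geodesic from `x` to `o`. -/
def towards (o x : HypSpace d) (s : ℝ) : HypSpace d :=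
  if h : 0 ≤ s ∧ s ≤ dist o x then (exists_between o x h.1 h.2).choose else x

theorem dist_towards {o x : HypSpace d} {s : ℝ} (hs : 0 ≤ s) (hs' : s ≤ dist o x) :
    dist (towards o x s) x = s := by
  rw [towards, dif_pos ⟨hs, hs'⟩]
  exact (exists_between o x hs hs').choose_spec.1

theorem dist_root_towards {o x : HypSpace d} {s : ℝ} (hs : 0 ≤ s) (hs' : s ≤ dist o x) :
    dist o (towards o x s) = dist o x - s := by
  rw [towards, dif_pos ⟨hs, hs'⟩]
  exact (exists_between o x hs hs').choose_spec.2

theorem card_mul_le_of_disjoint_balls {ι : Type*} {c : ℝ}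
    (hc : ∀ (z : HypSpace d) (s : ℝ), 0 < s →
      ENNReal.ofReal (c * s ^ d) ≤ hypVolume d (Metric.ball z s)) {s : ℝ} (hs : 0 < s)
    (T : Finset ι) (p : ι → HypSpace d) {A : Set (HypSpace d)}
    (hd : (T : Set ι).PairwiseDisjoint fun i => Metric.ball (p i) s)
    (hA : ∀ i ∈ T, Metric.ball (p i) s ⊆ A) :
    (T.card : ENNReal) * ENNReal.ofReal (c * s ^ d) ≤ hypVolume d A := by
  calc (T.card : ENNReal) * ENNReal.ofReal (c * s ^ d)
      = ∑ _i ∈ T, ENNReal.ofReal (c * s ^ d) := by simp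
    _ ≤ ∑ i ∈ T, hypVolume d (Metric.ball (p i) s) := Finset.sum_le_sum fun i _ => hc _ _ hs
    _ = hypVolume d (⋃ i ∈ T, Metric.ball (p i) s) :=
        (measure_biUnion_finset hd fun i _ => measurableSet_ball).symm
    _ ≤ _ := measure_mono (Set.iUnion₂_subset hA)

theorem card_mul_le_of_separated {c : ℝ}
    (hc : ∀ (z : HypSpace d) (s : ℝ), 0 < s →
      ENNReal.ofReal (c * s ^ d) ≤ hypVolume d (Metric.ball z s)) {s r : ℝ} (hs : 0 < s)
    {x : HypSpace d} {T : Finset (HypSpace d)}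
    (hT : ∀ y ∈ T, ∀ z ∈ T, y ≠ z → s ≤ dist y z) (hTx : ∀ y ∈ T, dist y x < r) :
    (T.card : ENNReal) * ENNReal.ofReal (c * (s / 2) ^ d) ≤
      hypVolume d (Metric.ball x (r + s / 2)) := by
  refine card_mul_le_of_disjoint_balls hc (half_pos hs) T id ?_ ?_
  · intro y hy z hz hyz
    exact Metric.ball_disjoint_ball (by have := hT y hy z hz hyz; simp only [id]; linarith)
  · intro y hy
    exact Metric.ball_subset_ball' (by have := hTx y hy; simp only [id]; linarith)

/-- Balls around points near the boundary stick out of `B(o, R)`. Each is replaced by a ball of half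
the radius, moved towards `o` where necessary, so that the comparison is with the volume of `B(o,
R)` itself. -/
theorem card_mul_le_of_separated_of_subset_ball {c : ℝ}
    (hc : ∀ (z : HypSpace d) (s : ℝ), 0 < s →
      ENNReal.ofReal (c * s ^ d) ≤ hypVolume d (Metric.ball z s)) {s R : ℝ} (hs : 0 < s)
    (hsR : s ≤ 2 * R) {o : HypSpace d} {T : Finset (HypSpace d)} (hTo : ↑T ⊆ Metric.ball o R)
    (hT : ∀ y ∈ T, ∀ z ∈ T, y ≠ z → s ≤ dist y z) :
    (T.card : ENNReal) * ENNReal.ofReal (c * (s / 4) ^ d) ≤ hypVolume d (Metric.ball o R) := by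
  have hex : ∀ y : HypSpace d, ∃ m, dist y o < R →
      Metric.ball m (s / 4) ⊆ Metric.ball y (s / 2) ∩ Metric.ball o R := by
    intro y
    rcases le_or_gt (s / 4) (dist o y) with h | h
    · obtain ⟨m, h1, h2⟩ := exists_between o y (by positivity) h
      refine ⟨m, fun hy => Set.subset_inter (Metric.ball_subset_ball' ?_)
        (Metric.ball_subset_ball' ?_)⟩
      · linarith
      · rw [dist_comm m o, h2, dist_comm o y]; linarith
    · refine ⟨y, fun _ => Set.subset_inter (Metric.ball_subset_ball (by linarith))
        (Metric.ball_subset_ball' ?_)⟩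
      rw [dist_comm]; linarith
  choose p hp using hex
  refine card_mul_le_of_disjoint_balls hc (by positivity) T p ?_ fun y hy => ?_
  · intro y hy z hz hyz
    refine (Metric.ball_disjoint_ball (x := y) (y := z) (δ := s / 2) (ε := s / 2) ?_).mono
      ((hp y (hTo hy)).trans Set.inter_subset_left) ((hp z (hTo hz)).trans Set.inter_subset_left)
    linarith [hT y hy z hz hyz]
  · exact (hp y (hTo hy)).trans Set.inter_subset_right

theorem exists_maximal_separated_ball (hd : 2 ≤ d) (o : HypSpace d) {s R : ℝ} (hs : 0 < s)
    {A : Set (HypSpace d)} (hA : A ⊆ Metric.ball o R) :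
    ∃ T : Finset (HypSpace d), ↑T ⊆ A ∧ (∀ x ∈ T, ∀ y ∈ T, x ≠ y → s ≤ dist x y) ∧
      ∀ x ∈ A, ∃ y ∈ T, dist x y < s := by
  obtain ⟨c, hc, hcv⟩ := exists_le_hypVolume_ball hd
  have hpos : 0 < c * (s / 2) ^ d := by positivity
  refine exists_maximal_separated A hs
    ⌈(hypVolume d (Metric.ball o (R + s / 2))).toReal / (c * (s / 2) ^ d)⌉₊ fun T hTA hT => ?_
  have h1 := card_mul_le_of_separated hcv hs hT (x := o) (r := R) fun y hy => hA (hTA hy)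
  have h2 := ENNReal.toReal_mono (hypVolume_ball_lt_top o _).ne h1
  rw [ENNReal.toReal_mul, ENNReal.toReal_ofReal hpos.le, ENNReal.toReal_natCast] at h2
  have h3 := ((le_div_iff₀ hpos).2 h2).trans (Nat.le_ceil _)
  exact_mod_cast h3

end HypSpace

theorem regionFunctional_le {X : Type*} [MetricSpace X] {o : X} {α M : ℝ} (hα : 0 ≤ α)
    {S ξ : Set X} (hfin : (ξ ∩ S).Finite) (h : ∀ x ∈ ξ ∩ S, radialEdgeLength o ξ x ≤ M) :
    ENNReal.ofReal (regionFunctional o α S ξ) ≤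
      ((ξ ∩ S).encard : ENNReal) * ENNReal.ofReal (M ^ α) := by
  rw [regionFunctional, finsum_mem_eq_finite_toFinset_sum _ hfin]
  have h1 : ∑ x ∈ hfin.toFinset, radialEdgeLength o ξ x ^ α ≤ ∑ _x ∈ hfin.toFinset, M ^ α := by
    refine Finset.sum_le_sum fun x hx => ?_
    exact Real.rpow_le_rpow (radialEdgeLength_nonneg _ _ _) (h x (hfin.mem_toFinset.1 hx)) hα
  refine (ENNReal.ofReal_le_ofReal h1).trans_eq ?_
  rw [Finset.sum_const, nsmul_eq_mul, ENNReal.ofReal_mul (by positivity), ENNReal.ofReal_natCast,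
    hfin.encard_eq_coe_toFinset_card]
  simp

/-! ### Stopping balls and void events. -/

namespace HypSpace

variable {d : ℕ} [NeZero d]

/-- A ball that, if it contains a point of a set, bounds the edge lengths at points near `x` by
`2 * k * ρ`. -/
def stopBall (o : HypSpace d) (ρ : ℝ) (x : HypSpace d) (k : ℕ) : Set (HypSpace d) :=
  Metric.ball (towards o x (k * ρ)) ((k - 1) * ρ)

/-- The set `ξ` has no point in the `k`-th stopping ball at `x`, and the root is not near either. -/
def IsVoid (o : HypSpace d) (ρ : ℝ) (x : HypSpace d) (k : ℕ) (ξ : Set (HypSpace d)) : Prop :=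
  k * ρ ≤ dist o x ∧ ξ ∩ stopBall o ρ x k = ∅

variable {o x : HypSpace d} {ρ : ℝ} {k : ℕ} {ξ : Set (HypSpace d)}

theorem isVoid_zero (hρ : 0 < ρ) : IsVoid o ρ x 0 ξ := by
  refine ⟨by simp [dist_nonneg], ?_⟩
  rw [stopBall, Metric.ball_eq_empty.2 (by simp; exact hρ.le), Set.inter_empty]

theorem exists_not_isVoid (hρ : 0 < ρ) (o x : HypSpace d) (ξ : Set (HypSpace d)) :
    ∃ k, ¬ IsVoid o ρ x k ξ := by
  obtain ⟨k, hk⟩ := exists_nat_gt (dist o x / ρ)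
  refine ⟨k, fun h => ?_⟩
  rw [div_lt_iff₀ hρ] at hk
  exact absurd h.1 (not_le.2 hk)

/-- A point of the stopping ball is closer to `o` than `dist o x - ρ`, hence an admissible neighbour
for every `y` in the `ρ`-ball of `x`, and its distance to `y` is less than `ρ + kρ + (k - 1)ρ`. If
instead the root is nearer than `kρ`, the edge is no longer than the distance to the root. -/
theorem radialEdgeLength_lt_of_not_isVoid (hρ : 0 < ρ)
    (hξ : ∀ r, (ξ ∩ Metric.ball o r).Finite) (hk : ¬ IsVoid o ρ x k ξ) {y : HypSpace d}
    (hy : dist y x < ρ) : radialEdgeLength o ξ y < 2 * k * ρ := by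
  rcases Nat.eq_zero_or_pos k with rfl | hk0
  · exact absurd (isVoid_zero hρ) hk
  have hk1 : (1 : ℝ) ≤ k := by exact_mod_cast hk0
  rcases lt_or_ge (dist o x) (k * ρ) with h | h
  · refine (radialEdgeLength_le_dist_root hξ).trans_lt ?_
    have := dist_triangle o x y
    rw [dist_comm x y] at this
    nlinarith
  · have hne : (ξ ∩ stopBall o ρ x k).Nonempty :=
      Set.nonempty_iff_ne_empty.2 fun he => hk ⟨h, he⟩
    obtain ⟨z, hz, hzb⟩ := hne
    have h1 := dist_towards (s := k * ρ) (by positivity) h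
    have h2 := dist_root_towards (s := k * ρ) (by positivity) h
    rw [stopBall, Metric.mem_ball] at hzb
    refine (radialEdgeLength_le_dist hξ hz ?_).trans_lt ?_
    · have := dist_triangle o (towards o x (k * ρ)) z
      have := dist_triangle o y x
      rw [dist_comm (towards o x (k * ρ)) z] at *
      linarith
    · have := dist_triangle y x z
      have := dist_triangle x (towards o x (k * ρ)) z
      rw [dist_comm x (towards o x (k * ρ)), dist_comm (towards o x (k * ρ)) z] at this
      linarith

theorem stopBall_subset (hρ : 0 < ρ) (h : k * ρ ≤ dist o x) :
    stopBall o ρ x k ⊆ Metric.ball x ((2 * k + 1) * ρ) := by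
  refine Metric.ball_subset_ball' ?_
  rw [dist_towards (by positivity) h]
  nlinarith

/-- This makes the void events at `x` independent of the number of points in the cell at `x`. -/
theorem disjoint_stopBall (hρ : 0 < ρ) (h : k * ρ ≤ dist o x) :
    Disjoint (stopBall o ρ x k) (Metric.ball x ρ) := by
  refine Metric.ball_disjoint_ball ?_
  rw [dist_towards (by positivity) h]
  linarith

theorem measurableSet_isVoid {Ω : Type*} {η : Ω → Set (HypSpace d)} (o : HypSpace d) (ρ : ℝ) (x : HypSpace d) (k : ℕ)
    {B : Set (HypSpace d)} (hB : k * ρ ≤ dist o x → stopBall o ρ x k ⊆ B) :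
    MeasurableSet[regionSigma η B] {ω | IsVoid o ρ x k (η ω)} := by
  by_cases h : k * ρ ≤ dist o x
  · have := measurable_count_regionSigma η (measurableSet_ball : MeasurableSet (stopBall o ρ x k))
      (hB h) (MeasurableSet.singleton 0)
    have e : {ω | IsVoid o ρ x k (η ω)} =
        (fun ω => (η ω ∩ stopBall o ρ x k).encard) ⁻¹' {0} := by
      ext ω; simp [IsVoid, h, Set.encard_eq_zero]
    rw [e]
    exact this
  · have : {ω | IsVoid o ρ x k (η ω)} = ∅ := by ext ω; simp [IsVoid, h]
    rw [this]
    exact @MeasurableSet.empty _ (_)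

variable {Ω : Type*} [MeasurableSpace Ω] {P : Measure Ω} {η : Ω → Set (HypSpace d)} {γ : ℝ}

/-- The stopping ball has radius `(k - 1)ρ`, and `d ≥ 2` turns the power `d` into a square. The
quadratic exponent is essential: it outweighs the exponential growth of the number of cells for
every value of `β`. -/
theorem measure_isVoid_le [IsProbabilityMeasure P] (hd : 2 ≤ d)
    (hη : IsPoissonProcess P η (ENNReal.ofReal γ • hypVolume d)) (hγ : 0 < γ) {c : ℝ} (hc0 : 0 < c)
    (hc : ∀ (z : HypSpace d) (s : ℝ), 0 < s →
      ENNReal.ofReal (c * s ^ d) ≤ hypVolume d (Metric.ball z s)) (hρ : 0 < ρ)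
    (o x : HypSpace d) (k : ℕ) :
    P {ω | IsVoid o ρ x k (η ω)} ≤
      ENNReal.ofReal (Real.exp (-(c * (γ * ρ ^ d) * ((k - 1 : ℕ) : ℝ) ^ 2))) := by
  rcases le_or_gt k 1 with hk | hk
  · rw [show k - 1 = 0 by omega]
    simpa using prob_le_one
  obtain ⟨j, rfl⟩ : ∃ j, k = j + 1 := ⟨k - 1, by omega⟩
  have hj : (1 : ℝ) ≤ j := by exact_mod_cast (by omega : 1 ≤ j)
  have hjρ : 0 < j * ρ := by positivity
  calc P {ω | IsVoid o ρ x (j + 1) (η ω)}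
      ≤ P {ω | η ω ∩ stopBall o ρ x (j + 1) = ∅} := measure_mono fun ω h => h.2
    _ = _ := hη.measure_void measurableSet_ball ?_
    _ ≤ _ := ?_
  · rw [Measure.smul_apply, smul_eq_mul]
    exact ENNReal.mul_ne_top ENNReal.ofReal_ne_top (hypVolume_ball_lt_top _ _).ne
  · refine ENNReal.ofReal_le_ofReal (Real.exp_le_exp.2 (neg_le_neg ?_))
    rw [Measure.smul_apply, smul_eq_mul, ENNReal.toReal_mul, ENNReal.toReal_ofReal hγ.le, stopBall]
    have h1 := ENNReal.toReal_mono (hypVolume_ball_lt_top _ _).ne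
      (hc (towards o x ((j + 1 : ℕ) * ρ)) (j * ρ) hjρ)
    rw [ENNReal.toReal_ofReal (by positivity)] at h1
    have e : (((j + 1 : ℕ) : ℝ) - 1) * ρ = j * ρ := by push_cast; ring
    rw [e, Nat.add_sub_cancel]
    calc c * (γ * ρ ^ d) * (j : ℝ) ^ 2 ≤ c * (γ * ρ ^ d) * (j : ℝ) ^ d := by
          gcongr
      _ = γ * (c * (j * ρ) ^ d) := by rw [mul_pow]; ring
      _ ≤ _ := by gcongr

end HypSpace

/-! ### Decomposition into cells and second moments of a cell. -/

theorem exists_measurable_disjoint_refinement {ι X : Type*} [MeasurableSpace X] (T : Finset ι)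
    (f : ι → Set X) (hf : ∀ i, MeasurableSet (f i)) :
    ∃ Q : ι → Set X, (∀ i, MeasurableSet (Q i)) ∧ (∀ i, Q i ⊆ f i) ∧
      (T : Set ι).PairwiseDisjoint Q ∧ ⋃ i ∈ T, Q i = ⋃ i ∈ T, f i := by
  classical
  induction T using Finset.induction_on with
  | empty => exact ⟨f, hf, fun _ => subset_rfl, by simp, rfl⟩
  | insert a T ha ih =>
    obtain ⟨Q, h1, h2, h3, h4⟩ := ih
    have hne : ∀ i ∈ T, i ≠ a := by rintro i hi rfl; exact ha hi
    have hU : ⋃ i ∈ T, Function.update Q a (f a \ ⋃ i ∈ T, f i) i = ⋃ i ∈ T, f i := by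
      rw [← h4]
      exact Set.iUnion₂_congr fun i hi => by rw [Function.update_of_ne (hne i hi)]
    refine ⟨Function.update Q a (f a \ ⋃ i ∈ T, f i), fun i => ?_, fun i => ?_, ?_, ?_⟩
    · rcases eq_or_ne i a with rfl | h
      · rw [Function.update_self]
        exact (hf _).diff (Finset.measurableSet_biUnion _ fun i _ => hf i)
      · rw [Function.update_of_ne h]; exact h1 i
    · rcases eq_or_ne i a with rfl | h
      · rw [Function.update_self]; exact Set.sdiff_subset
      · rw [Function.update_of_ne h]; exact h2 i
    · have key : ∀ i ∈ T, Disjoint (f a \ ⋃ i ∈ T, f i) (Q i) := fun i hi =>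
        Set.disjoint_sdiff_left.mono_right
          ((h2 i).trans (Set.subset_biUnion_of_mem (u := f) (Finset.mem_coe.2 hi)))
      intro i hi j hj hij
      simp only [Finset.coe_insert, Set.mem_insert_iff, Finset.mem_coe] at hi hj
      simp only [Function.onFun]
      rcases hi with rfl | hi <;> rcases hj with rfl | hj
      · exact absurd rfl hij
      · rw [Function.update_self, Function.update_of_ne (hne j hj)]; exact key j hj
      · rw [Function.update_self, Function.update_of_ne (hne i hi)]; exact (key i hi).symm
      · rw [Function.update_of_ne (hne i hi), Function.update_of_ne (hne j hj)]
        exact h3 hi hj hij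
    · rw [Finset.set_biUnion_insert, Finset.set_biUnion_insert, hU, Function.update_self,
        Set.sdiff_union_self]

theorem regionFunctional_biUnion {ι X : Type*} [MetricSpace X] {o : X} {α : ℝ} {T : Finset ι}
    {Q : ι → Set X} (hQ : (T : Set ι).PairwiseDisjoint Q) {ξ : Set X}
    (hfin : ∀ i ∈ T, (ξ ∩ Q i).Finite) :
    regionFunctional o α (⋃ i ∈ T, Q i) ξ = ∑ i ∈ T, regionFunctional o α (Q i) ξ := by
  rw [regionFunctional, Set.inter_iUnion₂]
  rw [← Finset.sum_coe_sort]
  have : ⋃ i ∈ T, ξ ∩ Q i = ⋃ i : T, ξ ∩ Q i := by ext; simp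
  rw [this, finsum_mem_iUnion]
  · exact finsum_eq_sum_of_fintype _
  · intro i j hij
    exact (hQ i.2 j.2 (fun h => hij (Subtype.ext h))).mono Set.inter_subset_right
      Set.inter_subset_right
  · exact fun i => hfin i i.2

namespace IsPoissonProcess

variable {Ω X : Type*} [mΩ : MeasurableSpace Ω] [MetricSpace X] [MeasurableSpace X]
  {P : Measure Ω} {η : Ω → Set X} {μ : Measure X}

theorem finite_inter_ball (h : IsPoissonProcess P η μ) (o : X) (ω : Ω) (r : ℝ) :
    (η ω ∩ Metric.ball o r).Finite :=
  h.locallyFinite ω _ Metric.isBounded_ball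

theorem measurable_regionFunctional_inter [SecondCountableTopology X] [BorelSpace X]
    (h : IsPoissonProcess P η μ) {o : X} (α : ℝ) {R : ℝ} {S B : Set X} (hS : MeasurableSet S)
    (hSR : S ⊆ Metric.ball o R) (hB : MeasurableSet B) :
    Measurable[regionSigma η B] fun ω => regionFunctional o α S (η ω ∩ B) := by
  refine @measurable_regionFunctional _ _ (regionSigma η B) _ _ _ _ o α R S hS hSR
    (fun ω => η ω ∩ B) (fun ω r => ?_) fun A hA => ?_
  · exact (h.finite_inter_ball o ω r).subset fun x hx => ⟨hx.1.1, hx.2⟩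
  · simp_rw [Set.inter_assoc]
    exact measurable_count_regionSigma η (hB.inter hA) Set.inter_subset_left

theorem measurable_regionFunctional' [SecondCountableTopology X] [BorelSpace X]
    (h : IsPoissonProcess P η μ) {o : X} (α : ℝ) {R : ℝ} {S : Set X} (hS : MeasurableSet S)
    (hSR : S ⊆ Metric.ball o R) : Measurable fun ω => regionFunctional o α S (η ω) :=
  measurable_regionFunctional α hS hSR (h.finite_inter_ball o) h.measurable_count

end IsPoissonProcess

namespace HypSpace

variable {d : ℕ} [NeZero d] {o x : HypSpace d} {ρ : ℝ} {Ω : Type*} [MeasurableSpace Ω]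
  {P : Measure Ω} {η : Ω → Set (HypSpace d)} {μ : Measure (HypSpace d)}

/-- With `k + 1` the first index whose event is not void, the event at `k` is void while all edges
in the cell are shorter than `2(k + 1)ρ`. -/
theorem sq_regionFunctional_le {α : ℝ} (hα : 0 ≤ α) (hρ : 0 < ρ) {ξ Q : Set (HypSpace d)}
    (hξ : ∀ r, (ξ ∩ Metric.ball o r).Finite) (hfin : (ξ ∩ Metric.ball x ρ).Finite)
    (hQ : Q ⊆ Metric.ball x ρ) :
    ∃ k : ℕ, IsVoid o ρ x k ξ ∧ ENNReal.ofReal (regionFunctional o α Q ξ) ^ 2 ≤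
      ENNReal.ofReal ((2 * (k + 1) * ρ) ^ (2 * α)) * ((ξ ∩ Metric.ball x ρ).encard : ENNReal) ^ 2 := by
  classical
  have hex := exists_not_isVoid hρ o x ξ
  have h0 : Nat.find hex ≠ 0 := fun h => by
    have := Nat.find_spec hex
    rw [h] at this
    exact this (isVoid_zero hρ)
  obtain ⟨k, hk⟩ := Nat.exists_eq_succ_of_ne_zero h0
  have hvoid : IsVoid o ρ x k ξ := not_not.1 (Nat.find_min hex (by omega : k < Nat.find hex))
  have hnv : ¬ IsVoid o ρ x (k + 1) ξ := by
    have := Nat.find_spec hex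
    rwa [hk] at this
  refine ⟨k, hvoid, ?_⟩
  have h1 : ENNReal.ofReal (regionFunctional o α Q ξ) ≤
      ((ξ ∩ Q).encard : ENNReal) * ENNReal.ofReal ((2 * (k + 1) * ρ) ^ α) := by
    refine regionFunctional_le hα (hfin.subset (Set.inter_subset_inter_right _ hQ)) fun y hy => ?_
    have := radialEdgeLength_lt_of_not_isVoid hρ hξ hnv (hQ hy.2)
    push_cast at this
    exact this.le
  have h2 : ((ξ ∩ Q).encard : ENNReal) ≤ ((ξ ∩ Metric.ball x ρ).encard : ENNReal) :=
    ENat.toENNReal_le.2 (Set.encard_le_encard (Set.inter_subset_inter_right _ hQ))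
  calc ENNReal.ofReal (regionFunctional o α Q ξ) ^ 2
      ≤ (((ξ ∩ Metric.ball x ρ).encard : ENNReal) *
          ENNReal.ofReal ((2 * (k + 1) * ρ) ^ α)) ^ 2 := by gcongr; exact h1.trans (by gcongr)
    _ = _ := by
        rw [mul_pow, mul_comm, ← ENNReal.ofReal_pow (by positivity), mul_comm 2 α,
          Real.rpow_mul (by positivity)]
        norm_num

/-- Summing over the stopping index `k`, each term is a product of an edge-length bound, a void
indicator and a squared count. The last two are independent, since they depend on the outside and
the inside of the `ρ`-ball. Fourth powers in the void bound leave `r j ^ 2` for the event and `r k ^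
2` for convergence. -/
theorem setLIntegral_sq_regionFunctional_le [IsProbabilityMeasure P]
    (hη : IsPoissonProcess P η μ) {α : ℝ} (hα : 0 ≤ α) (hρ : 0 < ρ) {r : ℕ → ℝ}
    (hr0 : ∀ k, 0 < r k)
    (hr : ∀ (x : HypSpace d) k, P {ω | IsVoid o ρ x k (η ω)} ≤ ENNReal.ofReal (r k ^ 4))
    (hsum : Summable fun k : ℕ => (2 * ((k : ℝ) + 1)) ^ (2 * α) * r k ^ 2) {E : ℝ} (hE : 0 ≤ E)
    (hN : ∫⁻ ω, ((η ω ∩ Metric.ball x ρ).encard : ENNReal) ^ 2 ∂P ≤ ENNReal.ofReal E)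
    {Q : Set (HypSpace d)} (hQ : Q ⊆ Metric.ball x ρ) (j : ℕ) :
    ∫⁻ ω in {ω | IsVoid o ρ x j (η ω)}, ENNReal.ofReal (regionFunctional o α Q (η ω)) ^ 2 ∂P ≤
      ENNReal.ofReal ((E * ∑' k : ℕ, (2 * ((k : ℝ) + 1)) ^ (2 * α) * r k ^ 2) * ρ ^ (2 * α)
        * r j ^ 2) := by
  classical
  let V : ℕ → Set Ω := fun k => {ω | IsVoid o ρ x k (η ω)}
  let N : Ω → ENNReal := fun ω => ((η ω ∩ Metric.ball x ρ).encard : ENNReal) ^ 2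
  let w : ℕ → ENNReal := fun k => ENNReal.ofReal ((2 * (k + 1) * ρ) ^ (2 * α))
  have hVr : ∀ k, MeasurableSet[regionSigma η (Metric.ball x ρ)ᶜ] (V k) := fun k =>
    measurableSet_isVoid o ρ x k fun h => (disjoint_stopBall hρ h).subset_compl_right
  have hV : ∀ k, MeasurableSet (V k) := fun k => hη.regionSigma_le _ _ (hVr k)
  have hNr : Measurable[regionSigma η (Metric.ball x ρ)] N :=
    (measurable_of_countable (fun n : ℕ∞ => (n : ENNReal) ^ 2)).comp
      (measurable_count_regionSigma η measurableSet_ball subset_rfl)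
  have hNm : Measurable N := hNr.mono (hη.regionSigma_le _) le_rfl
  have hind := hη.indep_regionSigma (measurableSet_ball (x := x) (ε := ρ)).compl
    (measurableSet_ball (x := x) (ε := ρ)) disjoint_compl_left
  -- The smaller of `r j ^ 4` and `r k ^ 4` is at most their geometric mean.
  have hPV : ∀ k, P (V j ∩ V k) ≤ ENNReal.ofReal (r j ^ 2 * r k ^ 2) := by
    intro k
    rcases le_total (r j) (r k) with h | h
    · refine (measure_mono Set.inter_subset_left).trans ((hr x j).trans
        (ENNReal.ofReal_le_ofReal ?_))
      rw [show r j ^ 4 = r j ^ 2 * r j ^ 2 by ring]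
      have := (hr0 j).le
      gcongr
    · refine (measure_mono Set.inter_subset_right).trans ((hr x k).trans
        (ENNReal.ofReal_le_ofReal ?_))
      rw [show r k ^ 4 = r k ^ 2 * r k ^ 2 by ring]
      have := (hr0 k).le
      gcongr
  calc ∫⁻ ω in V j, ENNReal.ofReal (regionFunctional o α Q (η ω)) ^ 2 ∂P
      ≤ ∫⁻ ω in V j, ∑' k, w k * ((V k).indicator (fun _ => 1) ω * N ω) ∂P := by
        refine lintegral_mono fun ω => ?_
        obtain ⟨k, hk, hle⟩ := sq_regionFunctional_le hα hρ (hη.finite_inter_ball o ω)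
          (hη.finite_inter_ball x ω ρ) hQ
        refine hle.trans (le_trans (le_of_eq ?_) (ENNReal.le_tsum k))
        rw [Set.indicator_of_mem (show ω ∈ V k from hk), one_mul]
    _ = ∑' k, w k * ∫⁻ ω in V j, (V k).indicator (fun _ => 1) ω * N ω ∂P := by
        rw [lintegral_tsum]
        · congr 1
          ext k
          rw [lintegral_const_mul]
          exact (measurable_const.indicator (hV k)).mul hNm
        · exact fun k => (((measurable_const.indicator (hV k)).mul hNm).const_mul _).aemeasurable
    _ = ∑' k, w k * (P (V j ∩ V k) * ∫⁻ ω, N ω ∂P) := by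
        congr 1
        ext k
        congr 1
        rw [← lintegral_indicator (hV j)]
        have e : ∀ ω, (V j).indicator (fun ω => (V k).indicator (fun _ => (1 : ENNReal)) ω * N ω) ω =
            (V j ∩ V k).indicator (fun _ => (1 : ENNReal)) ω * N ω := by
          intro ω
          by_cases h1 : ω ∈ V j <;> by_cases h2 : ω ∈ V k <;> simp [h1, h2]
        simp_rw [e]
        rw [lintegral_mul_eq_lintegral_mul_lintegral_of_independent_measurableSpace
          (hη.regionSigma_le _) (hη.regionSigma_le _) hind _ hNr,
          lintegral_indicator_const ((hV j).inter (hV k)), one_mul]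
        exact @Measurable.indicator _ _ (_) _ _ _ _ (@measurable_const _ _ _ (_) _)
          (@MeasurableSet.inter _ (_) _ _ (hVr j) (hVr k))
    _ ≤ ∑' k : ℕ, ENNReal.ofReal ((E * ρ ^ (2 * α) * r j ^ 2) *
          ((2 * ((k : ℝ) + 1)) ^ (2 * α) * r k ^ 2)) := by
        refine ENNReal.tsum_le_tsum fun k => ?_
        calc w k * (P (V j ∩ V k) * ∫⁻ ω, N ω ∂P)
            ≤ w k * (ENNReal.ofReal (r j ^ 2 * r k ^ 2) * ENNReal.ofReal E) := by
              gcongr; exact hPV k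
          _ = _ := by
              rw [← ENNReal.ofReal_mul (by positivity), ← ENNReal.ofReal_mul (by positivity),
                Real.mul_rpow (by positivity) hρ.le]
              congr 1
              ring
    _ = _ := by
        rw [← ENNReal.ofReal_tsum_of_nonneg (fun k => by positivity) (hsum.mul_left _),
          tsum_mul_left]
        congr 1
        ring

end HypSpace

/-! ### Decay of covariances between cells. -/

theorem summable_exp_sub_sq {a : ℝ} (ha : 0 < a) (b : ℝ) :
    Summable fun k : ℕ => Real.exp (b * k - a * ((k - 1 : ℕ) : ℝ) ^ 2) := by
  have hgeo : Summable fun k : ℕ => Real.exp (-(k : ℝ)) := by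
    simpa using Real.summable_exp_neg_nat
  -- The additional `1` leaves a factor `exp (-k)` for a geometric series once the square has been
  -- completed.
  let B := |b| + 1
  refine Summable.of_nonneg_of_le (fun k => (Real.exp_pos _).le) (fun k => ?_)
    (hgeo.mul_left (Real.exp (B + B ^ 2 / (4 * a))))
  rw [← Real.exp_add]
  refine Real.exp_le_exp.2 ?_
  have hk : (k : ℝ) ≤ ((k - 1 : ℕ) : ℝ) + 1 := by exact_mod_cast (by omega : k ≤ k - 1 + 1)
  have hk0 : (0 : ℝ) ≤ k := by positivity
  have hb : b * k ≤ |b| * k := by gcongr; exact le_abs_self b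
  have hB : 0 ≤ B := by positivity
  have h1 : B * ((k - 1 : ℕ) : ℝ) - a * ((k - 1 : ℕ) : ℝ) ^ 2 ≤ B ^ 2 / (4 * a) := by
    rw [le_div_iff₀ (by positivity)]
    nlinarith [sq_nonneg (2 * a * ((k - 1 : ℕ) : ℝ) - B)]
  have h2 : B * k ≤ B * (((k - 1 : ℕ) : ℝ) + 1) := by gcongr
  have h3 : B * k = |b| * k + k := by simp only [B]; ring
  linarith

namespace HypSpace

variable {d : ℕ} [NeZero d] {o : HypSpace d} {ρ : ℝ} {Ω : Type*} [MeasurableSpace Ω]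
  {P : Measure Ω} {η : Ω → Set (HypSpace d)} {μ : Measure (HypSpace d)}

/-- Off the void event, the functional of a cell is determined by the points near the cell. -/
theorem regionFunctional_inter_ball_of_not_isVoid {α : ℝ} (hρ : 0 < ρ) {x : HypSpace d}
    {ξ Q : Set (HypSpace d)} (hξ : ∀ r, (ξ ∩ Metric.ball o r).Finite) (hQ : Q ⊆ Metric.ball x ρ)
    {k : ℕ} (hk : ¬ IsVoid o ρ x k ξ) :
    regionFunctional o α Q (ξ ∩ Metric.ball x ((2 * k + 1) * ρ)) = regionFunctional o α Q ξ := by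
  have hsub : Metric.ball x ρ ⊆ Metric.ball x ((2 * k + 1) * ρ) :=
    Metric.ball_subset_ball (by nlinarith [(Nat.cast_nonneg k : (0 : ℝ) ≤ k)])
  rw [regionFunctional, regionFunctional, Set.inter_assoc,
    Set.inter_eq_self_of_subset_right (hQ.trans hsub)]
  refine finsum_mem_congr rfl fun y hy => ?_
  congr 1
  refine radialEdgeLength_eq_of_inter_subset hξ Set.inter_subset_left
    (radialEdgeLength_lt_of_not_isVoid hρ hξ hk (hQ hy.2)) fun z hz _ hyz => ⟨hz, ?_⟩
  have h1 : dist y x < ρ := hQ hy.2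
  have := dist_triangle z y x
  rw [dist_comm z y] at this
  rw [Metric.mem_ball]
  linarith

/-- A bound for the second moment of a cell on a void event. -/
def CellMoment (P : Measure Ω) (η : Ω → Set (HypSpace d)) (o : HypSpace d) (α ρ D : ℝ) (r : ℕ → ℝ)
    (x : HypSpace d) (Q : Set (HypSpace d)) : Prop :=
  ∀ k, ∫⁻ ω in {ω | IsVoid o ρ x k (η ω)}, ENNReal.ofReal (regionFunctional o α Q (η ω)) ^ 2 ∂P ≤
    ENNReal.ofReal (D * r k ^ 2)

variable {α D R : ℝ} {r : ℕ → ℝ} {x y : HypSpace d} {Q Q' : Set (HypSpace d)}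

theorem CellMoment.lintegral_le (h : CellMoment P η o α ρ D r x Q) (hρ : 0 < ρ) (hr : r 0 = 1) :
    ∫⁻ ω, ENNReal.ofReal (regionFunctional o α Q (η ω)) ^ 2 ∂P ≤ ENNReal.ofReal D := by
  have h0 := h 0
  have : {ω | IsVoid o ρ x 0 (η ω)} = Set.univ := by ext ω; simp [isVoid_zero hρ]
  rwa [this, Measure.restrict_univ, hr, one_pow, mul_one] at h0

theorem CellMoment.integrable_sq (h : CellMoment P η o α ρ D r x Q) (hρ : 0 < ρ) (hr : r 0 = 1)
    (hη : IsPoissonProcess P η μ) (hQm : MeasurableSet Q) (hQ : Q ⊆ Metric.ball o R) :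
    Integrable (fun ω => regionFunctional o α Q (η ω) ^ 2) P := by
  refine ⟨((hη.measurable_regionFunctional' α hQm hQ).pow_const 2).aestronglyMeasurable, ?_⟩
  rw [hasFiniteIntegral_iff_ofReal (Filter.Eventually.of_forall fun ω => sq_nonneg _)]
  simp_rw [ENNReal.ofReal_pow (regionFunctional_nonneg o α Q _)]
  exact (h.lintegral_le hρ hr).trans_lt ENNReal.ofReal_lt_top

theorem CellMoment.memLp (h : CellMoment P η o α ρ D r x Q) (hρ : 0 < ρ) (hr : r 0 = 1)
    (hη : IsPoissonProcess P η μ) (hQm : MeasurableSet Q) (hQ : Q ⊆ Metric.ball o R) :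
    MemLp (fun ω => regionFunctional o α Q (η ω)) 2 P :=
  (memLp_two_iff_integrable_sq
    (hη.measurable_regionFunctional' α hQm hQ).aestronglyMeasurable).2
    (h.integrable_sq hρ hr hη hQm hQ)

theorem measurableSet_isVoid' (hη : IsPoissonProcess P η μ) (o : HypSpace d) (ρ : ℝ)
    (x : HypSpace d) (k : ℕ) : MeasurableSet {ω | IsVoid o ρ x k (η ω)} :=
  hη.regionSigma_le Set.univ _ (measurableSet_isVoid o ρ x k fun _ => Set.subset_univ _)

theorem CellMoment.setIntegral_le (h : CellMoment P η o α ρ D r x Q) (hD : 0 ≤ D)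
    (hη : IsPoissonProcess P η μ) (hQm : MeasurableSet Q) (hQ : Q ⊆ Metric.ball o R) (k : ℕ) :
    ∫ ω in {ω | IsVoid o ρ x k (η ω)}, regionFunctional o α Q (η ω) ^ 2 ∂P ≤ D * r k ^ 2 := by
  rw [integral_eq_lintegral_of_nonneg_ae (Filter.Eventually.of_forall fun ω => sq_nonneg _)
    ((hη.measurable_regionFunctional' α hQm hQ).pow_const 2).aestronglyMeasurable]
  simp_rw [ENNReal.ofReal_pow (regionFunctional_nonneg o α Q _)]
  exact ENNReal.toReal_le_of_le_ofReal (by positivity) (h k)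

/-- Mixed second moment on a void event of one of two cells. -/
theorem setIntegral_mul_le [IsProbabilityMeasure P] (hx : CellMoment P η o α ρ D r x Q)
    (hy : CellMoment P η o α ρ D r y Q') (hD : 0 ≤ D) (hρ : 0 < ρ) (hr : r 0 = 1)
    (hr0 : ∀ k, 0 < r k) (hη : IsPoissonProcess P η μ) (hQm : MeasurableSet Q)
    (hQ : Q ⊆ Metric.ball o R) (hQm' : MeasurableSet Q') (hQ' : Q' ⊆ Metric.ball o R) (k : ℕ) :
    ∫ ω in {ω | IsVoid o ρ x k (η ω)},
      regionFunctional o α Q (η ω) * regionFunctional o α Q' (η ω) ∂P ≤ D * r k := by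
  have ix := (hx.integrable_sq hρ hr hη hQm hQ)
  have iy := (hy.integrable_sq hρ hr hη hQm' hQ')
  have ixy := (hx.memLp hρ hr hη hQm hQ).integrable_mul (hy.memLp hρ hr hη hQm' hQ')
  have hrk := hr0 k
  -- Young's inequality with weight `r k` balances the second moment `D * r k ^ 2` on the void event
  -- against the unrestricted second moment `D` of the other cell.
  calc ∫ ω in {ω | IsVoid o ρ x k (η ω)},
        regionFunctional o α Q (η ω) * regionFunctional o α Q' (η ω) ∂P
      ≤ ∫ ω in {ω | IsVoid o ρ x k (η ω)}, ((2 * r k)⁻¹ * regionFunctional o α Q (η ω) ^ 2 +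
          r k / 2 * regionFunctional o α Q' (η ω) ^ 2) ∂P := by
        refine setIntegral_mono ixy.integrableOn
          ((ix.const_mul _).add (iy.const_mul _)).integrableOn fun ω => ?_
        generalize regionFunctional o α Q (η ω) = a
        generalize regionFunctional o α Q' (η ω) = b
        have e : (2 * r k)⁻¹ * a ^ 2 + r k / 2 * b ^ 2 - a * b =
            (2 * r k)⁻¹ * (a - r k * b) ^ 2 := by field_simp; ring
        have : 0 ≤ (2 * r k)⁻¹ * (a - r k * b) ^ 2 := by positivity
        linarith
    _ = (2 * r k)⁻¹ * ∫ ω in {ω | IsVoid o ρ x k (η ω)}, regionFunctional o α Q (η ω) ^ 2 ∂P +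
          r k / 2 * ∫ ω in {ω | IsVoid o ρ x k (η ω)}, regionFunctional o α Q' (η ω) ^ 2 ∂P := by
        rw [integral_add (ix.const_mul _).integrableOn (iy.const_mul _).integrableOn,
          integral_const_mul, integral_const_mul]
    _ ≤ (2 * r k)⁻¹ * (D * r k ^ 2) + r k / 2 * D := by
        gcongr
        · exact hx.setIntegral_le hD hη hQm hQ k
        · have h0 := hy.setIntegral_le hD hη hQm' hQ' 0
          have : {ω | IsVoid o ρ y 0 (η ω)} = Set.univ := by ext ω; simp [isVoid_zero hρ]
          rw [this, Measure.restrict_univ, hr, one_pow, mul_one] at h0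
          exact (setIntegral_le_integral iy (Filter.Eventually.of_forall fun ω => sq_nonneg _)).trans
            h0
    _ = D * r k := by field_simp; ring

/-- Off their void events the two contributions are functions of the points in disjoint balls, hence
uncorrelated. Each void event costs at most `D * r k`. -/
theorem covariance_cells_le [IsProbabilityMeasure P] (hx : CellMoment P η o α ρ D r x Q)
    (hy : CellMoment P η o α ρ D r y Q') (hD : 0 ≤ D) (hρ : 0 < ρ) (hr : r 0 = 1)
    (hr0 : ∀ k, 0 < r k) (hη : IsPoissonProcess P η μ) (hQm : MeasurableSet Q)
    (hQ : Q ⊆ Metric.ball o R) (hQx : Q ⊆ Metric.ball x ρ) (hQm' : MeasurableSet Q')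
    (hQ' : Q' ⊆ Metric.ball o R) (hQy : Q' ⊆ Metric.ball y ρ) (k : ℕ)
    (hk : k = 0 ∨ (4 * k + 2) * ρ ≤ dist x y) :
    cov[fun ω => regionFunctional o α Q (η ω), fun ω => regionFunctional o α Q' (η ω); P] ≤
      2 * D * r k := by
  classical
  let F : Ω → ℝ := fun ω => regionFunctional o α Q (η ω)
  let F' : Ω → ℝ := fun ω => regionFunctional o α Q' (η ω)
  have mF := hx.memLp hρ hr hη hQm hQ
  have mF' := hy.memLp hρ hr hη hQm' hQ'
  have iFF := mF.integrable_mul mF'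
  have F0 : ∀ ω, 0 ≤ F ω := fun ω => regionFunctional_nonneg _ _ _ _
  have F0' : ∀ ω, 0 ≤ F' ω := fun ω => regionFunctional_nonneg _ _ _ _
  have iF := mF.integrable one_le_two
  have iF' := mF'.integrable one_le_two
  have e1 := setIntegral_mul_le hx hy hD hρ hr hr0 hη hQm hQ hQm' hQ' k
  have e2 := setIntegral_mul_le hy hx hD hρ hr hr0 hη hQm' hQ' hQm hQ k
  rw [covariance_eq_sub mF mF']
  rcases hk with rfl | hk
  -- For `k = 0` the cells may be close. Both contributions are nonnegative, so the covariance is at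
  -- most the mixed moment.
  · have hu : {ω | IsVoid o ρ x 0 (η ω)} = Set.univ := by ext ω; simp [isVoid_zero hρ]
    rw [hu, Measure.restrict_univ, hr] at e1
    have h1 : 0 ≤ ∫ ω, F ω ∂P := integral_nonneg F0
    have h2 : 0 ≤ ∫ ω, F' ω ∂P := integral_nonneg F0'
    have h3 := mul_nonneg h1 h2
    rw [hr]
    simp only [Pi.mul_apply]
    linarith
  · let V := {ω | IsVoid o ρ x k (η ω)}
    let V' := {ω | IsVoid o ρ y k (η ω)}
    let B := Metric.ball x ((2 * k + 1) * ρ)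
    let B' := Metric.ball y ((2 * k + 1) * ρ)
    have hV : MeasurableSet V := measurableSet_isVoid' hη o ρ x k
    have hV' : MeasurableSet V' := measurableSet_isVoid' hη o ρ y k
    let G : Ω → ℝ := Vᶜ.indicator F
    let G' : Ω → ℝ := V'ᶜ.indicator F'
    have hG : Measurable[regionSigma η B] G := by
      have e : G = Vᶜ.indicator fun ω => regionFunctional o α Q (η ω ∩ B) := by
        refine Set.indicator_congr fun ω hω => ?_
        exact (regionFunctional_inter_ball_of_not_isVoid hρ (hη.finite_inter_ball o ω) hQx hω).symm
      rw [e]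
      exact @Measurable.indicator _ _ (_) _ _ _ _
        (hη.measurable_regionFunctional_inter α hQm hQ measurableSet_ball)
        (@MeasurableSet.compl _ _ (_) (measurableSet_isVoid o ρ x k (stopBall_subset hρ)))
    have hG' : Measurable[regionSigma η B'] G' := by
      have e : G' = V'ᶜ.indicator fun ω => regionFunctional o α Q' (η ω ∩ B') := by
        refine Set.indicator_congr fun ω hω => ?_
        exact (regionFunctional_inter_ball_of_not_isVoid hρ (hη.finite_inter_ball o ω) hQy hω).symm
      rw [e]
      exact @Measurable.indicator _ _ (_) _ _ _ _
        (hη.measurable_regionFunctional_inter α hQm' hQ' measurableSet_ball)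
        (@MeasurableSet.compl _ _ (_) (measurableSet_isVoid o ρ y k (stopBall_subset hρ)))
    have hBB : Disjoint B B' := Metric.ball_disjoint_ball (by linarith)
    have hind : IndepFun G G' P := by
      rw [IndepFun_iff_Indep]
      exact indep_of_indep_of_le (hη.indep_regionSigma measurableSet_ball measurableSet_ball hBB)
        hG.comap_le hG'.comap_le
    have iG : Integrable G P := iF.indicator hV.compl
    have iG' : Integrable G' P := iF'.indicator hV'.compl
    have hGF : ∫ ω, G ω ∂P ≤ ∫ ω, F ω ∂P :=
      integral_mono iG iF fun ω => Set.indicator_le_self' (fun _ _ => F0 ω) ω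
    have hGF' : ∫ ω, G' ω ∂P ≤ ∫ ω, F' ω ∂P :=
      integral_mono iG' iF' fun ω => Set.indicator_le_self' (fun _ _ => F0' ω) ω
    have hG0 : 0 ≤ ∫ ω, G ω ∂P := integral_nonneg fun ω => Set.indicator_nonneg (fun ω _ => F0 ω) ω
    have hG0' : 0 ≤ ∫ ω, G' ω ∂P :=
      integral_nonneg fun ω => Set.indicator_nonneg (fun ω _ => F0' ω) ω
    have hmul : ∫ ω, G ω * G' ω ∂P = (∫ ω, G ω ∂P) * ∫ ω, G' ω ∂P :=
      hind.integral_fun_mul_eq_mul_integral iG.1 iG'.1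
    have iGG : Integrable (fun ω => G ω * G' ω) P := hind.integrable_mul iG iG'
    -- Pointwise, `F F'` either equals the truncated product or is counted on at least one of the
    -- void events.
    have hkey : ∫ ω, F ω * F' ω ∂P ≤
        ∫ ω, (G ω * G' ω + (V.indicator (fun ω => F ω * F' ω) ω +
          V'.indicator (fun ω => F' ω * F ω) ω)) ∂P := by
      have iFF' : Integrable (fun ω => F' ω * F ω) P := mF'.integrable_mul mF
      refine integral_mono iFF (iGG.add ((iFF.indicator hV).add (iFF'.indicator hV')))
        fun ω => ?_
      have h1 := mul_nonneg (F0 ω) (F0' ω)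
      by_cases hω : ω ∈ V <;> by_cases hω' : ω ∈ V' <;>
        simp only [G, G', Set.indicator, Set.mem_compl_iff, hω, hω', not_true, not_false_eq_true,
          if_true, if_false] <;> nlinarith
    have iFF' : Integrable (fun ω => F' ω * F ω) P := mF'.integrable_mul mF
    have hsplit : ∫ ω, (G ω * G' ω + (V.indicator (fun ω => F ω * F' ω) ω +
          V'.indicator (fun ω => F' ω * F ω) ω)) ∂P = ∫ ω, G ω * G' ω ∂P +
        (∫ ω in V, F ω * F' ω ∂P + ∫ ω in V', F' ω * F ω ∂P) := by
      have i1 : Integrable (fun ω => V.indicator (fun ω => F ω * F' ω) ω) P := iFF.indicator hV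
      have i2 : Integrable (fun ω => V'.indicator (fun ω => F' ω * F ω) ω) P := iFF'.indicator hV'
      have i12 : Integrable (fun ω => V.indicator (fun ω => F ω * F' ω) ω +
        V'.indicator (fun ω => F' ω * F ω) ω) P := i1.add i2
      rw [integral_add iGG i12, integral_add i1 i2, integral_indicator hV, integral_indicator hV']
    have hmm := mul_le_mul hGF hGF' hG0' (hG0.trans hGF)
    simp only [Pi.mul_apply]
    have e1' : ∫ ω in V, F ω * F' ω ∂P ≤ D * r k := e1
    have e2' : ∫ ω in V', F' ω * F ω ∂P ≤ D * r k := e2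
    have hgoal : ∫ ω, F ω * F' ω ∂P - (∫ ω, F ω ∂P) * ∫ ω, F' ω ∂P ≤ 2 * D * r k := by
      linarith
    exact hgoal

end HypSpace

/-! ### The upper variance bound. -/

namespace HypSpace

variable {d : ℕ} [NeZero d]

/-- The `k`-th shell of width `6ρ` lies in a ball of radius at most `7(k + 1)ρ` and at most `6k +
7`, so packing bounds its number of points by a multiple of `exp (13dk)`: `12k` comes from `exp
(2s)` and one more `k` from `k + 1 ≤ exp k`. The powers of `ρ` cancel. -/
theorem sum_separated_le {c C : ℝ} (hc0 : 0 < c) (hC0 : 0 < C)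
    (hc : ∀ (z : HypSpace d) (s : ℝ), 0 < s →
      ENNReal.ofReal (c * s ^ d) ≤ hypVolume d (Metric.ball z s))
    (hC : ∀ (z : HypSpace d) (s : ℝ), 0 < s →
      hypVolume d (Metric.ball z s) ≤ ENNReal.ofReal (C * (s * Real.exp (2 * s)) ^ d))
    {ρ : ℝ} (hρ : 0 < ρ) (hρ1 : ρ ≤ 1) {T : Finset (HypSpace d)}
    (hT : ∀ y ∈ T, ∀ z ∈ T, y ≠ z → ρ ≤ dist y z) (x : HypSpace d) {r : ℕ → ℝ}
    (hr0 : ∀ k, 0 < r k)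
    (hsum : Summable fun k : ℕ => Real.exp (13 * d * k) * r k) :
    ∑ y ∈ T, r ⌊dist x y / (6 * ρ)⌋₊ ≤
      C / c * (14 * Real.exp 14) ^ d * ∑' k : ℕ, Real.exp (13 * d * k) * r k := by
  classical
  have hcount : ∀ k : ℕ, ((T.filter fun y => ⌊dist x y / (6 * ρ)⌋₊ = k).card : ℝ) ≤
      C / c * (14 * Real.exp 14) ^ d * Real.exp (13 * d * k) := by
    intro k
    let T' := T.filter fun y => ⌊dist x y / (6 * ρ)⌋₊ = k
    have hk0 : (0 : ℝ) ≤ k := by positivity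
    have hT' : ∀ y ∈ T', dist y x < (k + 1) * (6 * ρ) := by
      intro y hy
      have h1 := (Finset.mem_filter.1 hy).2
      have h2 := Nat.lt_floor_add_one (dist x y / (6 * ρ))
      rw [h1, div_lt_iff₀ (by positivity)] at h2
      rwa [dist_comm]
    have h1 := card_mul_le_of_separated hc hρ (T := T')
      (fun y hy z hz => hT y (Finset.filter_subset _ _ hy) z (Finset.filter_subset _ _ hz)) hT'
    have h2 := h1.trans (hC x ((k + 1) * (6 * ρ) + ρ / 2) (by positivity))
    rw [← ENNReal.ofReal_natCast, ← ENNReal.ofReal_mul (by positivity),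
      ENNReal.ofReal_le_ofReal_iff (by positivity)] at h2
    let s := (k + 1) * (6 * ρ) + ρ / 2
    have hs : s ≤ 7 * (k + 1) * ρ := by simp only [s]; nlinarith
    have hs1 : s ≤ 6 * k + 7 := by simp only [s]; nlinarith
    have hsp : 0 < s := by positivity
    have hexp : (k : ℝ) + 1 ≤ Real.exp k := Real.add_one_le_exp _
    have h3 : s * Real.exp (2 * s) ≤ (ρ / 2) * (14 * Real.exp 14 * Real.exp (13 * k)) := by
      calc s * Real.exp (2 * s) ≤ (7 * Real.exp k * ρ) * Real.exp (12 * k + 14) := by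
            gcongr
            · exact hs.trans (by gcongr)
            · linarith
        _ = _ := by
            rw [Real.exp_add, show (13 : ℝ) * k = k + 12 * k by ring, Real.exp_add]; ring
    have h4 : (T'.card : ℝ) * (c * (ρ / 2) ^ d) ≤
        C * ((ρ / 2) * (14 * Real.exp 14 * Real.exp (13 * k))) ^ d :=
      h2.trans (by gcongr)
    have e : Real.exp (13 * d * k) = Real.exp (13 * k) ^ d := by
      rw [← Real.exp_nat_mul]; ring_nf
    rw [mul_pow, mul_pow (14 * Real.exp 14), ← e] at h4
    have hpos : 0 < c * (ρ / 2) ^ d := by positivity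
    refine le_of_mul_le_mul_right (h4.trans_eq ?_) hpos
    field_simp
  rw [Finset.sum_comp r fun y => ⌊dist x y / (6 * ρ)⌋₊]
  calc ∑ k ∈ T.image fun y => ⌊dist x y / (6 * ρ)⌋₊,
        (T.filter fun y => ⌊dist x y / (6 * ρ)⌋₊ = k).card • r k
      ≤ ∑ k ∈ T.image fun y => ⌊dist x y / (6 * ρ)⌋₊,
        C / c * (14 * Real.exp 14) ^ d * (Real.exp (13 * d * k) * r k) := by
        refine Finset.sum_le_sum fun k _ => ?_
        rw [nsmul_eq_mul, ← mul_assoc]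
        exact mul_le_mul_of_nonneg_right (hcount k) (hr0 k).le
    _ = C / c * (14 * Real.exp 14) ^ d * ∑ k ∈ T.image fun y => ⌊dist x y / (6 * ρ)⌋₊,
        Real.exp (13 * d * k) * r k := by rw [Finset.mul_sum]
    _ ≤ _ := by
        refine mul_le_mul_of_nonneg_left (hsum.sum_le_tsum _ fun k _ => ?_) (by positivity)
        exact (mul_pos (Real.exp_pos _) (hr0 k)).le

/-- Each row of the covariance matrix of the cells sums to `O(ρ ^ (2α))`, and packing bounds the
number of cells by a multiple of `V(R) / ρ ^ d`. All constants involve the intensity only through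
`β`. -/
theorem exists_variance_le (hd : 2 ≤ d) {α : ℝ} (hα : 0 < α) {β : ℝ} (hβ : 0 < β) :
    ∃ K : ℝ, 0 < K ∧ ∀ (o : HypSpace d) (γ ρ R : ℝ), 0 < γ → 0 < ρ → ρ ≤ 1 → γ * ρ ^ d = β →
      1 ≤ R → ∀ (Ω : Type*) [MeasurableSpace Ω] (P : Measure Ω) [IsProbabilityMeasure P]
        (η : Ω → Set (HypSpace d)), IsPoissonProcess P η (ENNReal.ofReal γ • hypVolume d) →
        MemLp (fun ω => edgeLengthFunctional o α R (η ω)) 2 P ∧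
        Var[fun ω => edgeLengthFunctional o α R (η ω); P] ≤
          K * (ρ ^ (2 * α) / ρ ^ d) * ballVolume o R := by
  obtain ⟨c, hc0, hc⟩ := exists_le_hypVolume_ball hd
  obtain ⟨C, hC0, hC⟩ := exists_hypVolume_ball_le (d := d)
  -- The quarter makes `r k ^ 4` equal to the void bound.
  obtain ⟨a, ha⟩ : ∃ a, a = c * β / 4 := ⟨_, rfl⟩
  have ha0 : 0 < a := by rw [ha]; positivity
  obtain ⟨r, hrdef⟩ : ∃ r : ℕ → ℝ, r = fun k => Real.exp (-(a * ((k - 1 : ℕ) : ℝ) ^ 2)) := ⟨_, rfl⟩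
  have hr0 : ∀ k, 0 < r k := fun k => by rw [hrdef]; exact Real.exp_pos _
  have hr1 : r 0 = 1 := by simp [hrdef]
  have hr4 : ∀ k, r k ^ 4 = Real.exp (-(c * β * ((k - 1 : ℕ) : ℝ) ^ 2)) := by
    intro k
    rw [hrdef, ← Real.exp_nat_mul, ha]
    push_cast
    ring_nf
  have hsum1 : Summable fun k : ℕ => (2 * ((k : ℝ) + 1)) ^ (2 * α) * r k ^ 2 := by
    refine Summable.of_nonneg_of_le (fun k => by positivity) (fun k => ?_)
      ((summable_exp_sub_sq (mul_pos two_pos ha0) (2 * α)).mul_left ((2 : ℝ) ^ (2 * α)))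
    rw [Real.mul_rpow (by norm_num) (by positivity), mul_assoc, sub_eq_add_neg, Real.exp_add]
    have h1 : ((k : ℝ) + 1) ^ (2 * α) ≤ Real.exp (2 * α * k) := by
      rw [mul_comm (2 * α), Real.exp_mul]
      exact Real.rpow_le_rpow (by positivity) (Real.add_one_le_exp _) (by positivity)
    have h2 : r k ^ 2 = Real.exp (-(2 * a * ((k - 1 : ℕ) : ℝ) ^ 2)) := by
      rw [hrdef, ← Real.exp_nat_mul]; push_cast; ring_nf
    rw [h2]
    gcongr
  have hsum2 : Summable fun k : ℕ => Real.exp (13 * d * k) * r k := by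
    refine (summable_exp_sub_sq ha0 (13 * d)).congr fun k => ?_
    rw [hrdef, sub_eq_add_neg, Real.exp_add]
  obtain ⟨E, hE⟩ : ∃ E, E = 2 * Real.exp (C * β * Real.exp 2 ^ d) := ⟨_, rfl⟩
  have hE0 : 0 < E := by rw [hE]; positivity
  obtain ⟨S, hS⟩ : ∃ S, S = ∑' k : ℕ, (2 * ((k : ℝ) + 1)) ^ (2 * α) * r k ^ 2 := ⟨_, rfl⟩
  have hS0 : 0 < S := by
    rw [hS]
    exact hsum1.tsum_pos (fun k => by have := hr0 k; positivity) 0 (by have := hr0 0; positivity)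
  obtain ⟨M, hM⟩ : ∃ M, M = C / c * (14 * Real.exp 14) ^ d *
    ∑' k : ℕ, Real.exp (13 * d * k) * r k := ⟨_, rfl⟩
  have hM0 : 0 < M := by
    have : 0 < ∑' k : ℕ, Real.exp (13 * d * k) * r k :=
      hsum2.tsum_pos (fun k => by have := hr0 k; positivity) 0 (by have := hr0 0; positivity)
    rw [hM]; positivity
  refine ⟨2 * (E * S) * M / (c * (1 / 4) ^ d), by positivity, ?_⟩
  intro o γ ρ R hγ hρ hρ1 hβρ hR Ω _ P _ η hη
  -- The cells are a disjoint refinement of the `ρ`-balls around a maximal `ρ`-separated set.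
  obtain ⟨T, hTo, hTs, hTc⟩ := exists_maximal_separated_ball hd o (R := R) hρ subset_rfl
  obtain ⟨Q, hQm, hQf, hQd, hQU⟩ := exists_measurable_disjoint_refinement T
    (fun y => Metric.ball y ρ ∩ Metric.ball o R) fun y => measurableSet_ball.inter measurableSet_ball
  have hQy : ∀ y, Q y ⊆ Metric.ball y ρ := fun y => (hQf y).trans Set.inter_subset_left
  have hQo : ∀ y, Q y ⊆ Metric.ball o R := fun y => (hQf y).trans Set.inter_subset_right
  have hUo : ⋃ y ∈ T, Q y = Metric.ball o R := by
    rw [hQU]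
    refine Set.Subset.antisymm (Set.iUnion₂_subset fun _ _ => Set.inter_subset_right) fun x hx => ?_
    obtain ⟨y, hy, hxy⟩ := hTc x hx
    exact Set.mem_biUnion (Finset.mem_coe.2 hy) ⟨hxy, hx⟩
  have hF : ∀ ω, edgeLengthFunctional o α R (η ω) = ∑ y ∈ T, regionFunctional o α (Q y) (η ω) := by
    intro ω
    rw [edgeLengthFunctional_eq, ← hUo, regionFunctional_biUnion hQd]
    exact fun y _ => (hη.finite_inter_ball o ω R).subset (Set.inter_subset_inter_right _ (hQo y))
  obtain ⟨D, hD⟩ : ∃ D, D = (E * S) * ρ ^ (2 * α) := ⟨_, rfl⟩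
  have hD0 : 0 < D := by rw [hD]; positivity
  have hmom : ∀ y, CellMoment P η o α ρ D r y (Q y) := by
    intro y k
    rw [hD, hS]
    refine setLIntegral_sq_regionFunctional_le hη hα.le hρ hr0 (fun x k => ?_) hsum1 hE0.le ?_
      (hQy y) k
    · rw [hr4, ← hβρ]
      exact measure_isVoid_le hd hη hγ hc0 hc hρ o x k
    · have hμ : (ENNReal.ofReal γ • hypVolume d) (Metric.ball y ρ) ≠ ⊤ := by
        rw [Measure.smul_apply, smul_eq_mul]
        exact ENNReal.mul_ne_top ENNReal.ofReal_ne_top (hypVolume_ball_lt_top _ _).ne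
      refine (hη.lintegral_count_sq_le measurableSet_ball hμ).trans (ENNReal.ofReal_le_ofReal ?_)
      rw [hE, Measure.smul_apply, smul_eq_mul, ENNReal.toReal_mul, ENNReal.toReal_ofReal hγ.le]
      refine mul_le_mul_of_nonneg_left (Real.exp_le_exp.2 ?_) two_pos.le
      have h1 := ENNReal.toReal_mono ENNReal.ofReal_ne_top (hC y ρ hρ)
      rw [ENNReal.toReal_ofReal (by positivity)] at h1
      calc γ * (hypVolume d (Metric.ball y ρ)).toReal
          ≤ γ * (C * (ρ * Real.exp (2 * 1)) ^ d) := by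
            gcongr; exact h1.trans (by gcongr)
        _ = C * β * Real.exp 2 ^ d := by rw [← hβρ, mul_pow, mul_one]; ring
  have hmem : ∀ y ∈ T, MemLp (fun ω => regionFunctional o α (Q y) (η ω)) 2 P := fun y _ =>
    (hmom y).memLp hρ hr1 hη (hQm y) (hQo y)
  simp_rw [hF]
  refine ⟨memLp_finsetSum _ hmem, ?_⟩
  rw [variance_fun_sum' hmem]
  -- Division by `6ρ` works because `4k + 2 ≤ 6k` for `k ≥ 1`.
  have hcov : ∀ x ∈ T, ∀ y ∈ T, cov[fun ω => regionFunctional o α (Q x) (η ω),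
      fun ω => regionFunctional o α (Q y) (η ω); P] ≤ 2 * D * r ⌊dist x y / (6 * ρ)⌋₊ := by
    intro x _ y _
    refine covariance_cells_le (hmom x) (hmom y) hD0.le hρ hr1 hr0 hη (hQm x) (hQo x) (hQy x)
      (hQm y) (hQo y) (hQy y) _ ?_
    rcases Nat.eq_zero_or_pos ⌊dist x y / (6 * ρ)⌋₊ with h | h
    · exact Or.inl h
    · right
      have h1 : (1 : ℝ) ≤ ⌊dist x y / (6 * ρ)⌋₊ := by exact_mod_cast h
      have h2 := Nat.floor_le (show 0 ≤ dist x y / (6 * ρ) by positivity)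
      rw [le_div_iff₀ (by positivity)] at h2
      nlinarith
  have hcard : (T.card : ℝ) * (c * (ρ / 4) ^ d) ≤ ballVolume o R := by
    have h1 := card_mul_le_of_separated_of_subset_ball hc hρ (by linarith) hTo hTs
    have h2 := ENNReal.toReal_mono (hypVolume_ball_lt_top o R).ne h1
    rwa [ENNReal.toReal_mul, ENNReal.toReal_ofReal (by positivity), ENNReal.toReal_natCast] at h2
  calc ∑ x ∈ T, ∑ y ∈ T, cov[fun ω => regionFunctional o α (Q x) (η ω),
        fun ω => regionFunctional o α (Q y) (η ω); P]
      ≤ ∑ x ∈ T, ∑ y ∈ T, 2 * D * r ⌊dist x y / (6 * ρ)⌋₊ :=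
        Finset.sum_le_sum fun x hx => Finset.sum_le_sum fun y hy => hcov x hx y hy
    _ ≤ ∑ _x ∈ T, 2 * D * M := by
        refine Finset.sum_le_sum fun x _ => ?_
        rw [← Finset.mul_sum, hM]
        exact mul_le_mul_of_nonneg_left
          (sum_separated_le hc0 hC0 hc hC hρ hρ1 hTs x hr0 hsum2) (by positivity)
    _ = (T.card : ℝ) * (c * (ρ / 4) ^ d) * (2 * D * M / (c * (ρ / 4) ^ d)) := by
        rw [Finset.sum_const, nsmul_eq_mul, mul_assoc (T.card : ℝ),
          mul_div_cancel₀ _ (show c * (ρ / 4) ^ d ≠ 0 by positivity)]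
    _ ≤ ballVolume o R * (2 * D * M / (c * (ρ / 4) ^ d)) := by gcongr
    _ = _ := by
        rw [hD, show ρ / 4 = 1 / 4 * ρ by ring, mul_pow]
        field_simp

end HypSpace

/-! ### Second differences of the functional under removal of points. -/

section SecondDifference

variable {X : Type*} [MetricSpace X] {o : X} {ξ S U W : Set X} {α : ℝ}

/-- The second difference of the functional under removal of the points in two sets. -/
def secondDifference (o : X) (α : ℝ) (S U W ξ : Set X) : ℝ :=
  regionFunctional o α S ξ - regionFunctional o α S (ξ ∩ Wᶜ) - regionFunctional o α S (ξ ∩ Uᶜ) +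
    regionFunctional o α S (ξ ∩ (U ∪ W)ᶜ)

theorem secondDifference_of_left_empty (h : ξ ∩ U = ∅) : secondDifference o α S U W ξ = 0 := by
  have h1 : ξ ∩ Uᶜ = ξ :=
    Set.inter_eq_left.2 (Set.disjoint_iff_inter_eq_empty.2 h).subset_compl_right
  have h2 : ξ ∩ (U ∪ W)ᶜ = ξ ∩ Wᶜ := by rw [Set.compl_union, ← Set.inter_assoc, h1]
  rw [secondDifference, h1, h2]
  ring

theorem secondDifference_of_right_empty (h : ξ ∩ W = ∅) : secondDifference o α S U W ξ = 0 := by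
  have h1 : ξ ∩ Wᶜ = ξ :=
    Set.inter_eq_left.2 (Set.disjoint_iff_inter_eq_empty.2 h).subset_compl_right
  have h2 : ξ ∩ (U ∪ W)ᶜ = ξ ∩ Uᶜ := by
    rw [Set.compl_union, Set.inter_comm Uᶜ, ← Set.inter_assoc, h1]
  rw [secondDifference, h1, h2]
  ring

/-- Terms of points in `U` or `W` cancel by `hU` and `hW`. For any other point the full edge length
is the minimum of those after one removal, so its second difference is the power after both removals
minus the power of the maximum after one. This is nonnegative, hence the single point `z` bounds the
sum from below. -/
theorem le_secondDifference (hα : 0 ≤ α) (hξ : ∀ r, (ξ ∩ Metric.ball o r).Finite)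
    (hS : (ξ ∩ S).Finite) (hUW : Disjoint U W)
    (hU : ∀ x ∈ ξ ∩ U, radialEdgeLength o (ξ ∩ Wᶜ) x = radialEdgeLength o ξ x)
    (hW : ∀ x ∈ ξ ∩ W, radialEdgeLength o (ξ ∩ Uᶜ) x = radialEdgeLength o ξ x)
    {z : X} (hz : z ∈ ξ ∩ S) (hzUW : z ∉ U ∪ W) {m M : ℝ} (hm0 : 0 ≤ m)
    (hm : m ≤ radialEdgeLength o (ξ ∩ (U ∪ W)ᶜ) z)
    (hMU : radialEdgeLength o (ξ ∩ Wᶜ) z ≤ M) (hMW : radialEdgeLength o (ξ ∩ Uᶜ) z ≤ M) :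
    m ^ α - M ^ α ≤ secondDifference o α S U W ξ := by
  have hξi : ∀ B : Set X, ∀ r, ((ξ ∩ B) ∩ Metric.ball o r).Finite := fun B r =>
    (hξ r).subset fun x hx => ⟨hx.1.1, hx.2⟩
  let f : Set X → X → ℝ := fun A x => radialEdgeLength o A x ^ α
  let Y := ξ ∩ (U ∪ W)ᶜ ∩ S
  let YU := ξ ∩ U ∩ S
  let YW := ξ ∩ W ∩ S
  have fY : Y.Finite := hS.subset fun x hx => ⟨hx.1.1, hx.2⟩
  have fU : YU.Finite := hS.subset fun x hx => ⟨hx.1.1, hx.2⟩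
  have fW : YW.Finite := hS.subset fun x hx => ⟨hx.1.1, hx.2⟩
  have dYU : Disjoint Y YU := Set.disjoint_left.2 fun x h1 h2 => h1.1.2 (Or.inl h2.1.2)
  have dYW : Disjoint Y YW := Set.disjoint_left.2 fun x h1 h2 => h1.1.2 (Or.inr h2.1.2)
  have dUW : Disjoint YU YW := Set.disjoint_left.2 fun x h1 h2 =>
    Set.disjoint_left.1 hUW h1.1.2 h2.1.2
  have e1 : ξ ∩ S = (Y ∪ YU) ∪ YW := by
    ext x
    simp only [Y, YU, YW, Set.mem_inter_iff, Set.mem_union, Set.mem_compl_iff]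
    tauto
  have e2 : ξ ∩ Wᶜ ∩ S = Y ∪ YU := by
    ext x
    have := fun (h1 : x ∈ U) (h2 : x ∈ W) => Set.disjoint_left.1 hUW h1 h2
    simp only [Y, YU, Set.mem_inter_iff, Set.mem_union, Set.mem_compl_iff]
    tauto
  have e3 : ξ ∩ Uᶜ ∩ S = Y ∪ YW := by
    ext x
    have := fun (h1 : x ∈ U) (h2 : x ∈ W) => Set.disjoint_left.1 hUW h1 h2
    simp only [Y, YW, Set.mem_inter_iff, Set.mem_union, Set.mem_compl_iff]
    tauto
  have r1 : regionFunctional o α S ξ =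
      ∑ᶠ x ∈ Y, f ξ x + ∑ᶠ x ∈ YU, f ξ x + ∑ᶠ x ∈ YW, f ξ x := by
    rw [regionFunctional, e1, finsum_mem_union (Set.disjoint_union_left.2 ⟨dYW, dUW⟩)
      (fY.union fU) fW, finsum_mem_union dYU fY fU]
  have r2 : regionFunctional o α S (ξ ∩ Wᶜ) =
      ∑ᶠ x ∈ Y, f (ξ ∩ Wᶜ) x + ∑ᶠ x ∈ YU, f ξ x := by
    rw [regionFunctional, e2, finsum_mem_union dYU fY fU]
    congr 1
    exact finsum_mem_congr rfl fun x hx => by rw [hU x hx.1]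
  have r3 : regionFunctional o α S (ξ ∩ Uᶜ) =
      ∑ᶠ x ∈ Y, f (ξ ∩ Uᶜ) x + ∑ᶠ x ∈ YW, f ξ x := by
    rw [regionFunctional, e3, finsum_mem_union dYW fY fW]
    congr 1
    exact finsum_mem_congr rfl fun x hx => by rw [hW x hx.1]
  have r4 : regionFunctional o α S (ξ ∩ (U ∪ W)ᶜ) = ∑ᶠ x ∈ Y, f (ξ ∩ (U ∪ W)ᶜ) x := rfl
  rw [secondDifference, r1, r2, r3, r4]
  simp only [finsum_mem_eq_finite_toFinset_sum _ fY]
  have hterm : ∀ x, max (radialEdgeLength o (ξ ∩ Wᶜ) x) (radialEdgeLength o (ξ ∩ Uᶜ) x) ≤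
        radialEdgeLength o (ξ ∩ (U ∪ W)ᶜ) x ∧
      f ξ x - f (ξ ∩ Wᶜ) x - f (ξ ∩ Uᶜ) x + f (ξ ∩ (U ∪ W)ᶜ) x =
      f (ξ ∩ (U ∪ W)ᶜ) x -
        max (radialEdgeLength o (ξ ∩ Wᶜ) x) (radialEdgeLength o (ξ ∩ Uᶜ) x) ^ α := by
    intro x
    have h1 : ξ = (ξ ∩ Wᶜ) ∪ (ξ ∩ Uᶜ) := by
      ext y
      have := fun (h1 : y ∈ U) (h2 : y ∈ W) => Set.disjoint_left.1 hUW h1 h2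
      simp only [Set.mem_inter_iff, Set.mem_union, Set.mem_compl_iff]
      tauto
    have h2 : ξ ∩ Wᶜ = (ξ ∩ Wᶜ) ∪ (ξ ∩ (U ∪ W)ᶜ) :=
      (Set.union_eq_self_of_subset_right (Set.inter_subset_inter_right _
        (Set.compl_subset_compl.2 Set.subset_union_right))).symm
    have h3 : ξ ∩ Uᶜ = (ξ ∩ Uᶜ) ∪ (ξ ∩ (U ∪ W)ᶜ) :=
      (Set.union_eq_self_of_subset_right (Set.inter_subset_inter_right _
        (Set.compl_subset_compl.2 Set.subset_union_left))).symm
    have l1 : radialEdgeLength o ξ x =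
        min (radialEdgeLength o (ξ ∩ Wᶜ) x) (radialEdgeLength o (ξ ∩ Uᶜ) x) := by
      conv_lhs => rw [h1]
      exact radialEdgeLength_union (hξi _) (hξi _)
    have l2 : radialEdgeLength o (ξ ∩ Wᶜ) x ≤ radialEdgeLength o (ξ ∩ (U ∪ W)ᶜ) x := by
      rw [h2, radialEdgeLength_union (hξi _) (hξi _)]
      exact min_le_right _ _
    have l3 : radialEdgeLength o (ξ ∩ Uᶜ) x ≤ radialEdgeLength o (ξ ∩ (U ∪ W)ᶜ) x := by
      rw [h3, radialEdgeLength_union (hξi _) (hξi _)]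
      exact min_le_right _ _
    refine ⟨max_le l2 l3, ?_⟩
    simp only [f, l1]
    rcases le_total (radialEdgeLength o (ξ ∩ Wᶜ) x) (radialEdgeLength o (ξ ∩ Uᶜ) x) with h | h
    · rw [min_eq_left h, max_eq_right h]; ring
    · rw [min_eq_right h, max_eq_left h]; ring
  have hnn : ∀ x, 0 ≤ f ξ x - f (ξ ∩ Wᶜ) x - f (ξ ∩ Uᶜ) x + f (ξ ∩ (U ∪ W)ᶜ) x := by
    intro x
    rw [(hterm x).2, sub_nonneg]
    exact Real.rpow_le_rpow (le_max_of_le_left (radialEdgeLength_nonneg _ _ _)) (hterm x).1 hα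
  have hzY : z ∈ fY.toFinset := fY.mem_toFinset.2 ⟨⟨hz.1, hzUW⟩, hz.2⟩
  have hsum := Finset.single_le_sum (fun x _ => hnn x) hzY
  rw [Finset.sum_add_distrib, Finset.sum_sub_distrib, Finset.sum_sub_distrib] at hsum
  have hz1 : m ^ α - M ^ α ≤
      f ξ z - f (ξ ∩ Wᶜ) z - f (ξ ∩ Uᶜ) z + f (ξ ∩ (U ∪ W)ᶜ) z := by
    rw [(hterm z).2]
    refine sub_le_sub (Real.rpow_le_rpow hm0 hm hα) (Real.rpow_le_rpow ?_ (max_le hMU hMW) hα)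
    exact le_max_of_le_left (radialEdgeLength_nonneg _ _ _)
  linarith

end SecondDifference

/-! ### Fork configurations have a positive second difference. -/

namespace HypSpace

variable {d : ℕ} [NeZero d]

/-- The positions of the four clusters of a configuration in which the second difference has a
definite sign. -/
structure IsFork (o z t u w : HypSpace d) (ρ : ℝ) : Prop where
  pos : 0 < ρ
  root : 4 * ρ ≤ dist o z
  dist_t : dist t z = 6 / 5 * ρ
  root_t : dist o t = dist o z - 6 / 5 * ρ
  dist_u : dist u z = ρ
  dist_w : dist w z = ρ
  root_u : dist o u ≤ dist o z - 3 / 10 * ρ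
  root_w : dist o w ≤ dist o z - 3 / 10 * ρ
  dist_ut : dist u t ≤ 9 / 10 * ρ
  dist_wt : dist w t ≤ 9 / 10 * ρ
  dist_uw : 11 / 10 * ρ ≤ dist u w

theorem exists_isFork (hd : 2 ≤ d) (o z : HypSpace d) {ρ : ℝ} (hρ : 0 < ρ) (hρ' : ρ ≤ 1 / 2)
    (hr : 4 * ρ ≤ dist o z) : ∃ t u w, IsFork o z t u w ρ := by
  obtain ⟨t, u, w, h1, h2, h3, h4, h5, h6, h7, h8, h9⟩ :=
    exists_fork hd o z hρ hρ' (by linarith)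
  exact ⟨t, u, w, hρ, hr, h1, h2, h3, h4, h5, h6, h7, h8, h9⟩

variable {o z t u w : HypSpace d} {ρ : ℝ}

theorem IsFork.swap (h : IsFork o z t u w ρ) : IsFork o z t w u ρ :=
  ⟨h.pos, h.root, h.dist_t, h.root_t, h.dist_w, h.dist_u, h.root_w, h.root_u, h.dist_wt, h.dist_ut,
    by rw [dist_comm]; exact h.dist_uw⟩

/-- The small ball occupied by one cluster of a fork. -/
def cluster (x : HypSpace d) (ρ : ℝ) : Set (HypSpace d) := Metric.ball x (ρ / 100)

theorem IsFork.disjoint_uw (h : IsFork o z t u w ρ) : Disjoint (cluster u ρ) (cluster w ρ) :=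
  Metric.ball_disjoint_ball (by linarith [h.pos, h.dist_uw])

theorem IsFork.disjoint_uz (h : IsFork o z t u w ρ) : Disjoint (cluster u ρ) (cluster z ρ) :=
  Metric.ball_disjoint_ball (by linarith [h.pos, h.dist_u])

theorem IsFork.disjoint_tz (h : IsFork o z t u w ρ) : Disjoint (cluster t ρ) (cluster z ρ) :=
  Metric.ball_disjoint_ball (by linarith [h.pos, h.dist_t])

theorem IsFork.disjoint_ut (h : IsFork o z t u w ρ) : Disjoint (cluster u ρ) (cluster t ρ) :=
  Metric.ball_disjoint_ball (by
    linarith [h.pos, h.dist_u, h.dist_t, dist_triangle t u z, dist_comm t u])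

/-- A point near `t` is an admissible neighbour at distance below `19/20 * ρ`, whereas the cluster
at `w` is farther away than that. So the edges at `u` ignore `w`. -/
theorem IsFork.radialEdgeLength_eq (h : IsFork o z t u w ρ) {ξ : Set (HypSpace d)}
    (hξ : ∀ r, (ξ ∩ Metric.ball o r).Finite) (ht : (ξ ∩ cluster t ρ).Nonempty) :
    ∀ x ∈ ξ ∩ cluster u ρ,
      radialEdgeLength o (ξ ∩ (cluster w ρ)ᶜ) x = radialEdgeLength o ξ x := by
  rintro x ⟨-, hxu⟩
  obtain ⟨t', ht', htt⟩ := ht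
  rw [cluster, Metric.mem_ball] at hxu htt
  have hp := h.pos
  have h1 : dist o t' < dist o x := by
    linarith [dist_triangle o t t', dist_triangle o x u, dist_triangle o u z, h.root_t, h.dist_u,
      dist_comm t t']
  have h2 : radialEdgeLength o ξ x < 19 / 20 * ρ := by
    refine (radialEdgeLength_le_dist hξ ht' h1).trans_lt ?_
    linarith [dist_triangle x u t', dist_triangle u t t', h.dist_ut, dist_comm t t']
  refine radialEdgeLength_eq_of_inter_subset hξ Set.inter_subset_left h2
    fun y hy _ hxy => ⟨hy, fun hyw => ?_⟩
  rw [cluster, Metric.mem_ball] at hyw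
  linarith [dist_triangle u x w, dist_triangle x y w, h.dist_uw, dist_comm u x]

theorem IsFork.radialEdgeLength_le (h : IsFork o z t u w ρ) {ξ : Set (HypSpace d)}
    (hξ : ∀ r, (ξ ∩ Metric.ball o r).Finite) (hu : (ξ ∩ cluster u ρ).Nonempty)
    {x : HypSpace d} (hx : x ∈ cluster z ρ) :
    radialEdgeLength o (ξ ∩ (cluster w ρ)ᶜ) x ≤ 21 / 20 * ρ := by
  obtain ⟨u', hu', huu⟩ := hu
  have hw : u' ∉ cluster w ρ := Set.disjoint_left.1 h.disjoint_uw huu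
  rw [cluster, Metric.mem_ball] at hx huu
  have hp := h.pos
  have h1 : dist o u' < dist o x := by
    linarith [dist_triangle o u u', dist_triangle o x z, h.root_u, dist_comm u u']
  refine (radialEdgeLength_le_dist (fun r => (hξ r).subset fun y hy => ⟨hy.1.1, hy.2⟩)
    (⟨hu', hw⟩ : u' ∈ ξ ∩ (cluster w ρ)ᶜ) h1).trans ?_
  linarith [dist_triangle x z u', dist_triangle z u u', h.dist_u, dist_comm u u', dist_comm z u]

/-- With one of the clusters at `u` and `w` present, a point near `z` has an edge of length at most
`21/20 * ρ`. With both removed, the nearest candidates are those near `t`, at distance at least `6/5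
* ρ - 2/100 * ρ`, which exceeds `23/20 * ρ`. -/
theorem IsFork.le_secondDifference (h : IsFork o z t u w ρ) {α : ℝ} (hα : 0 ≤ α)
    {ξ S : Set (HypSpace d)} (hξ : ∀ r, (ξ ∩ Metric.ball o r).Finite) (hS : (ξ ∩ S).Finite)
    (hzS : cluster z ρ ⊆ S) (hu : (ξ ∩ cluster u ρ).Nonempty) (hw : (ξ ∩ cluster w ρ).Nonempty)
    (ht : (ξ ∩ cluster t ρ).Nonempty) (hz : (ξ ∩ cluster z ρ).Nonempty)
    (hrest : ξ ∩ (Metric.ball z (2 * ρ) \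
      (cluster u ρ ∪ cluster w ρ ∪ (cluster t ρ ∪ cluster z ρ))) = ∅) :
    (23 / 20 * ρ) ^ α - (21 / 20 * ρ) ^ α ≤
      secondDifference o α S (cluster u ρ) (cluster w ρ) ξ := by
  have hp := h.pos
  have hfinz : (ξ ∩ cluster z ρ).Finite := hS.subset (Set.inter_subset_inter_right _ hzS)
  -- Several points may lie in the cluster at `z`; the one nearest to the root cannot connect to any
  -- of the others.
  obtain ⟨x, ⟨hxξ, hxz⟩, hmin⟩ := hfinz.exists_minimalFor (fun y => dist o y) _ hz
  have hxz' : dist x z < ρ / 100 := hxz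
  have hxo : x ≠ o := by
    rintro rfl
    linarith [h.root]
  have hxu : x ∉ cluster u ρ ∪ cluster w ρ := by
    rintro (hx | hx)
    · exact Set.disjoint_left.1 h.disjoint_uz hx hxz
    · exact Set.disjoint_left.1 h.swap.disjoint_uz hx hxz
  refine _root_.le_secondDifference hα hξ hS h.disjoint_uw (h.radialEdgeLength_eq hξ ht)
    (h.swap.radialEdgeLength_eq hξ ht) ⟨hxξ, hzS hxz⟩ hxu (by positivity) ?_
    (h.radialEdgeLength_le hξ hu hxz) (h.swap.radialEdgeLength_le hξ hw hxz)
  rw [le_radialEdgeLength_iff (fun r => (hξ r).subset fun y hy => ⟨hy.1.1, hy.2⟩) hxo]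
  rintro y (⟨hyξ, hyUW⟩ | hy) hyx
  · by_cases hyz : y ∈ cluster z ρ
    · have := hmin (⟨hyξ, hyz⟩ : y ∈ ξ ∩ cluster z ρ) hyx.le
      exact absurd this (not_le.2 hyx)
    by_cases hyt : y ∈ cluster t ρ
    · rw [cluster, Metric.mem_ball] at hyt
      linarith [dist_triangle t y z, dist_triangle y x z, h.dist_t, dist_comm t y, dist_comm x y]
    · have hyb : y ∉ Metric.ball z (2 * ρ) := by
        intro hyb
        have : y ∈ ξ ∩ (Metric.ball z (2 * ρ) \
            (cluster u ρ ∪ cluster w ρ ∪ (cluster t ρ ∪ cluster z ρ))) :=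
          ⟨hyξ, hyb, fun hc => hc.elim hyUW fun hc => hc.elim hyt hyz⟩
        rw [hrest] at this
        exact this
      rw [Metric.mem_ball, not_lt] at hyb
      linarith [dist_triangle y x z, dist_comm x y]
  · rw [Set.mem_singleton_iff] at hy
    rw [hy]
    linarith [h.root, dist_triangle o x z, dist_comm o x]

end HypSpace

/-! ### Centred void indicators and their correlation with the functional. -/

theorem measurableSet_void_regionSigma {Ω X : Type*} [MeasurableSpace X] (η : Ω → Set X) {U B : Set X}
    (hU : MeasurableSet U) (hUB : U ⊆ B) : MeasurableSet[regionSigma η B] {ω | η ω ∩ U = ∅} := by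
  have := measurable_count_regionSigma η hU hUB (MeasurableSet.singleton (0 : ℕ∞))
  simpa [Set.preimage] using this

section VoidDeviation

variable {Ω X : Type*} [mΩ : MeasurableSpace Ω]

/-- The centred indicator function of the event that there is no point in `U`. -/
def voidDeviation (P : Measure Ω) (η : Ω → Set X) (U : Set X) (ω : Ω) : ℝ :=
  {ω | η ω ∩ U = ∅}.indicator 1 ω - P.real {ω | η ω ∩ U = ∅}

theorem abs_voidDeviation_le (P : Measure Ω) [IsProbabilityMeasure P] (η : Ω → Set X) (U : Set X)
    (ω : Ω) : |voidDeviation P η U ω| ≤ 1 := by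
  have h1 : 0 ≤ P.real {ω | η ω ∩ U = ∅} := measureReal_nonneg
  have h2 : P.real {ω | η ω ∩ U = ∅} ≤ 1 := measureReal_le_one
  rw [voidDeviation, abs_le]
  by_cases h : ω ∈ {ω | η ω ∩ U = ∅}
  · rw [Set.indicator_of_mem h, Pi.one_apply]
    constructor <;> linarith
  · rw [Set.indicator_of_notMem h]
    constructor <;> linarith

theorem voidDeviation_of_nonempty (P : Measure Ω) {η : Ω → Set X} {U : Set X} {ω : Ω}
    (h : (η ω ∩ U).Nonempty) : voidDeviation P η U ω = -P.real {ω | η ω ∩ U = ∅} := by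
  rw [voidDeviation, Set.indicator_of_notMem (show ω ∉ {ω | η ω ∩ U = ∅} from h.ne_empty), zero_sub]

variable [MeasurableSpace X]

theorem measurable_voidDeviation (P : Measure Ω) (η : Ω → Set X) {U B : Set X}
    (hU : MeasurableSet U) (hUB : U ⊆ B) : Measurable[regionSigma η B] (voidDeviation P η U) :=
  @Measurable.sub_const _ _ _ _ _ (_) _ (@Measurable.indicator _ _ (_) _ _ _ _
    (@measurable_const _ _ _ (_) _) (measurableSet_void_regionSigma η hU hUB)) _

end VoidDeviation

namespace IsPoissonProcess

variable {Ω X : Type*} [mΩ : MeasurableSpace Ω] [MetricSpace X] [MeasurableSpace X]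
  {P : Measure Ω} {η : Ω → Set X} {μ : Measure X}

theorem indepFun_of_regionSigma [IsProbabilityMeasure P] (h : IsPoissonProcess P η μ)
    {B B' : Set X} (hB : MeasurableSet B) (hB' : MeasurableSet B') (hd : Disjoint B B')
    {f g : Ω → ℝ} (hf : Measurable[regionSigma η B] f) (hg : Measurable[regionSigma η B'] g) :
    IndepFun f g P :=
  (IndepFun_iff_Indep f g P).2 (indep_of_indep_of_le_left (indep_of_indep_of_le_right
    (h.indep_regionSigma hB hB' hd) hg.comap_le) hf.comap_le)

theorem integral_voidDeviation [IsProbabilityMeasure P] (h : IsPoissonProcess P η μ)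
    {U : Set X} (hU : MeasurableSet U) : ∫ ω, voidDeviation P η U ω ∂P = 0 := by
  have hm := h.measurableSet_void hU
  have hi : Integrable ({ω | η ω ∩ U = ∅}.indicator (1 : Ω → ℝ)) P :=
    (integrable_const (1 : ℝ)).indicator hm
  simp only [voidDeviation]
  rw [integral_sub hi (integrable_const _),
    integral_indicator_one hm]
  simp

/-- The two factors are independent and one of them is centred. This removes every term of the
second difference except the functional itself. -/
theorem integral_mul_voidDeviation [IsProbabilityMeasure P] (h : IsPoissonProcess P η μ)
    {U : Set X} (hU : MeasurableSet U) {Y : Ω → ℝ} (hY : Measurable[regionSigma η Uᶜ] Y) :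
    ∫ ω, Y ω * voidDeviation P η U ω ∂P = 0 := by
  have hV := measurable_voidDeviation P η hU subset_rfl
  rw [(h.indepFun_of_regionSigma hU.compl hU disjoint_compl_left hY hV).integral_fun_mul_eq_mul_integral
    (hY.mono (h.regionSigma_le _) le_rfl).aestronglyMeasurable
    (hV.mono (h.regionSigma_le _) le_rfl).aestronglyMeasurable, h.integral_voidDeviation hU, mul_zero]

theorem measureReal_void (h : IsPoissonProcess P η μ) {B : Set X} (hB : MeasurableSet B)
    (hμ : μ B ≠ ⊤) : P.real {ω | η ω ∩ B = ∅} = Real.exp (-(μ B).toReal) := by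
  rw [measureReal_def, h.measure_void hB hμ, ENNReal.toReal_ofReal (Real.exp_pos _).le]

theorem measureReal_nonempty [IsProbabilityMeasure P] (h : IsPoissonProcess P η μ) {B : Set X}
    (hB : MeasurableSet B) (hμ : μ B ≠ ⊤) :
    P.real {ω | (η ω ∩ B).Nonempty} = 1 - Real.exp (-(μ B).toReal) := by
  have : {ω | (η ω ∩ B).Nonempty} = {ω | η ω ∩ B = ∅}ᶜ := by
    ext ω
    exact Set.nonempty_iff_ne_empty
  rw [this, probReal_compl_eq_one_sub (h.measurableSet_void hB), h.measureReal_void hB hμ]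

theorem integrable_regionFunctional_inter [SecondCountableTopology X] [BorelSpace X]
    [IsProbabilityMeasure P] (h : IsPoissonProcess P η μ) {o : X} {α : ℝ} (hα : 0 ≤ α) {R : ℝ}
    (hμ : μ (Metric.ball o R) ≠ ⊤) {B : Set X} (hB : MeasurableSet B) :
    Integrable (fun ω => regionFunctional o α (Metric.ball o R) (η ω ∩ B)) P := by
  refine ⟨((h.measurable_regionFunctional_inter α measurableSet_ball subset_rfl hB).mono
    (h.regionSigma_le _) le_rfl).aestronglyMeasurable, ?_⟩
  rw [hasFiniteIntegral_iff_ofReal (Filter.Eventually.of_forall fun ω =>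
    regionFunctional_nonneg _ _ _ _)]
  refine lt_of_le_of_lt (lintegral_mono (g := fun ω =>
    ((η ω ∩ Metric.ball o R).encard : ENNReal) ^ 2 * ENNReal.ofReal (R ^ α)) fun ω => ?_) ?_
  · have hsub : η ω ∩ B ∩ Metric.ball o R ⊆ η ω ∩ Metric.ball o R := fun x hx => ⟨hx.1.1, hx.2⟩
    refine (regionFunctional_le hα (M := R) ((h.finite_inter_ball o ω R).subset hsub)
      fun x hx => ?_).trans ?_
    · refine (radialEdgeLength_le_dist_root fun r =>
        (h.finite_inter_ball o ω r).subset fun x hx => ⟨hx.1.1, hx.2⟩).trans ?_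
      rw [dist_comm]
      exact (Metric.mem_ball.1 hx.2).le
    -- The count is at most its square, whose integral is already bounded.
    · refine mul_le_mul_left ((ENat.toENNReal_le.2 (Set.encard_le_encard hsub)).trans ?_) _
      rw [(h.finite_inter_ball o ω R).encard_eq_coe_toFinset_card]
      norm_cast
      exact Nat.le_self_pow two_ne_zero _
  · have hm : Measurable fun ω => ((η ω ∩ Metric.ball o R).encard : ENNReal) ^ 2 :=
      (measurable_of_countable (fun n : ℕ∞ => (n : ENNReal) ^ 2)).comp
        (h.measurable_count _ measurableSet_ball)
    rw [lintegral_mul_const _ hm]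
    exact ENNReal.mul_lt_top ((h.lintegral_count_sq_le measurableSet_ball hμ).trans_lt
      ENNReal.ofReal_lt_top) ENNReal.ofReal_lt_top

/-- The correlation of the functional with the product of two void deviations is that of its second
difference. -/
theorem le_integral_mul_voidDeviation [SecondCountableTopology X] [BorelSpace X]
    [IsProbabilityMeasure P] (h : IsPoissonProcess P η μ) {o : X} {α : ℝ} (hα : 0 ≤ α) {R : ℝ}
    (hμ : μ (Metric.ball o R) ≠ ⊤) {U W : Set X} (hU : MeasurableSet U) (hW : MeasurableSet W)
    (hUW : Disjoint U W) {V : Set Ω} (hV : MeasurableSet[regionSigma η (U ∪ W)ᶜ] V) {g : ℝ}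
    (hg : ∀ ω ∈ V, (η ω ∩ U).Nonempty → (η ω ∩ W).Nonempty →
      g ≤ secondDifference o α (Metric.ball o R) U W (η ω)) :
    g * (P.real {ω | η ω ∩ U = ∅} * P.real {ω | η ω ∩ W = ∅}) *
        P.real (V ∩ {ω | (η ω ∩ U).Nonempty} ∩ {ω | (η ω ∩ W).Nonempty}) ≤
      ∫ ω, regionFunctional o α (Metric.ball o R) (η ω) *
        (V.indicator 1 ω * voidDeviation P η U ω * voidDeviation P η W ω) ∂P := by
  let F : Set X → Ω → ℝ := fun B ω => regionFunctional o α (Metric.ball o R) (η ω ∩ B)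
  let H : Ω → ℝ := fun ω => V.indicator 1 ω * voidDeviation P η U ω * voidDeviation P η W ω
  let D : Ω → ℝ := fun ω => secondDifference o α (Metric.ball o R) U W (η ω)
  have hVm : MeasurableSet V := h.regionSigma_le _ _ hV
  have hVr : ∀ B, (U ∪ W)ᶜ ⊆ B → Measurable[regionSigma η B] (V.indicator (1 : Ω → ℝ)) :=
    fun B hB => @Measurable.indicator _ _ (_) _ _ _ _ (@measurable_const _ _ _ (_) _)
      (regionSigma_mono η hB _ hV)
  have hUc : (U ∪ W)ᶜ ⊆ Uᶜ := Set.compl_subset_compl.2 Set.subset_union_left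
  have hWc : (U ∪ W)ᶜ ⊆ Wᶜ := Set.compl_subset_compl.2 Set.subset_union_right
  have hdU : Measurable (voidDeviation P η U) :=
    (measurable_voidDeviation P η hU subset_rfl).mono (h.regionSigma_le _) le_rfl
  have hdW : Measurable (voidDeviation P η W) :=
    (measurable_voidDeviation P η hW subset_rfl).mono (h.regionSigma_le _) le_rfl
  have hHm : Measurable H := ((measurable_const.indicator hVm).mul hdU).mul hdW
  have hH1 : ∀ ω, ‖H ω‖ ≤ 1 := by
    intro ω
    have h1 : |V.indicator (1 : Ω → ℝ) ω| ≤ 1 := by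
      by_cases hω : ω ∈ V <;> simp [hω]
    rw [Real.norm_eq_abs, abs_mul, abs_mul]
    exact mul_le_one₀ (mul_le_one₀ h1 (abs_nonneg _) (abs_voidDeviation_le _ _ _ _)) (abs_nonneg _)
      (abs_voidDeviation_le _ _ _ _)
  have hFm : ∀ B, MeasurableSet B → Measurable[regionSigma η B] (F B) := fun B hB =>
    h.measurable_regionFunctional_inter α measurableSet_ball subset_rfl hB
  have hFi : ∀ B, MeasurableSet B → Integrable (F B) P := fun B hB =>
    h.integrable_regionFunctional_inter hα hμ hB
  have hFH : ∀ B, MeasurableSet B → Integrable (fun ω => F B ω * H ω) P := fun B hB =>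
    (hFi B hB).mul_bdd hHm.aestronglyMeasurable (Filter.Eventually.of_forall hH1)
  -- Once the points of `W` are removed, everything but the deviation of `W` is determined outside
  -- `W`.
  have zW : ∀ B, MeasurableSet B → B ⊆ Wᶜ → ∫ ω, F B ω * H ω ∂P = 0 := by
    intro B hB hBW
    have := h.integral_mul_voidDeviation hW (Y := fun ω =>
      F B ω * (V.indicator 1 ω * voidDeviation P η U ω))
      (@Measurable.mul _ _ _ _ _ (_) _ _ ((hFm B hB).mono (regionSigma_mono η hBW) le_rfl)
        (@Measurable.mul _ _ _ _ _ (_) _ _ (hVr _ hWc)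
          (measurable_voidDeviation P η hU hUW.subset_compl_right)))
    rw [← this]
    exact integral_congr_ae (Filter.Eventually.of_forall fun ω => by simp only [H]; ring)
  have zU : ∫ ω, F Uᶜ ω * H ω ∂P = 0 := by
    have := h.integral_mul_voidDeviation hU (Y := fun ω =>
      F Uᶜ ω * (V.indicator 1 ω * voidDeviation P η W ω))
      (@Measurable.mul _ _ _ _ _ (_) _ _ (hFm _ hU.compl)
        (@Measurable.mul _ _ _ _ _ (_) _ _ (hVr _ hUc)
          (measurable_voidDeviation P η hW hUW.subset_compl_left)))
    rw [← this]
    exact integral_congr_ae (Filter.Eventually.of_forall fun ω => by simp only [H]; ring)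
  have huniv : ∀ ω, F Set.univ ω = regionFunctional o α (Metric.ball o R) (η ω) := fun ω => by
    simp only [F, Set.inter_univ]
  have hDH : ∀ ω, D ω * H ω = F Set.univ ω * H ω - F Wᶜ ω * H ω - F Uᶜ ω * H ω +
      F (U ∪ W)ᶜ ω * H ω := fun ω => by
    rw [huniv]
    simp only [D, secondDifference, F]
    ring
  have i0 := hFH _ MeasurableSet.univ
  have i1 := hFH _ hW.compl
  have i2 := hFH _ hU.compl
  have i3 := hFH _ (hU.union hW).compl
  have i01 : Integrable (fun ω => F Set.univ ω * H ω - F Wᶜ ω * H ω) P := i0.sub i1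
  have i012 : Integrable (fun ω => F Set.univ ω * H ω - F Wᶜ ω * H ω - F Uᶜ ω * H ω) P := i01.sub i2
  have hDi : Integrable (fun ω => D ω * H ω) P := by
    simp_rw [hDH]
    exact i012.add i3
  have hFD : ∫ ω, regionFunctional o α (Metric.ball o R) (η ω) * H ω ∂P = ∫ ω, D ω * H ω ∂P := by
    simp_rw [hDH]
    rw [integral_add i012 i3, integral_sub i01 i2, integral_sub i0 i1,
      zW _ hW.compl subset_rfl, zU, zW _ (hU.union hW).compl hWc]
    simp_rw [huniv]
    ring
  have hne : ∀ B, MeasurableSet B → MeasurableSet {ω | (η ω ∩ B).Nonempty} := fun B hB => by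
    have : {ω | (η ω ∩ B).Nonempty} = {ω | η ω ∩ B = ∅}ᶜ := by
      ext ω
      exact Set.nonempty_iff_ne_empty
    rw [this]
    exact (h.measurableSet_void hB).compl
  have hgood := (hVm.inter (hne U hU)).inter (hne W hW)
  change _ ≤ ∫ ω, regionFunctional o α (Metric.ball o R) (η ω) * H ω ∂P
  rw [hFD, mul_comm, ← smul_eq_mul, ← integral_indicator_const _ hgood]
  -- The integrand vanishes if `U` or `W` is empty or `V` fails. Otherwise both deviations are
  -- negative, and their product is the product of the two void probabilities.
  refine integral_mono ((integrable_const _).indicator hgood) hDi fun ω => ?_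
  simp only [D]
  rcases (η ω ∩ U).eq_empty_or_nonempty with hu | hu
  · rw [secondDifference_of_left_empty hu, zero_mul, Set.indicator_of_notMem]
    exact fun hω => hω.1.2.ne_empty hu
  rcases (η ω ∩ W).eq_empty_or_nonempty with hw | hw
  · rw [secondDifference_of_right_empty hw, zero_mul, Set.indicator_of_notMem]
    exact fun hω => hω.2.ne_empty hw
  by_cases hω : ω ∈ V
  · have hmem : ω ∈ V ∩ {ω | (η ω ∩ U).Nonempty} ∩ {ω | (η ω ∩ W).Nonempty} := ⟨⟨hω, hu⟩, hw⟩
    rw [Set.indicator_of_mem hmem]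
    simp only [H]
    rw [Set.indicator_of_mem hω, voidDeviation_of_nonempty P hu, voidDeviation_of_nonempty P hw,
      Pi.one_apply, one_mul, neg_mul_neg]
    exact mul_le_mul_of_nonneg_right (hg ω hω hu hw) (by positivity)
  · rw [Set.indicator_of_notMem fun hc => hω hc.1.1]
    simp [H, hω]

end IsPoissonProcess

theorem IsPoissonProcess.measureReal_void_inter_nonempty {Ω X ι : Type*} [MeasurableSpace Ω]
    [MetricSpace X] [MeasurableSpace X] {P : Measure Ω} {η : Ω → Set X} {μ : Measure X}
    [IsProbabilityMeasure P] [Fintype ι] (h : IsPoissonProcess P η μ) {K : ι → Set X}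
    {E : Set X} (hK : ∀ i, MeasurableSet (K i)) (hE : MeasurableSet E)
    (hKd : Pairwise fun i j => Disjoint (K i) (K j)) (hEd : Disjoint E (⋃ i, K i)) :
    P.real ({ω | η ω ∩ E = ∅} ∩ ⋂ i, {ω | (η ω ∩ K i).Nonempty}) =
      P.real {ω | η ω ∩ E = ∅} * ∏ i, P.real {ω | (η ω ∩ K i).Nonempty} := by
  have hne : ∀ i, {ω | (η ω ∩ K i).Nonempty} = (fun ω => (η ω ∩ K i).encard) ⁻¹' {0}ᶜ := by
    intro i
    ext ω
    simp [Set.nonempty_iff_ne_empty]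
  have h1 := (h.iIndepFun_count hK hKd).measure_inter_preimage_eq_mul Finset.univ
    (sets := fun _ => {0}ᶜ) fun _ _ => MeasurableSet.of_discrete
  have h2 := (Indep_iff _ _ P).1 (h.indep_regionSigma hE (MeasurableSet.iUnion hK) hEd)
    {ω | η ω ∩ E = ∅} (⋂ i, {ω | (η ω ∩ K i).Nonempty})
    (measurableSet_void_regionSigma η hE subset_rfl)
    (by
      refine @MeasurableSet.iInter _ _ (_) _ _ fun i => ?_
      rw [hne]
      exact measurable_count_regionSigma η (hK i) (Set.subset_iUnion K i) MeasurableSet.of_discrete)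
  simp only [measureReal_def]
  rw [h2, ENNReal.toReal_mul, ← ENNReal.toReal_prod]
  congr 2
  simp_rw [hne]
  simpa using h1

namespace HypSpace

variable {d : ℕ} [NeZero d] {Ω : Type*} [MeasurableSpace Ω] {P : Measure Ω}
  {η : Ω → Set (HypSpace d)} {γ ρ : ℝ}

theorem smul_hypVolume_ne_top {B : Set (HypSpace d)} {x : HypSpace d} {r : ℝ}
    (hB : B ⊆ Metric.ball x r) : (ENNReal.ofReal γ • hypVolume d) B ≠ ⊤ := by
  rw [Measure.smul_apply, smul_eq_mul]
  exact ENNReal.mul_ne_top ENNReal.ofReal_ne_top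
    ((measure_mono hB).trans_lt (hypVolume_ball_lt_top x r)).ne

theorem toReal_smul_hypVolume (hγ : 0 ≤ γ) (B : Set (HypSpace d)) :
    ((ENNReal.ofReal γ • hypVolume d) B).toReal = γ * (hypVolume d B).toReal := by
  rw [Measure.smul_apply, smul_eq_mul, ENNReal.toReal_mul, ENNReal.toReal_ofReal hγ]

theorem exp_le_measureReal_void {C : ℝ} (hC0 : 0 < C)
    (hC : ∀ (z : HypSpace d) (s : ℝ), 0 < s →
      hypVolume d (Metric.ball z s) ≤ ENNReal.ofReal (C * (s * Real.exp (2 * s)) ^ d))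
    (hη : IsPoissonProcess P η (ENNReal.ofReal γ • hypVolume d)) (hγ : 0 < γ) (hρ : 0 < ρ)
    (hρ1 : ρ ≤ 1) {B : Set (HypSpace d)} (hB : MeasurableSet B) {x : HypSpace d}
    (hBx : B ⊆ Metric.ball x (2 * ρ)) :
    Real.exp (-(C * (γ * ρ ^ d) * (2 * Real.exp 4) ^ d)) ≤ P.real {ω | η ω ∩ B = ∅} := by
  rw [hη.measureReal_void hB (smul_hypVolume_ne_top hBx), toReal_smul_hypVolume hγ.le,
    Real.exp_le_exp, neg_le_neg_iff]
  have h1 := ENNReal.toReal_mono ENNReal.ofReal_ne_top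
    ((measure_mono hBx).trans (hC x (2 * ρ) (by positivity)))
  rw [ENNReal.toReal_ofReal (by positivity)] at h1
  calc γ * (hypVolume d B).toReal ≤ γ * (C * (2 * ρ * Real.exp 4) ^ d) := by
        gcongr
        refine h1.trans ?_
        gcongr
        linarith
    _ = _ := by
        rw [show 2 * ρ * Real.exp 4 = ρ * (2 * Real.exp 4) by ring, mul_pow ρ]
        ring

theorem le_measureReal_cluster_nonempty [IsProbabilityMeasure P] {c : ℝ} (hc0 : 0 < c)
    (hc : ∀ (z : HypSpace d) (s : ℝ), 0 < s →
      ENNReal.ofReal (c * s ^ d) ≤ hypVolume d (Metric.ball z s))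
    (hη : IsPoissonProcess P η (ENNReal.ofReal γ • hypVolume d)) (hγ : 0 < γ) (hρ : 0 < ρ)
    (x : HypSpace d) :
    1 - Real.exp (-(c * (γ * ρ ^ d) / 100 ^ d)) ≤ P.real {ω | (η ω ∩ cluster x ρ).Nonempty} := by
  rw [cluster, hη.measureReal_nonempty measurableSet_ball (smul_hypVolume_ne_top subset_rfl),
    toReal_smul_hypVolume hγ.le, sub_le_sub_iff_left, Real.exp_le_exp, neg_le_neg_iff]
  have h1 := ENNReal.toReal_mono (hypVolume_ball_lt_top x (ρ / 100)).ne
    (hc x (ρ / 100) (by positivity))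
  rw [ENNReal.toReal_ofReal (by positivity)] at h1
  calc c * (γ * ρ ^ d) / 100 ^ d = γ * (c * (ρ / 100) ^ d) := by rw [div_pow]; ring
    _ ≤ _ := by gcongr

variable {o z t u w : HypSpace d}

theorem IsFork.cluster_subset (h : IsFork o z t u w ρ) {x : HypSpace d} (hx : dist x z ≤ 6 / 5 * ρ) :
    cluster x ρ ⊆ Metric.ball z (2 * ρ) :=
  Metric.ball_subset_ball' (by linarith [h.pos])

theorem IsFork.pairwise_disjoint (h : IsFork o z t u w ρ) :
    Pairwise fun i j : Fin 4 => Disjoint (cluster (![u, w, t, z] i) ρ)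
      (cluster (![u, w, t, z] j) ρ) := by
  have h1 := h.disjoint_uw
  have h2 := h.disjoint_ut
  have h3 := h.disjoint_uz
  have h4 := h.swap.disjoint_ut
  have h5 := h.swap.disjoint_uz
  have h6 := h.disjoint_tz
  intro i j
  revert i j
  simp [Fin.forall_fin_succ, h1, h2, h3, h4, h5, h6, h1.symm, h2.symm, h3.symm, h4.symm, h5.symm,
    h6.symm]

/-- A bounded centred function of the configuration near `z` that is correlated with the
functional. -/
theorem IsFork.exists_correlated [IsProbabilityMeasure P] (h : IsFork o z t u w ρ) {c C : ℝ}
    (hc0 : 0 < c) (hC0 : 0 < C)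
    (hc : ∀ (z : HypSpace d) (s : ℝ), 0 < s →
      ENNReal.ofReal (c * s ^ d) ≤ hypVolume d (Metric.ball z s))
    (hC : ∀ (z : HypSpace d) (s : ℝ), 0 < s →
      hypVolume d (Metric.ball z s) ≤ ENNReal.ofReal (C * (s * Real.exp (2 * s)) ^ d))
    (hη : IsPoissonProcess P η (ENNReal.ofReal γ • hypVolume d)) (hγ : 0 < γ) (hρ1 : ρ ≤ 1)
    {α R : ℝ} (hα : 0 ≤ α) (hzR : cluster z ρ ⊆ Metric.ball o R) :
    ∃ H : Ω → ℝ, Measurable[regionSigma η (Metric.ball z (2 * ρ))] H ∧ (∀ ω, |H ω| ≤ 1) ∧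
      ∫ ω, H ω ∂P = 0 ∧
      ((23 / 20 * ρ) ^ α - (21 / 20 * ρ) ^ α) *
        (Real.exp (-(C * (γ * ρ ^ d) * (2 * Real.exp 4) ^ d)) ^ 3 *
          (1 - Real.exp (-(c * (γ * ρ ^ d) / 100 ^ d))) ^ 4) ≤
        ∫ ω, edgeLengthFunctional o α R (η ω) * H ω ∂P := by
  have hρ := h.pos
  let x : Fin 4 → HypSpace d := ![u, w, t, z]
  let E : Set (HypSpace d) :=
    Metric.ball z (2 * ρ) \ (cluster u ρ ∪ cluster w ρ ∪ (cluster t ρ ∪ cluster z ρ))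
  -- The event fixes the configuration near `z` outside the clusters at `u` and `w`, so it is
  -- independent of the two deviations.
  let V : Set Ω := {ω | η ω ∩ E = ∅} ∩
    ({ω | (η ω ∩ cluster t ρ).Nonempty} ∩ {ω | (η ω ∩ cluster z ρ).Nonempty})
  have hm : ∀ y, MeasurableSet (cluster y ρ : Set (HypSpace d)) := fun y => measurableSet_ball
  have hE : MeasurableSet E :=
    measurableSet_ball.diff (((hm u).union (hm w)).union ((hm t).union (hm z)))
  have hEb : E ⊆ Metric.ball z (2 * ρ) := Set.sdiff_subset
  have hub : cluster u ρ ⊆ Metric.ball z (2 * ρ) := h.cluster_subset (by linarith [h.dist_u])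
  have hwb : cluster w ρ ⊆ Metric.ball z (2 * ρ) := h.cluster_subset (by linarith [h.dist_w])
  have htb : cluster t ρ ⊆ Metric.ball z (2 * ρ) := h.cluster_subset h.dist_t.le
  have hzb : cluster z ρ ⊆ Metric.ball z (2 * ρ) := h.cluster_subset (by rw [dist_self]; positivity)
  have hVr : ∀ B, E ⊆ B → cluster t ρ ⊆ B → cluster z ρ ⊆ B → MeasurableSet[regionSigma η B] V := by
    intro B h1 h2 h3
    have hne : ∀ y, cluster y ρ ⊆ B →
        MeasurableSet[regionSigma η B] {ω | (η ω ∩ cluster y ρ).Nonempty} := by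
      intro y hy
      have : {ω | (η ω ∩ cluster y ρ).Nonempty} = {ω | η ω ∩ cluster y ρ = ∅}ᶜ := by
        ext ω
        exact Set.nonempty_iff_ne_empty
      rw [this]
      exact @MeasurableSet.compl _ _ (_) (measurableSet_void_regionSigma η (hm y) hy)
    exact @MeasurableSet.inter _ (_) _ _ (measurableSet_void_regionSigma η hE h1)
      (@MeasurableSet.inter _ (_) _ _ (hne t h2) (hne z h3))
  have hVUW : MeasurableSet[regionSigma η (cluster u ρ ∪ cluster w ρ)ᶜ] V := by
    refine hVr _ (fun y hy hc => hy.2 (Or.inl hc)) ?_ ?_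
    · exact (Set.disjoint_union_right.2 ⟨h.disjoint_ut.symm, h.swap.disjoint_ut.symm⟩).subset_compl_right
    · exact (Set.disjoint_union_right.2 ⟨h.disjoint_uz.symm, h.swap.disjoint_uz.symm⟩).subset_compl_right
  have hind : ∀ B, MeasurableSet[regionSigma η B] V →
      Measurable[regionSigma η B] (V.indicator (1 : Ω → ℝ)) := fun B hB =>
    @Measurable.indicator _ _ (_) _ _ _ _ (@measurable_const _ _ _ (_) _) hB
  refine ⟨fun ω => V.indicator 1 ω * voidDeviation P η (cluster u ρ) ω *
    voidDeviation P η (cluster w ρ) ω, ?_, fun ω => ?_, ?_, ?_⟩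
  · exact @Measurable.mul _ _ _ _ _ (_) _ _ (@Measurable.mul _ _ _ _ _ (_) _ _
      (hind _ (hVr _ hEb htb hzb)) (measurable_voidDeviation P η (hm u) hub))
      (measurable_voidDeviation P η (hm w) hwb)
  · have h1 : |V.indicator (1 : Ω → ℝ) ω| ≤ 1 := by
      by_cases hω : ω ∈ V <;> simp [hω]
    rw [abs_mul, abs_mul]
    exact mul_le_one₀ (mul_le_one₀ h1 (abs_nonneg _) (abs_voidDeviation_le _ _ _ _)) (abs_nonneg _)
      (abs_voidDeviation_le _ _ _ _)
  · refine hη.integral_mul_voidDeviation (hm w) ?_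
    exact @Measurable.mul _ _ _ _ _ (_) _ _ (hind _ (regionSigma_mono η
      (Set.compl_subset_compl.2 Set.subset_union_right) _ hVUW))
      (measurable_voidDeviation P η (hm u) h.disjoint_uw.subset_compl_right)
  · have hg : 0 ≤ (23 / 20 * ρ) ^ α - (21 / 20 * ρ) ^ α :=
      sub_nonneg.2 (Real.rpow_le_rpow (by positivity) (by linarith) hα)
    have key := hη.le_integral_mul_voidDeviation hα (R := R) (o := o) (smul_hypVolume_ne_top subset_rfl)
      (hm u) (hm w) h.disjoint_uw hVUW (g := (23 / 20 * ρ) ^ α - (21 / 20 * ρ) ^ α)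
      fun ω hω hu hw => h.le_secondDifference hα (hη.finite_inter_ball o ω)
        (hη.finite_inter_ball o ω R) hzR hu hw hω.2.1 hω.2.2 hω.1
    refine le_trans ?_ key
    have hset : V ∩ {ω | (η ω ∩ cluster u ρ).Nonempty} ∩ {ω | (η ω ∩ cluster w ρ).Nonempty} =
        {ω | η ω ∩ E = ∅} ∩ ⋂ i, {ω | (η ω ∩ cluster (x i) ρ).Nonempty} := by
      ext ω
      simp only [V, x, Set.mem_inter_iff, Set.mem_iInter, Fin.forall_fin_succ, Set.mem_ofPred_eq]
      simp
      tauto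
    have hEd : Disjoint E (⋃ i, cluster (x i) ρ) := by
      rw [Set.disjoint_iUnion_right]
      intro i
      refine Set.disjoint_sdiff_left.mono_right ?_
      fin_cases i
      · exact fun y hy => Or.inl (Or.inl hy)
      · exact fun y hy => Or.inl (Or.inr hy)
      · exact fun y hy => Or.inr (Or.inl hy)
      · exact fun y hy => Or.inr (Or.inr hy)
    rw [hset, hη.measureReal_void_inter_nonempty (fun i => hm (x i)) hE h.pairwise_disjoint hEd,
      mul_assoc ((23 / 20 * ρ) ^ α - (21 / 20 * ρ) ^ α)]
    refine mul_le_mul_of_nonneg_left ?_ hg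
    -- The three exponential factors come from the voids of `u`, `w` and `E`; the four others from
    -- the nonempty clusters.
    have vU := exp_le_measureReal_void hC0 hC hη hγ hρ hρ1 (hm u) hub
    have vW := exp_le_measureReal_void hC0 hC hη hγ hρ hρ1 (hm w) hwb
    have vE := exp_le_measureReal_void hC0 hC hη hγ hρ hρ1 hE hEb
    have hτ : 0 ≤ 1 - Real.exp (-(c * (γ * ρ ^ d) / 100 ^ d)) :=
      sub_nonneg.2 (Real.exp_le_one_iff.2 (neg_nonpos.2 (by positivity)))
    have hprod : (1 - Real.exp (-(c * (γ * ρ ^ d) / 100 ^ d))) ^ 4 ≤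
        ∏ i, P.real {ω | (η ω ∩ cluster (x i) ρ).Nonempty} := by
      have := Finset.prod_le_prod (s := (Finset.univ : Finset (Fin 4))) (fun i _ => hτ)
        fun i _ => le_measureReal_cluster_nonempty hc0 hc hη hγ hρ (x i)
      simpa using this
    rw [show ∀ a b : ℝ, a ^ 3 * b = a * a * (a * b) from fun a b => by ring]
    gcongr

end HypSpace

/-! ### The lower variance bound. -/

/-- A functional that is correlated with many uncorrelated bounded functions has a large variance. -/
theorem card_mul_sq_le_variance {Ω ι : Type*} [MeasurableSpace Ω] {P : Measure Ω}
    [IsProbabilityMeasure P] {F : Ω → ℝ} (hF : MemLp F 2 P) {T : Finset ι} {H : ι → Ω → ℝ}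
    (hm : ∀ i ∈ T, Measurable (H i)) (h1 : ∀ i ∈ T, ∀ ω, |H i ω| ≤ 1)
    (h0 : ∀ i ∈ T, ∫ ω, H i ω ∂P = 0)
    (hind : (T : Set ι).Pairwise fun i j => IndepFun (H i) (H j) P) {e : ℝ} (he : 0 ≤ e)
    (hcov : ∀ i ∈ T, e ≤ ∫ ω, F ω * H i ω ∂P) : T.card * e ^ 2 ≤ Var[F; P] := by
  have hmem : ∀ i ∈ T, MemLp (H i) 2 P := fun i hi =>
    MemLp.of_bound (hm i hi).aestronglyMeasurable 1 (Filter.Eventually.of_forall (h1 i hi))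
  have hsum : MemLp (∑ i ∈ T, H i) 2 P := memLp_finsetSum' _ hmem
  have hvar : Var[∑ i ∈ T, H i; P] ≤ T.card := by
    rw [IndepFun.variance_sum hmem hind, ← nsmul_one, ← Finset.sum_const]
    refine Finset.sum_le_sum fun i hi => ?_
    refine (variance_le_expectation_sq (hm i hi).aestronglyMeasurable).trans ?_
    have : ∫ ω, (H i ^ 2) ω ∂P ≤ ∫ _ω, (1 : ℝ) ∂P := by
      refine integral_mono (hmem i hi).integrable_sq (integrable_const _) fun ω => ?_
      exact (sq_le_one_iff_abs_le_one _).2 (h1 i hi ω)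
    simpa using this
  have hc : T.card * e ≤ cov[F, ∑ i ∈ T, H i; P] := by
    have : cov[F, ∑ i ∈ T, H i; P] = ∑ i ∈ T, cov[F, H i; P] := covariance_sum_right' hmem hF
    rw [this, ← nsmul_eq_mul, ← Finset.sum_const]
    refine Finset.sum_le_sum fun i hi => ?_
    rw [covariance_eq_sub hF (hmem i hi), h0 i hi, mul_zero, sub_zero]
    exact hcov i hi
  -- With `n` functions, expanding this variance gives `Var F ≥ 2e · ne - e² · n = ne²`.
  have h2 := variance_nonneg (fun ω => F ω - (e • ∑ i ∈ T, H i) ω) P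
  rw [variance_fun_sub hF (hsum.const_smul e), covariance_smul_right, variance_smul] at h2
  nlinarith [mul_le_mul_of_nonneg_left hc he, mul_le_mul_of_nonneg_left hvar (sq_nonneg e)]

namespace HypSpace

variable {d : ℕ} [NeZero d]

/-- Centres stay `4ρ` away from the root, as a fork requires, and `2ρ` away from the boundary. Their
separation makes the `2ρ`-balls disjoint. Every point of the ball is within `8ρ` of the annulus, and
`8 + 4 = 12`. -/
theorem exists_separated_annulus (hd : 2 ≤ d) (o : HypSpace d) {ρ R : ℝ} (hρ : 0 < ρ)
    (hR : 8 * ρ ≤ R) :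
    ∃ T : Finset (HypSpace d), (∀ z ∈ T, 4 * ρ ≤ dist o z ∧ dist o z ≤ R - 2 * ρ) ∧
      (∀ x ∈ T, ∀ y ∈ T, x ≠ y → 4 * ρ ≤ dist x y) ∧
      Metric.ball o R ⊆ ⋃ y ∈ T, Metric.ball y (12 * ρ) := by
  obtain ⟨T, hTA, hTs, hTc⟩ := exists_maximal_separated_ball hd o (R := R)
    (show 0 < 4 * ρ by positivity) (A := {x | 4 * ρ ≤ dist o x ∧ dist o x ≤ R - 2 * ρ})
    fun x hx => by
      rw [Metric.mem_ball, dist_comm]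
      linarith [hx.2]
  refine ⟨T, fun z hz => hTA hz, hTs, fun x hx => ?_⟩
  rw [Metric.mem_ball, dist_comm] at hx
  obtain ⟨a, ha1, ha2, hxa⟩ : ∃ a, 4 * ρ ≤ dist o a ∧ dist o a ≤ R - 2 * ρ ∧ dist x a ≤ 8 * ρ := by
    rcases lt_or_ge (dist o x) (4 * ρ) with h | h
    · obtain ⟨a, ha⟩ := exists_dist_eq o (show 0 ≤ 4 * ρ by positivity)
      rw [dist_comm] at ha
      exact ⟨a, ha.ge, by linarith, by linarith [dist_triangle x o a, dist_comm x o]⟩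
    rcases le_or_gt (dist o x) (R - 2 * ρ) with h' | h'
    · exact ⟨x, h, h', by rw [dist_self]; positivity⟩
    · obtain ⟨a, ha, ha'⟩ := exists_between o x (show 0 ≤ 2 * ρ by positivity) (by linarith)
      exact ⟨a, by linarith, by linarith, by rw [dist_comm]; linarith⟩
  obtain ⟨y, hy, hay⟩ := hTc a ⟨ha1, ha2⟩
  refine Set.mem_biUnion (Finset.mem_coe.2 hy) ?_
  rw [Metric.mem_ball]
  linarith [dist_triangle x a y]

/-- Each centre carries a fork whose local variable has correlation at least `A * ρ ^ α` with the
functional. Covering by `12ρ`-balls shows that there are at least of order `V(R) / ρ ^ d` centres.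
-/
theorem exists_le_variance (hd : 2 ≤ d) {α : ℝ} (hα : 0 < α) {β : ℝ} (hβ : 0 < β) :
    ∃ k : ℝ, 0 < k ∧ ∀ (o : HypSpace d) (γ ρ R : ℝ), 0 < γ → 0 < ρ → ρ ≤ 1 / 2 → γ * ρ ^ d = β →
      4 ≤ R → ∀ (Ω : Type*) [MeasurableSpace Ω] (P : Measure Ω) [IsProbabilityMeasure P]
        (η : Ω → Set (HypSpace d)), IsPoissonProcess P η (ENNReal.ofReal γ • hypVolume d) →
        MemLp (fun ω => edgeLengthFunctional o α R (η ω)) 2 P →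
        k * (ρ ^ (2 * α) / ρ ^ d) * ballVolume o R ≤
          Var[fun ω => edgeLengthFunctional o α R (η ω); P] := by
  obtain ⟨c, hc0, hc⟩ := exists_le_hypVolume_ball hd
  obtain ⟨C, hC0, hC⟩ := exists_hypVolume_ball_le (d := d)
  obtain ⟨A, hA⟩ : ∃ A, A = ((23 / 20 : ℝ) ^ α - (21 / 20) ^ α) *
    (Real.exp (-(C * β * (2 * Real.exp 4) ^ d)) ^ 3 *
      (1 - Real.exp (-(c * β / 100 ^ d))) ^ 4) := ⟨_, rfl⟩
  have hA0 : 0 < A := by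
    have h1 : (21 / 20 : ℝ) ^ α < (23 / 20) ^ α :=
      Real.rpow_lt_rpow (by norm_num) (by norm_num) hα
    have h2 : Real.exp (-(c * β / 100 ^ d)) < 1 :=
      Real.exp_lt_one_iff.2 (neg_lt_zero.2 (by positivity))
    rw [hA]
    exact mul_pos (sub_pos.2 h1) (mul_pos (by positivity) (pow_pos (sub_pos.2 h2) 4))
  refine ⟨A ^ 2 / (C * (12 * Real.exp 12) ^ d), by positivity, ?_⟩
  intro o γ ρ R hγ hρ hρ1 hβρ hR Ω _ P _ η hη hF
  obtain ⟨T, hTA, hTs, hTc⟩ := exists_separated_annulus hd o hρ (show 8 * ρ ≤ R by linarith)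
  have hcell : ∀ z ∈ T, ∃ H : Ω → ℝ, Measurable[regionSigma η (Metric.ball z (2 * ρ))] H ∧
      (∀ ω, |H ω| ≤ 1) ∧ ∫ ω, H ω ∂P = 0 ∧
      A * ρ ^ α ≤ ∫ ω, edgeLengthFunctional o α R (η ω) * H ω ∂P := by
    intro z hz
    obtain ⟨t, u, w, hfork⟩ := exists_isFork hd o z hρ hρ1 (hTA z hz).1
    obtain ⟨H, h1, h2, h3, h4⟩ := hfork.exists_correlated hc0 hC0 hc hC hη hγ (by linarith) hα.le
      (R := R) (Metric.ball_subset_ball' (by linarith [(hTA z hz).2, dist_comm o z]))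
    refine ⟨H, h1, h2, h3, le_of_eq_of_le ?_ h4⟩
    rw [hA, hβρ, Real.mul_rpow (by norm_num) hρ.le, Real.mul_rpow (by norm_num) hρ.le]
    ring
  choose! H hHm hH1 hH0 hHF using hcell
  have hvar := card_mul_sq_le_variance hF
    (fun z hz => (hHm z hz).mono (hη.regionSigma_le _) le_rfl) hH1 hH0
    (fun x hx y hy hxy => hη.indepFun_of_regionSigma measurableSet_ball measurableSet_ball
      (Metric.ball_disjoint_ball (by linarith [hTs x hx y hy hxy])) (hHm x hx) (hHm y hy))
    (show 0 ≤ A * ρ ^ α by positivity) hHF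
  refine le_trans ?_ hvar
  have hcard : ballVolume o R ≤ T.card * (C * (12 * Real.exp 12) ^ d * ρ ^ d) := by
    have h1 : hypVolume d (Metric.ball o R) ≤
        ∑ _y ∈ T, ENNReal.ofReal (C * (12 * Real.exp 12) ^ d * ρ ^ d) := by
      refine (measure_mono hTc).trans ((measure_biUnion_finset_le _ _).trans
        (Finset.sum_le_sum fun y _ => (hC y (12 * ρ) (by positivity)).trans
          (ENNReal.ofReal_le_ofReal ?_)))
      rw [mul_assoc C, ← mul_pow, show 12 * Real.exp 12 * ρ = 12 * ρ * Real.exp 12 by ring]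
      gcongr
      linarith
    rw [Finset.sum_const, nsmul_eq_mul] at h1
    have h2 := ENNReal.toReal_mono
      (ENNReal.mul_ne_top (ENNReal.natCast_ne_top _) ENNReal.ofReal_ne_top) h1
    rwa [ENNReal.toReal_mul, ENNReal.toReal_ofReal (by positivity), ENNReal.toReal_natCast] at h2
  have hρα : (ρ ^ α) ^ 2 = ρ ^ (2 * α) := by
    rw [mul_comm, Real.rpow_mul hρ.le]
    norm_num
  calc A ^ 2 / (C * (12 * Real.exp 12) ^ d) * (ρ ^ (2 * α) / ρ ^ d) * ballVolume o R
      ≤ A ^ 2 / (C * (12 * Real.exp 12) ^ d) * (ρ ^ (2 * α) / ρ ^ d) *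
          (T.card * (C * (12 * Real.exp 12) ^ d * ρ ^ d)) := by gcongr
    _ = T.card * (A * ρ ^ α) ^ 2 := by
        rw [mul_pow A, hρα]
        field_simp

end HypSpace

end

theorem proposition8p5 (d : ℕ) [NeZero d] (hd : 2 ≤ d) (α : ℝ) (hα : 0 < α) (c₀ : ℝ)
    (hc₀ : 0 < c₀) :
    ∃ cl cu r₀ : ℝ, 0 < cl ∧ 0 < cu ∧ 0 < r₀ ∧
      ∀ (o : HypSpace d) (γ R : ℝ), c₀ ≤ γ → r₀ ≤ R →
        ∀ (Ω : Type*) [MeasurableSpace Ω] (P : Measure Ω) [IsProbabilityMeasure P]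
          (η : Ω → Set (HypSpace d)),
          IsPoissonProcess P η (ENNReal.ofReal γ • HypSpace.hypVolume d) →
          MemLp (fun ω => edgeLengthFunctional o α R (η ω)) 2 P ∧
          cl * γ ^ (1 - 2 * α / (d : ℝ)) * HypSpace.ballVolume o R ≤
            Var[fun ω => edgeLengthFunctional o α R (η ω); P] ∧
          Var[fun ω => edgeLengthFunctional o α R (η ω); P] ≤
            cu * γ ^ (1 - 2 * α / (d : ℝ)) * HypSpace.ballVolume o R := by
  -- With this value `γ ≥ c₀` is equivalent to `ρ ≤ 1/2`, where `ρ` solves `γ * ρ ^ d = β`.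
  obtain ⟨β, hβ⟩ : ∃ β, β = c₀ * (1 / 2) ^ d := ⟨_, rfl⟩
  have hβ0 : 0 < β := by rw [hβ]; positivity
  obtain ⟨K, hK0, hK⟩ := HypSpace.exists_variance_le hd hα hβ0
  obtain ⟨k, hk0, hk⟩ := HypSpace.exists_le_variance hd hα hβ0
  have hb : 0 < β ^ (2 * α / (d : ℝ) - 1) := by positivity
  refine ⟨k * β ^ (2 * α / (d : ℝ) - 1), K * β ^ (2 * α / (d : ℝ) - 1), 4, by positivity,
    by positivity, by norm_num, ?_⟩
  intro o γ R hγ hR Ω _ P _ η hη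
  have hγ0 : 0 < γ := hc₀.trans_le hγ
  have hd0 : d ≠ 0 := NeZero.ne d
  obtain ⟨ρ, hρ⟩ : ∃ ρ, ρ = (β / γ) ^ (1 / (d : ℝ)) := ⟨_, rfl⟩
  have hρ0 : 0 < ρ := by rw [hρ]; positivity
  have hρd : ρ ^ d = β / γ := by
    rw [hρ, one_div, Real.rpow_inv_natCast_pow (by positivity) hd0]
  have hγρ : γ * ρ ^ d = β := by rw [hρd]; field_simp
  have hρ1 : ρ ≤ 1 / 2 := by
    refine le_of_pow_le_pow_left₀ hd0 (by norm_num) ?_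
    rw [hρd, div_le_iff₀ hγ0, hβ, mul_comm]
    gcongr
  -- Both bounds are multiples of the left side; the fixed power of `β` goes into the constants.
  have hscale : ρ ^ (2 * α) / ρ ^ d =
      β ^ (2 * α / (d : ℝ) - 1) * γ ^ (1 - 2 * α / (d : ℝ)) := by
    have h1 : ρ ^ (2 * α) = (β / γ) ^ (2 * α / (d : ℝ)) := by
      rw [hρ, ← Real.rpow_mul (by positivity)]
      congr 1
      ring
    rw [h1, hρd, ← Real.rpow_sub_one (by positivity), Real.div_rpow hβ0.le hγ0.le, div_eq_mul_inv,
      ← Real.rpow_neg hγ0.le, neg_sub]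
  obtain ⟨hmem, hup⟩ := hK o γ ρ R hγ0 hρ0 (by linarith) hγρ (by linarith) Ω P η hη
  have hlow := hk o γ ρ R hγ0 hρ0 hρ1 hγρ hR Ω P η hη hmem
  rw [hscale, ← mul_assoc] at hup hlow
  exact ⟨hmem, hlow, hup⟩
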